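/- Let $H$ be a real Hilbert space and let $A:D(A)\to H$ be a positive self-adjoint operator with compact inverse, with eigenvalues $\lambda_1\le\lambda_2\le\cdots$ (counted with multiplicity) and a corresponding complete orthonormal system of eigenvectors $\{e_n\}_{n=1}^\infty$. For $s\in\mathbb R$ put $H^s:=D(A^{s/2})$, $\|u\|_{H^s}^2:=\sum_{n}\lambda_n^s u_n^2$ for $u=\sum_n u_ne_n$. For $\varepsilon\ge 0$ let $\mathcal E_\varepsilon:=H^1\times H$ if $\varepsilon\neq0$ and $\mathcal E_0:=H^1\times H^{-1}$, with the norm $$\|(u,v)\|_{\mathcal E_\varepsilon}^2:=\varepsilon\|v\|_H^2+\|v\|_{H^{-1}}^2+\|u\|_{H^1}^2 .$$ Let $F:H\to H$ satisfy $F(0)=0$ and $\|F(u_1)-F(u_2)\|_H\le L\|u_1-u_2\|_H$ for all $u_1,u_2\in H$. Let $N\in\mathbb N$, $N\ge1$, and let $P_NH$ be the span of $e_1,\dots,e_N$. For $\varepsilon\ge0$ with $4\varepsilon\lambda_N<1$ define $$\widehat{\mathcal P}_N v:=\sum_{n=1}^N\frac{\varepsilon}{\sqrt{1-4\varepsilon\lambda_n}}\,v_ne_n,\qquad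 \mathcal P_Nu:=\sum_{n=1}^N\frac{1+\sqrt{1-4\varepsilon\lambda_n}}{2\sqrt{1-4\varepsilon\lambda_n}}\,u_ne_n,$$ and let $\theta=\theta_\varepsilon$ be the smallest root of $2\theta(\varepsilon\theta-1)+\lambda_{N+1}+\lambda_N=0$ (so $\theta_0=(\lambda_N+\lambda_{N+1})/2$). For $p\in P_NH$ consider the backward problem $$\varepsilon\partial_t^2u+\partial_tu+Au=F(u),\quad t\le0,\qquad \widehat{\mathcal P}_N\partial_tu(0)+\mathcal P_Nu(0)=p,\qquad \int_{-\infty}^0e^{2\theta_\varepsilon t}\|u(t)\|_H^2\,dt<\infty, \tag{$*$}$$ where $(u,\partial_tu)\in C((-\infty,0],\mathcal E_\varepsilon)$ and the equation is understood in $H^{-1}$; for $\varepsilon=0$ it reads $\partial_tu+Au=F(u)$, $P_Nu(0)=p$. Assume that $\lambda_{N+1}-\lambda_N>2L$. Then there is a constant $C$ such that for every $\varepsilon>0$ with $3\lambda_{N+1}+\lambda_N\le\frac1\varepsilon$ and every $p\in P_NH$ the following holds. Problem $(*)$ has a unique solution $u_\varepsilon$ for this $\varepsilon$ and a unique solution $u_0$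 for the parameter value $0$, so that the maps $$M_\varepsilon(p):=(u_\varepsilon(0),\partial_tu_\varepsilon(0)),\qquad M_0(p):=(u_0(0),\partial_tu_0(0)),$$ which generate the manifolds $\mathcal M_\varepsilon=M_\varepsilon(P_NH)$ and $\mathcal M_0=M_0(P_NH)$, are well defined; moreover $M_\varepsilon(p)-M_0(p)\in\mathcal E_\varepsilon$ and $$\|M_\varepsilon(p)-M_0(p)\|_{\mathcal E_\varepsilon}\le C\varepsilon\|p\|_H .$$ The constant $C$ does not depend on $\varepsilon$ or $p$. -/

import Mathlib

open Set Filter Topology MeasureTheory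

noncomputable section

namespace HypRelax

variable {H : Type*} [NormedAddCommGroup H] [InnerProductSpace ℝ H] [CompleteSpace H]

/-- `A : D(A) → H` is a positive self-adjoint (in general unbounded) operator in the Hilbert
space `H` with compact inverse. -/
structure IsPositiveSelfAdjointCompactInv (A : H →ₗ.[ℝ] H) : Prop where
  dense_domain : Dense (A.domain : Set H)
  selfAdjoint : IsSelfAdjoint A
  pos : ∀ x : A.domain, x ≠ 0 → 0 < inner ℝ (A x) (x : H)
  compact_inv : ∃ B : H →L[ℝ] H, IsCompactOperator B ∧
    (∀ f : H, ∃ hf : B f ∈ A.domain, A ⟨B f, hf⟩ = f) ∧ ∀ x : A.domain, B (A x) = x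

/-- `lam 1 ≤ lam 2 ≤ ...` are the eigenvalues of `A`, repeated according to multiplicity and
enumerated in the non-decreasing order, and `e` is a corresponding complete orthonormal system of
eigenvectors. -/
structure IsEigenSystem (A : H →ₗ.[ℝ] H) (e : HilbertBasis ℕ+ ℝ H) (lam : ℕ+ → ℝ) : Prop where
  mono : Monotone lam
  eigen : ∀ n, ∃ h : e n ∈ A.domain, A ⟨e n, h⟩ = lam n • e n

/-- The Fourier coefficients `u_n = (u, e_n)`. -/
def coeff (e : HilbertBasis ℕ+ ℝ H) (u : H) : ℕ+ → ℝ := fun n => inner ℝ (e n) u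

/-- Membership in `H^s = D(A^{s/2})`. For every real `s`, an element of `H^s` is described by the
sequence `a` of its Fourier coefficients (for negative `s` it need not be an element of `H`). -/
def MemHs (lam : ℕ+ → ℝ) (s : ℝ) (a : ℕ+ → ℝ) : Prop := Summable fun n => lam n ^ s * a n ^ 2

/-- The square of the norm of `H^s`. -/
def normSqHs (lam : ℕ+ → ℝ) (s : ℝ) (a : ℕ+ → ℝ) : ℝ := ∑' n, lam n ^ s * a n ^ 2

/-- Membership of a pair `ξ = (u, v)` in the energy space `𝓔_ε`, which is `H¹ × H` for `ε ≠ 0` and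
`H¹ × H⁻¹` for `ε = 0`. The component `v` is given by its Fourier coefficients. -/
structure MemEnergy (e : HilbertBasis ℕ+ ℝ H) (lam : ℕ+ → ℝ) (ε : ℝ) (ξ : H × (ℕ+ → ℝ)) :
    Prop where
  fst_mem : MemHs lam 1 (coeff e ξ.1)
  snd_mem : MemHs lam (-1) ξ.2
  snd_mem' : ε ≠ 0 → MemHs lam 0 ξ.2

/-- The norm of `𝓔_ε`: `‖(u, v)‖² = ε ‖v‖²_H + ‖v‖²_{H⁻¹} + ‖u‖²_{H¹}`. -/
def energyNorm (e : HilbertBasis ℕ+ ℝ H) (lam : ℕ+ → ℝ) (ε : ℝ) (ξ : H × (ℕ+ → ℝ)) : ℝ :=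
  Real.sqrt (ε * normSqHs lam 0 ξ.2 + normSqHs lam (-1) ξ.2 + normSqHs lam 1 (coeff e ξ.1))

/-- The space `P_N H` spanned by the first `N` eigenvectors. -/
def spanPN (e : HilbertBasis ℕ+ ℝ H) (N : ℕ+) : Submodule ℝ H :=
  Submodule.span ℝ (e '' Set.Iic N)

/-- The operator `v ↦ ∑_{n ≤ N} ε / √(1 - 4 ε λ_n) v_n e_n`. -/
def projHat (e : HilbertBasis ℕ+ ℝ H) (lam : ℕ+ → ℝ) (N : ℕ+) (ε : ℝ) (a : ℕ+ → ℝ) : H :=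
  ∑ n ∈ Finset.Icc 1 N, (ε / Real.sqrt (1 - 4 * ε * lam n) * a n) • e n

/-- The operator `u ↦ ∑_{n ≤ N} (1 + √(1 - 4 ε λ_n)) / (2 √(1 - 4 ε λ_n)) u_n e_n`; for `ε = 0` it
is the orthogonal projector onto `P_N H`. -/
def projCal (e : HilbertBasis ℕ+ ℝ H) (lam : ℕ+ → ℝ) (N : ℕ+) (ε : ℝ) (a : ℕ+ → ℝ) : H :=
  ∑ n ∈ Finset.Icc 1 N,
    ((1 + Real.sqrt (1 - 4 * ε * lam n)) / (2 * Real.sqrt (1 - 4 * ε * lam n)) * a n) • e n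

/-- The exponent `θ`: the smallest root of `2 θ (ε θ - 1) + λ_{N+1} + λ_N = 0`. For `ε = 0` this is
the only root `(λ_{N+1} + λ_N) / 2`. -/
def theta (lam : ℕ+ → ℝ) (N : ℕ+) (ε : ℝ) : ℝ :=
  sInf {θ : ℝ | 2 * θ * (ε * θ - 1) + lam (N + 1) + lam N = 0}

/-- `ξ = (u, ∂_t u)` is a trajectory in `C((-∞, 0], 𝓔_ε)` of
`ε ∂_t² u + ∂_t u + A u = F(u)`, `t ≤ 0`, with `∫_{-∞}^0 e^{2 θ t} ‖u(t)‖² dt < ∞`, `θ = θ_ε`, and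
with the condition `P̂_N ∂_t u(0) + 𝒫_N u(0) = p`.
The equation is an equality in `H⁻¹`, written out in Fourier coefficients (there `A` is the
multiplication by `λ_n`); derivatives at `t = 0` are left derivatives. For `ε = 0` the field
`equation` says that `0 = F(u) - A u - ∂_t u`. -/
structure IsSlowBackwardSolution (e : HilbertBasis ℕ+ ℝ H) (lam : ℕ+ → ℝ) (F : H → H) (N : ℕ+)
    (ε : ℝ) (p : H) (ξ : ℝ → H × (ℕ+ → ℝ)) : Prop where
  mem : ∀ t ≤ 0, MemEnergy e lam ε (ξ t)
  cont : ∀ t ≤ 0, Tendsto (fun s => energyNorm e lam ε (ξ s - ξ t)) (𝓝[Set.Iic 0] t) (𝓝 0)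
  velocity : ∀ t ≤ 0, ∀ n,
    HasDerivWithinAt (fun s => coeff e (ξ s).1 n) ((ξ t).2 n) (Set.Iic 0) t
  equation : ∀ t ≤ 0, ∀ n,
    HasDerivWithinAt (fun s => ε * (ξ s).2 n)
      (coeff e (F (ξ t).1) n - lam n * coeff e (ξ t).1 n - (ξ t).2 n) (Set.Iic 0) t
  slow : IntegrableOn (fun t => Real.exp (2 * theta lam N ε * t) * ‖(ξ t).1‖ ^ 2) (Set.Iic 0)
  initial : projHat e lam N ε (ξ 0).2 + projCal e lam N ε (coeff e (ξ 0).1) = p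

/-- The backward problem with datum `p` has exactly one solution on `(-∞, 0]`. -/
def UniquelySolvable (e : HilbertBasis ℕ+ ℝ H) (lam : ℕ+ → ℝ) (F : H → H) (N : ℕ+) (ε : ℝ)
    (p : H) : Prop :=
  (∃ ξ, IsSlowBackwardSolution e lam F N ε p ξ) ∧
    ∀ ξ η, IsSlowBackwardSolution e lam F N ε p ξ → IsSlowBackwardSolution e lam F N ε p η →
      Set.EqOn ξ η (Set.Iic 0)

open Classical in
/-- The map `M_ε(p) = (u(0), ∂_t u(0))`, where `u` is the solution of the backward problem with
datum `p` (the value is meaningful when that problem is uniquely solvable). The manifold `𝓜_ε` is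
the image of `P_N H` under this map. -/
def manifoldMap (e : HilbertBasis ℕ+ ℝ H) (lam : ℕ+ → ℝ) (F : H → H) (N : ℕ+) (ε : ℝ) (p : H) :
    H × (ℕ+ → ℝ) :=
  if h : ∃ ξ, IsSlowBackwardSolution e lam F N ε p ξ then h.choose 0 else 0

end HypRelax

end

/-! In Fourier coefficients every mode solves `ε u'' + u' + λ u = h`. Conjugation with `e^{θt}`
gives `ε w'' + κ w' + d w = g`, where `κ = 1 - 2εθ` and, by the equation for `θ`, `d = λ - (λ_N +
λ_{N+1})/2`. Hence `|d| ≥ δ := (λ_{N+1} - λ_N)/2` for every mode. One energy functional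
(`DampedSol.energy_le`) then yields `‖w‖ ≤ δ⁻¹ ‖g‖` in `L²(-∞, 0)`: on fast modes it is coercive,
which is where `ε (3 λ_{N+1} + λ_N) ≤ 1` enters, and on slow modes it has the right sign at `t = 0`
when the slow coordinate vanishes (`GapData.boundary_nonneg`). Since `L < δ`, sending `w` to the
solution of the linear problem with forcing `F(w)` is a contraction, and `uniquelySolvable` follows
for every admissible `ε ≥ 0`.

For the `O(ε)` bound, `u₀` cannot simply be inserted into the hyperbolic equation: `F` is only
Lipschitz, so `∂_t² u₀` is not under control. Instead `u` is compared with the exponential time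
average `u₀ - ε c` of `u₀`, where `ε c' + c = ∂_t u₀`. The difference `u - u₀ + ε c` has velocity `v
- c` and solves the hyperbolic equation with forcing `F(u) - F(u₀) + ε A c` and a final datum of
size `O(ε)`. The term `ε A c` is small because `∂_t u₀` lies in weighted `L²(H²)` and `L^∞(H¹)`,
which difference quotients in time prove (`exists_regularity`).

The energy estimate then controls the displacement in `H¹` and `√ε ‖v - c‖` in `H`. Two facts
complete the velocity bound, both obtained by reading an equation as a relaxation `ε y' + y = s`: `v
- c` is `O(ε)` in `H⁻¹` (`exists_vel_le`), and `c - ∂_t u₀ - ε A c` at `t = 0` is `O(ε)` in `H`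
(`exists_defect_le`). -/

set_option linter.unusedSectionVars false

/-! ### Calculus on the half-line and scalar first order equations -/

namespace HypRelax

/-- Fatou's lemma for real-valued nonnegative functions. -/
lemma integrableOn_and_integral_le_of_tendsto {ι : Type*} {l : Filter ι} [l.NeBot]
    [l.IsCountablyGenerated] {f : ι → ℝ → ℝ} {g : ℝ → ℝ} {B : ι → ℝ} {b : ℝ} {s : Set ℝ}
    (hs : MeasurableSet s) (hf : ∀ i, IntegrableOn (f i) s) (hnn : ∀ i, ∀ t ∈ s, 0 ≤ f i t)
    (hB : ∀ i, ∫ t in s, f i t ≤ B i) (hlim : ∀ t ∈ s, Tendsto (fun i => f i t) l (𝓝 (g t)))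
    (hb : Tendsto B l (𝓝 b)) : IntegrableOn g s ∧ ∫ t in s, g t ≤ b := by
  have hg0 : ∀ t ∈ s, 0 ≤ g t := fun t ht =>
    ge_of_tendsto (hlim t ht) (Eventually.of_forall fun i => hnn i t ht)
  have hgm : AEStronglyMeasurable g (volume.restrict s) :=
    aestronglyMeasurable_of_tendsto_ae l (fun i => (hf i).1)
      ((ae_restrict_iff' hs).2 (Eventually.of_forall hlim))
  have hb0 : 0 ≤ b := ge_of_tendsto hb (Eventually.of_forall fun i =>
    (setIntegral_nonneg hs (hnn i)).trans (hB i))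
  have key : ∫⁻ t in s, ENNReal.ofReal (g t) ≤ ENNReal.ofReal b := by
    have h1 : ∫⁻ t in s, ENNReal.ofReal (g t)
        = ∫⁻ t in s, l.liminf (fun i => ENNReal.ofReal (f i t)) := by
      refine setLIntegral_congr_fun hs fun t ht => ?_
      exact ((ENNReal.continuous_ofReal.tendsto _).comp (hlim t ht)).liminf_eq.symm
    rw [h1]
    refine (lintegral_liminf_le' fun i => (hf i).1.aemeasurable.ennreal_ofReal).trans ?_
    have h2 : Tendsto (fun i => ENNReal.ofReal (B i)) l (𝓝 (ENNReal.ofReal b)) :=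
      (ENNReal.continuous_ofReal.tendsto _).comp hb
    rw [← h2.liminf_eq]
    refine liminf_le_liminf (Eventually.of_forall fun i => ?_)
    rw [← ofReal_integral_eq_lintegral_ofReal (hf i)
      ((ae_restrict_iff' hs).2 (Eventually.of_forall (hnn i)))]
    exact ENNReal.ofReal_le_ofReal (hB i)
  have hae : 0 ≤ᵐ[volume.restrict s] g := (ae_restrict_iff' hs).2 (Eventually.of_forall hg0)
  constructor
  · refine ⟨hgm, ?_⟩
    rw [hasFiniteIntegral_iff_ofReal hae]
    exact key.trans_lt ENNReal.ofReal_lt_top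
  · rw [integral_eq_lintegral_of_nonneg_ae hae hgm]
    exact ENNReal.toReal_le_of_le_ofReal hb0 key

/-- An integrable function on a half-line is small along a sequence tending to `-∞`. -/
lemma frequently_lt_of_integrableOn_Iic {f : ℝ → ℝ} (hf : IntegrableOn f (Iic 0)) {η : ℝ}
    (hη : 0 < η) : ∃ᶠ T in atBot, f T < η := by
  intro h
  obtain ⟨M, hM⟩ := (h.and (eventually_le_atBot (0 : ℝ))).exists_forall_of_atBot
  have hM0 : M ≤ 0 := (hM M le_rfl).2
  have h1 : IntegrableOn (fun _ : ℝ => η) (Iic M) := by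
    refine Integrable.mono' (hf.mono_set (Iic_subset_Iic.2 hM0)) aestronglyMeasurable_const ?_
    refine (ae_restrict_iff' measurableSet_Iic).2 (Eventually.of_forall fun t ht => ?_)
    rw [Real.norm_of_nonneg hη.le]
    exact not_lt.1 (hM t ht).1
  rw [integrableOn_const_iff] at h1
  rcases h1 with h1 | h1
  · exact hη.ne' (by simpa using h1)
  · simp at h1

lemma hasDerivAt_of_hasDerivWithinAt_Iic {E : Type*} [NormedAddCommGroup E] [NormedSpace ℝ E]
    {f : ℝ → E} {f' : E} {t : ℝ} (h : HasDerivWithinAt f f' (Iic 0) t) (ht : t < 0) :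
    HasDerivAt f f' t :=
  h.hasDerivAt (Iic_mem_nhds ht)

/-- Integrated form of a differential inequality on a compact interval of the half-line. -/
lemma sub_le_integral_of_deriv_le {E E' f : ℝ → ℝ} {T t : ℝ} (hT : T ≤ t) (ht : t ≤ 0)
    (hd : ∀ s ≤ 0, HasDerivWithinAt E (E' s) (Iic 0) s) (hle : ∀ s ≤ 0, E' s ≤ f s)
    (hf : IntegrableOn f (Icc T t)) : E t - E T ≤ ∫ s in T..t, f s := by
  refine intervalIntegral.sub_le_integral_of_hasDeriv_right_of_le hT (g' := E') ?_ ?_ hf ?_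
  · intro s hs
    exact (hd s (hs.2.trans ht)).continuousWithinAt.mono
      (fun x hx => (hx.2.trans ht : x ≤ 0))
  · intro s hs
    exact (hasDerivAt_of_hasDerivWithinAt_Iic (hd s (hs.2.le.trans ht))
      (hs.2.trans_le ht)).hasDerivWithinAt
  · intro s hs
    exact hle s (hs.2.le.trans ht)

/-- Integrated form of a differential inequality on the half-line, for a quantity which is small
along a sequence tending to `-∞`. -/
lemma le_integral_of_deriv_le {E E' f : ℝ → ℝ} {t : ℝ} (ht : t ≤ 0)
    (hd : ∀ s ≤ 0, HasDerivWithinAt E (E' s) (Iic 0) s) (hle : ∀ s ≤ 0, E' s ≤ f s)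
    (hf : IntegrableOn f (Iic 0)) (hsm : ∀ η > 0, ∃ᶠ T in atBot, E T < η) :
    E t ≤ ∫ s in Iic t, f s := by
  refine le_of_forall_pos_le_add fun η hη => ?_
  have hlim := intervalIntegral_tendsto_integral_Iic t
    (hf.mono_set (Iic_subset_Iic.2 ht)) (tendsto_id (α := ℝ) (x := atBot))
  have h1 := hlim.eventually (gt_mem_nhds (show (∫ s in Iic t, f s) < (∫ s in Iic t, f s) + η / 2
    by linarith))
  obtain ⟨T, hT1, hT2, hT3⟩ :=
    ((hsm (η / 2) (by linarith)).and_eventually (h1.and (eventually_le_atBot t))).exists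
  have := sub_le_integral_of_deriv_le hT3 ht hd hle (hf.mono_set fun x hx => hx.2.trans ht)
  simp only [id] at hT2
  linarith

lemma nonpos_of_deriv_nonpos {E E' : ℝ → ℝ} {t : ℝ} (ht : t ≤ 0)
    (hd : ∀ s ≤ 0, HasDerivWithinAt E (E' s) (Iic 0) s) (hle : ∀ s ≤ 0, E' s ≤ 0)
    (hsm : ∀ η > 0, ∃ᶠ T in atBot, E T < η) : E t ≤ 0 := by
  simpa using le_integral_of_deriv_le (f := fun _ => 0) ht hd hle integrableOn_zero hsm

lemma integrableOn_Iic_of_integral_le {f : ℝ → ℝ} (hc : ContinuousOn f (Iic 0))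
    (h0 : ∀ t ≤ 0, 0 ≤ f t) {M : ℝ} (hM : ∀ T ≤ 0, ∫ t in T..0, f t ≤ M) :
    IntegrableOn f (Iic 0) := by
  refine integrableOn_Iic_of_intervalIntegral_norm_bounded (l := atBot) (a := id) M 0
    (fun T => ?_) tendsto_id ?_
  · exact ((hc.mono fun x hx => hx.2).integrableOn_compact isCompact_Icc).mono_set Ioc_subset_Icc_self
  · filter_upwards [eventually_le_atBot 0] with T hT
    refine le_trans (le_of_eq ?_) (hM T hT)
    refine intervalIntegral.integral_congr fun t ht => ?_
    rw [id, uIcc_of_le hT] at ht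
    exact Real.norm_of_nonneg (h0 t ht.2)

/-- Differentiating `σ‖z‖²` produces `2c‖z‖²` plus a cross term absorbed by Young's inequality. The
sign `σ = ±1` treats growing and decaying exponents together; `hM` is the boundary term, bounded
uniformly in `T`. -/
lemma integrableOn_normSq_of_linear_ode {ρ : ℂ} {g z : ℝ → ℂ} {σ c M : ℝ} (hc : 0 < c)
    (hσ : σ * ρ.re = c) (hσ1 : σ ^ 2 = 1) (hg : Continuous g)
    (hg2 : IntegrableOn (fun t => ‖g t‖ ^ 2) (Iic 0))
    (hz : ∀ t, HasDerivAt z (ρ * z t + g t) t)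
    (hM : ∀ T ≤ 0, σ * (‖z 0‖ ^ 2 - ‖z T‖ ^ 2) ≤ M) :
    IntegrableOn (fun t => ‖z t‖ ^ 2) (Iic 0) := by
  have hzc : Continuous z := continuous_iff_continuousAt.2 fun t => (hz t).continuousAt
  refine integrableOn_Iic_of_integral_le (by fun_prop) (fun t _ => by positivity)
    (M := (M + (∫ t in Iic 0, ‖g t‖ ^ 2) / c) / c) fun T hT => ?_
  have hd : ∀ s ≤ 0, HasDerivWithinAt (fun s => -(σ * ‖z s‖ ^ 2))
      (-(σ * (2 * inner ℝ (z s) (ρ * z s + g s)))) (Iic 0) s := fun s _ =>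
    (((hz s).norm_sq).const_mul σ).neg.hasDerivWithinAt
  have hle : ∀ s ≤ 0, -(σ * (2 * inner ℝ (z s) (ρ * z s + g s)))
      ≤ ‖g s‖ ^ 2 / c - c * ‖z s‖ ^ 2 := by
    intro s _
    have h1 : inner ℝ (z s) (ρ * z s) = ρ.re * ‖z s‖ ^ 2 := by
      rw [Complex.inner, ← Complex.normSq_eq_norm_sq]
      simp only [Complex.mul_re, Complex.mul_im, Complex.conj_re, Complex.conj_im,
        Complex.normSq_apply]
      ring
    rw [inner_add_right, h1]
    have h2 : |inner ℝ (z s) (g s)| ≤ ‖z s‖ * ‖g s‖ := abs_real_inner_le_norm _ _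
    have h3 : -(σ * inner ℝ (z s) (g s)) ≤ ‖z s‖ * ‖g s‖ := by
      have : |σ| = 1 := by rwa [← abs_one, ← sq_eq_sq_iff_abs_eq_abs, one_pow]
      calc -(σ * inner ℝ (z s) (g s)) ≤ |σ * inner ℝ (z s) (g s)| := neg_le_abs _
        _ = |inner ℝ (z s) (g s)| := by rw [abs_mul, this, one_mul]
        _ ≤ _ := h2
    have h4 : 2 * (‖z s‖ * ‖g s‖) ≤ c * ‖z s‖ ^ 2 + ‖g s‖ ^ 2 / c := by
      have : 0 ≤ (c * ‖z s‖ - ‖g s‖) ^ 2 / c := by positivity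
      have h5 : (c * ‖z s‖ - ‖g s‖) ^ 2 / c
        = c * ‖z s‖ ^ 2 + ‖g s‖ ^ 2 / c - 2 * (‖z s‖ * ‖g s‖) := by field_simp; ring
      linarith
    have h6 : σ * (2 * (ρ.re * ‖z s‖ ^ 2)) = 2 * c * ‖z s‖ ^ 2 := by rw [← hσ]; ring
    linarith
  have hi1 : IntervalIntegrable (fun s => ‖g s‖ ^ 2 / c) volume T 0 :=
    (by fun_prop : Continuous fun s => ‖g s‖ ^ 2 / c).intervalIntegrable _ _
  have hi2 : IntervalIntegrable (fun s => c * ‖z s‖ ^ 2) volume T 0 :=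
    (by fun_prop : Continuous fun s => c * ‖z s‖ ^ 2).intervalIntegrable _ _
  have h := sub_le_integral_of_deriv_le hT le_rfl hd hle
    ((by fun_prop : Continuous fun s => ‖g s‖ ^ 2 / c - c * ‖z s‖ ^ 2).integrableOn_Icc)
  rw [intervalIntegral.integral_sub hi1 hi2, intervalIntegral.integral_const_mul,
    intervalIntegral.integral_div] at h
  have hG : ∫ s in T..0, ‖g s‖ ^ 2 ≤ ∫ s in Iic 0, ‖g s‖ ^ 2 := by
    rw [intervalIntegral.integral_of_le hT]
    exact setIntegral_mono_set hg2 (Eventually.of_forall fun t => by positivity)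
      (Eventually.of_forall fun x hx => hx.2)
  have hG' : (∫ s in T..0, ‖g s‖ ^ 2) / c ≤ (∫ s in Iic 0, ‖g s‖ ^ 2) / c := by gcongr
  rw [le_div_iff₀ hc]
  have := hM T hT
  linarith

lemma hasDerivAt_duhamel {ρ K : ℂ} {g : ℝ → ℂ} (hg : Continuous g) (t : ℝ) :
    HasDerivAt (fun t : ℝ => Complex.exp (ρ * t) * (K + ∫ s in (0 : ℝ)..t, Complex.exp (-ρ * s) * g s))
      (ρ * (Complex.exp (ρ * t) * (K + ∫ s in (0 : ℝ)..t, Complex.exp (-ρ * s) * g s)) + g t) t := by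
  have h1 : HasDerivAt (fun t : ℝ => Complex.exp (ρ * t)) (Complex.exp (ρ * t) * (ρ * 1)) t :=
    (((hasDerivAt_id t).ofReal_comp.const_mul ρ).cexp)
  have hc : Continuous fun s : ℝ => Complex.exp (-ρ * s) * g s := by fun_prop
  have h2 := (intervalIntegral.integral_hasDerivAt_right (hc.intervalIntegrable 0 t)
    hc.stronglyMeasurable.stronglyMeasurableAtFilter hc.continuousAt).const_add K
  refine (h1.mul h2).congr_deriv ?_
  have : Complex.exp (ρ * t) * (Complex.exp (-ρ * t) * g t) = g t := by
    rw [← mul_assoc, ← Complex.exp_add]; simp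
  linear_combination this

/-- Solvability of a stable scalar linear equation on the half-line. -/
lemma exists_stable_solution {ρ : ℂ} (hρ : ρ.re < 0) {g : ℝ → ℂ} (hg : Continuous g)
    (hg2 : IntegrableOn (fun t => ‖g t‖ ^ 2) (Iic 0)) :
    ∃ z : ℝ → ℂ, (∀ t, HasDerivAt z (ρ * z t + g t) t) ∧
      IntegrableOn (fun t => ‖z t‖ ^ 2) (Iic 0) := by
  set c := -ρ.re with hc
  have hc0 : 0 < c := by simp [hc, hρ]
  have hcont : Continuous fun s : ℝ => Complex.exp (-ρ * s) * g s := by fun_prop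
  have hnorm : ∀ s : ℝ, ‖Complex.exp (-ρ * s) * g s‖ = Real.exp (c * s) * ‖g s‖ := fun s => by
    rw [norm_mul, Complex.norm_exp]; simp [hc]
  -- Young's inequality with `e^{ct}` factored out: after multiplication by `e^{-ct}` the integral
  -- of this majorant over `(-∞, t]` is bounded uniformly in `t ≤ 0`.
  have hbd : ∀ t s : ℝ, Real.exp (c * s) * ‖g s‖
      ≤ Real.exp (c * t) * ((Real.exp (-(2 * c * t)) * Real.exp (2 * c * s) + ‖g s‖ ^ 2) / 2) := by
    intro t s
    have h1 : Real.exp (c * s) = Real.exp (c * t) * Real.exp (c * (s - t)) := by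
      rw [← Real.exp_add]; ring_nf
    have h2 : Real.exp (-(2 * c * t)) * Real.exp (2 * c * s) = Real.exp (c * (s - t)) ^ 2 := by
      rw [← Real.exp_add, ← Real.exp_nat_mul]; ring_nf
    rw [h1, h2, mul_assoc]
    gcongr
    nlinarith [sq_nonneg (Real.exp (c * (s - t)) - ‖g s‖)]
  have hdom : ∀ t ≤ 0, IntegrableOn (fun s => Real.exp (c * t) *
      ((Real.exp (-(2 * c * t)) * Real.exp (2 * c * s) + ‖g s‖ ^ 2) / 2)) (Iic t) := fun t ht =>
    ((((integrableOn_exp_mul_Iic (by positivity) t).const_mul _).add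
      (hg2.mono_set (Iic_subset_Iic.2 ht))).div_const _).const_mul _
  have hint : ∀ t ≤ 0, IntegrableOn (fun s : ℝ => Complex.exp (-ρ * s) * g s) (Iic t) :=
    fun t ht => Integrable.mono' (hdom t ht) hcont.aestronglyMeasurable
      (Eventually.of_forall fun s => (hnorm s).le.trans (hbd t s))
  set K := ∫ s in Iic (0 : ℝ), Complex.exp (-ρ * s) * g s
  set z := fun t : ℝ => Complex.exp (ρ * t) * (K + ∫ s in (0 : ℝ)..t, Complex.exp (-ρ * s) * g s)
    with hzdef
  refine ⟨z, fun t => hasDerivAt_duhamel hg t, ?_⟩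
  set G := ∫ s in Iic (0 : ℝ), ‖g s‖ ^ 2
  have hzb : ∀ t ≤ 0, ‖z t‖ ≤ (1 / (2 * c) + G) / 2 := by
    intro t ht
    have h1 : K + ∫ s in (0 : ℝ)..t, Complex.exp (-ρ * s) * g s
        = ∫ s in Iic t, Complex.exp (-ρ * s) * g s := by
      rw [← intervalIntegral.integral_Iic_sub_Iic (hint 0 le_rfl) (hint t ht)]
      simp [K]
    have h2 : ‖Complex.exp (ρ * t)‖ = Real.exp (-(c * t)) := by
      rw [Complex.norm_exp]; simp [hc]
    rw [hzdef, norm_mul, h1, h2]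
    have h3 : ‖∫ s in Iic t, Complex.exp (-ρ * s) * g s‖ ≤ ∫ s in Iic t, Real.exp (c * t) *
      ((Real.exp (-(2 * c * t)) * Real.exp (2 * c * s) + ‖g s‖ ^ 2) / 2) :=
      norm_integral_le_of_norm_le (hdom t ht)
        (Eventually.of_forall fun s => (hnorm s).le.trans (hbd t s))
    rw [integral_const_mul, integral_div, integral_add
      ((integrableOn_exp_mul_Iic (by positivity) t).const_mul _)
      (hg2.mono_set (Iic_subset_Iic.2 ht)), integral_const_mul,
      integral_exp_mul_Iic (by positivity)] at h3
    have h4 : ∫ s in Iic t, ‖g s‖ ^ 2 ≤ G :=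
      setIntegral_mono_set hg2 (Eventually.of_forall fun t => by positivity)
        (Eventually.of_forall (Iic_subset_Iic.2 ht))
    have h5 : Real.exp (-(2 * c * t)) * (Real.exp (2 * c * t) / (2 * c)) = 1 / (2 * c) := by
      rw [← mul_div_assoc, ← Real.exp_add]; simp
    rw [h5] at h3
    calc Real.exp (-(c * t)) * ‖∫ s in Iic t, Complex.exp (-ρ * s) * g s‖
        ≤ Real.exp (-(c * t)) * (Real.exp (c * t) * ((1 / (2 * c) + ∫ s in Iic t, ‖g s‖ ^ 2) / 2)) := by
          gcongr
      _ = (1 / (2 * c) + ∫ s in Iic t, ‖g s‖ ^ 2) / 2 := by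
          rw [← mul_assoc, ← Real.exp_add]; simp
      _ ≤ _ := by gcongr
  refine integrableOn_normSq_of_linear_ode (σ := -1) hc0 (by simp [hc]) (by norm_num) hg hg2
    (fun t => hasDerivAt_duhamel hg t) (M := ((1 / (2 * c) + G) / 2) ^ 2) fun T hT => ?_
  have h1 : ‖z T‖ ^ 2 ≤ ((1 / (2 * c) + G) / 2) ^ 2 :=
    pow_le_pow_left₀ (norm_nonneg _) (hzb T hT) 2
  have h2 : 0 ≤ ‖z 0‖ ^ 2 := by positivity
  linarith

/-- Solvability of an unstable scalar linear equation on the half-line, with a prescribed final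
value. -/
lemma exists_unstable_solution {ρ : ℂ} (hρ : 0 < ρ.re) (z₀ : ℂ) {g : ℝ → ℂ} (hg : Continuous g)
    (hg2 : IntegrableOn (fun t => ‖g t‖ ^ 2) (Iic 0)) :
    ∃ z : ℝ → ℂ, (∀ t, HasDerivAt z (ρ * z t + g t) t) ∧ z 0 = z₀ ∧
      IntegrableOn (fun t => ‖z t‖ ^ 2) (Iic 0) := by
  refine ⟨fun t : ℝ => Complex.exp (ρ * t) * (z₀ + ∫ s in (0 : ℝ)..t, Complex.exp (-ρ * s) * g s),
    fun t => hasDerivAt_duhamel hg t, by simp, ?_⟩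
  refine integrableOn_normSq_of_linear_ode (σ := 1) hρ (by simp) (by norm_num) hg hg2
    (fun t => hasDerivAt_duhamel hg t) (M := ‖z₀‖ ^ 2) fun T hT => ?_
  simp only [Complex.ofReal_zero, mul_zero, Complex.exp_zero, intervalIntegral.integral_same,
    add_zero, one_mul]
  have : 0 ≤ ‖Complex.exp (ρ * T) * (z₀ + ∫ s in (0 : ℝ)..T, Complex.exp (-ρ * s) * g s)‖ ^ 2 := by
    positivity
  linarith

end HypRelax

/-! ### Energy estimates for the damped scalar equation -/

namespace HypRelax

lemma hasDerivWithinAt_sq {f : ℝ → ℝ} {f' t : ℝ} {s : Set ℝ} (h : HasDerivWithinAt f f' s t) :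
    HasDerivWithinAt (fun x => f x ^ 2) (2 * f t * f') s t := by
  simpa [Pi.pow_def] using h.pow 2

/-- Slowly growing solutions of `ε w'' + κ w' + d w = g` on the half-line; `y = w'`. For `ε = 0` the
equation reads `κ w' + d w = g`. -/
structure DampedSol (ε κ d : ℝ) (g w y : ℝ → ℝ) : Prop where
  gcont : ContinuousOn g (Iic 0)
  vel : ∀ t ≤ 0, HasDerivWithinAt w (y t) (Iic 0) t
  eqn : ∀ t ≤ 0, HasDerivWithinAt (fun s => ε * y s) (g t - κ * y t - d * w t) (Iic 0) t
  gint : IntegrableOn (fun t => g t ^ 2) (Iic 0)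
  wint : IntegrableOn (fun t => w t ^ 2) (Iic 0)

namespace DampedSol

variable {ε κ d : ℝ} {g w y : ℝ → ℝ}

lemma wcont (H : DampedSol ε κ d g w y) : ContinuousOn w (Iic 0) := fun t ht =>
  (H.vel t ht).continuousWithinAt

lemma residual_eq_zero (H : DampedSol 0 κ d g w y) {t : ℝ} (ht : t ≤ 0) :
    g t - κ * y t - d * w t = 0 := by
  have h1 := H.eqn t ht
  simp only [zero_mul] at h1
  exact (uniqueDiffWithinAt_Iic t |>.mono (Iic_subset_Iic.2 ht)).eq_deriv _ h1
    (hasDerivWithinAt_const t (Iic 0) (0 : ℝ))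

lemma ycont (H : DampedSol ε κ d g w y) (hκ : 0 < κ) : ContinuousOn y (Iic 0) := by
  rcases eq_or_ne ε 0 with rfl | hε
  · have : ContinuousOn (fun t => (g t - d * w t) / κ) (Iic 0) :=
      (H.gcont.sub (continuousOn_const.mul H.wcont)).div_const _
    refine this.congr fun t ht => ?_
    have := H.residual_eq_zero ht
    field_simp
    linarith
  · have : ContinuousOn (fun t => ε⁻¹ * (ε * y t)) (Iic 0) :=
      continuousOn_const.mul fun t ht => (H.eqn t ht).continuousWithinAt
    refine this.congr fun t _ => ?_
    field_simp

lemma hasDeriv_mul (H : DampedSol ε κ d g w y) {t : ℝ} (ht : t ≤ 0) :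
    HasDerivWithinAt (fun s => w s * (ε * y s))
      (y t * (ε * y t) + w t * (g t - κ * y t - d * w t)) (Iic 0) t :=
  (H.vel t ht).mul (H.eqn t ht)

lemma hasDeriv_sq (H : DampedSol ε κ d g w y) {t : ℝ} (ht : t ≤ 0) :
    HasDerivWithinAt (fun s => ε * y s ^ 2)
      (2 * y t * (g t - κ * y t - d * w t)) (Iic 0) t := by
  rcases eq_or_ne ε 0 with rfl | hε
  · rw [H.residual_eq_zero ht]
    simpa using hasDerivWithinAt_const t (Iic 0) (0 : ℝ)
  · have h := (((H.eqn t ht).pow 2).const_mul ε⁻¹).congr_deriv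
      (g' := 2 * y t * (g t - κ * y t - d * w t)) (by push_cast; field_simp)
    refine h.congr (fun s _ => ?_) ?_
    all_goals simp only [Pi.pow_apply]; field_simp

lemma gwint (H : DampedSol ε κ d g w y) : IntegrableOn (fun t => g t * w t) (Iic 0) := by
  refine Integrable.mono' (H.gint.add H.wint)
    ((H.gcont.mul H.wcont).aestronglyMeasurable measurableSet_Iic) (Eventually.of_forall fun t => ?_)
  simp only [Pi.add_apply, Real.norm_eq_abs, abs_mul]
  nlinarith [sq_nonneg (|g t| - |w t|), sq_abs (g t), sq_abs (w t), sq_nonneg (g t), sq_nonneg (w t)]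

/-- The velocity of a slowly growing solution is square integrable. -/
lemma yint (H : DampedSol ε κ d g w y) (hε : 0 ≤ ε) (hκ : 0 < κ) :
    IntegrableOn (fun t => y t ^ 2) (Iic 0) := by
  have hyc := H.ycont hκ
  rcases hε.eq_or_lt with rfl | hε
  · refine Integrable.mono' ((H.gint.const_mul (2 / κ ^ 2)).add (H.wint.const_mul (2 * d ^ 2 / κ ^ 2)))
      ((hyc.pow 2).aestronglyMeasurable measurableSet_Iic) ?_
    refine (ae_restrict_iff' measurableSet_Iic).2 (Eventually.of_forall fun t ht => ?_)
    have h1 := H.residual_eq_zero ht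
    have h2 : y t = (g t - d * w t) / κ := by field_simp; linarith
    rw [Real.norm_of_nonneg (sq_nonneg _), h2, div_pow]
    have h3 : (g t - d * w t) ^ 2 ≤ 2 * g t ^ 2 + 2 * d ^ 2 * w t ^ 2 := by
      nlinarith [sq_nonneg (g t + d * w t)]
    calc (g t - d * w t) ^ 2 / κ ^ 2 ≤ (2 * g t ^ 2 + 2 * d ^ 2 * w t ^ 2) / κ ^ 2 := by gcongr
      _ = _ := by simp only [Pi.add_apply]; ring
  set f := fun t => g t * w t - d * w t ^ 2 with hf
  have hfint : IntegrableOn f (Iic 0) := H.gwint.sub (H.wint.const_mul d)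
  -- `P' = ε y² + f` with `f` integrable, so `P` measures `ε ∫ y²` without prior information on `y`
  -- at `-∞`.
  set P := fun t => w t * (ε * y t) + κ / 2 * w t ^ 2 with hP
  have hPd : ∀ s ≤ 0, HasDerivWithinAt (fun s => -P s) (-(ε * y s ^ 2 + f s)) (Iic 0) s := by
    intro s hs
    refine ((H.hasDeriv_mul hs).add (((H.vel s hs).pow 2).const_mul (κ / 2))).neg.congr_deriv ?_
    simp only [hf]; push_cast; ring
  set F := ∫ t in Iic 0, |f t| with hF
  have hFabs : IntegrableOn (fun t => |f t|) (Iic 0) := hfint.abs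
  have hpi : ∀ T ≤ 0, IntervalIntegrable (fun s => y s ^ 2) volume T 0 := fun T hT =>
    ((hyc.pow 2).mono (by rw [uIcc_of_le hT]; exact fun x hx => hx.2)).intervalIntegrable
  have hIP : ∀ T ≤ 0, ε * ∫ s in T..0, y s ^ 2 ≤ P 0 - P T + F := by
    intro T hT
    have hfi : IntervalIntegrable (fun s => |f s|) volume T 0 :=
      (hFabs.mono_set (fun x hx => by rw [uIcc_of_le hT] at hx; exact hx.2)).intervalIntegrable
    have h := sub_le_integral_of_deriv_le hT le_rfl hPd
      (f := fun s => |f s| - ε * y s ^ 2)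
      (fun s _ => by linarith [neg_abs_le (f s)])
      ((hFabs.mono_set fun x hx => hx.2).sub
        (((hyc.pow 2).mono fun x hx => hx.2).integrableOn_compact isCompact_Icc |>.const_mul ε))
    rw [intervalIntegral.integral_sub hfi ((hpi T hT).const_mul ε),
      intervalIntegral.integral_const_mul] at h
    have h2 : ∫ s in T..0, |f s| ≤ F := by
      rw [intervalIntegral.integral_of_le hT]
      exact setIntegral_mono_set hFabs (Eventually.of_forall fun t => abs_nonneg _)
        (Eventually.of_forall fun x hx => hx.2)
    linarith
  -- If `∫ y²` diverges, then `P ≤ -1` far to the left. As `κ w²/2 ≥ 0`, this forces `(w²)' ≤ -2/ε`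
  -- there, so `w²` grows at least linearly backwards in time, contradicting `w ∈ L²`.
  by_contra hni
  have hunb : ¬ ∀ T ≤ 0, ∫ s in T..0, y s ^ 2 ≤ (P 0 + F + 1) / ε := fun h =>
    hni (integrableOn_Iic_of_integral_le (hyc.pow 2) (fun t _ => sq_nonneg _) h)
  push Not at hunb
  obtain ⟨T₀, hT₀, hlt⟩ := hunb
  rw [div_lt_iff₀ hε] at hlt
  have hPle : ∀ T ≤ T₀, P T ≤ -1 := by
    intro T hT
    have h1 : ∫ s in T₀..0, y s ^ 2 ≤ ∫ s in T..0, y s ^ 2 := by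
      have hpi' : IntervalIntegrable (fun s => y s ^ 2) volume T T₀ :=
        ((hyc.pow 2).mono (by
          rw [uIcc_of_le hT]; exact fun x hx => hx.2.trans hT₀)).intervalIntegrable
      rw [← intervalIntegral.integral_add_adjacent_intervals hpi' (hpi T₀ hT₀)]
      linarith [intervalIntegral.integral_nonneg (f := fun s => y s ^ 2) (μ := volume) hT
        (fun s _ => sq_nonneg _)]
    have h2 := hIP T (hT.trans hT₀)
    nlinarith
  have hgrow : ∀ T ≤ T₀, 2 / ε * (T₀ - T) ≤ w T ^ 2 := by
    intro T hT
    -- The bound on `(w²)'` is known only left of `T₀`, whereas the integration lemma asks for one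
    -- on all of `(-∞, 0]`; the conditional makes it trivial on `(T₀, 0]`.
    have h := sub_le_integral_of_deriv_le (E := fun s => w s ^ 2)
      (E' := fun s => if s ≤ T₀ then 2 * w s * y s else 2 * w s * y s)
      (f := fun s => if s ≤ T₀ then - (2 / ε) else 2 * w s * y s) hT hT₀ (fun s hs => by
        simpa using hasDerivWithinAt_sq (H.vel s hs)) (fun s hs => by
        split_ifs with hsT
        · have h1 := hPle s hsT
          have h2 : w s * (ε * y s) ≤ -1 := by
            have : 0 ≤ κ / 2 * w s ^ 2 := by positivity
            simp only [hP] at h1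
            linarith
          rw [show -(2 / ε) = -2 / ε by ring, le_div_iff₀ hε]
          nlinarith
        · exact le_rfl)
      ((integrableOn_const (by simp) (by simp) : IntegrableOn (fun _ => -(2 / ε)) (Icc T T₀)).congr_fun
        (fun s hs => (if_pos hs.2).symm) measurableSet_Icc)
    rw [intervalIntegral.integral_congr (g := fun _ => -(2 / ε)) (fun s hs => by
      rw [uIcc_of_le hT] at hs; simp [hs.2])] at h
    simp only [intervalIntegral.integral_const, smul_eq_mul] at h
    nlinarith [sq_nonneg (w T₀)]
  obtain ⟨T, h1, h2⟩ := ((frequently_lt_of_integrableOn_Iic H.wint one_pos).and_eventually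
    (eventually_le_atBot (T₀ - ε))).exists
  have h3 := hgrow T (by linarith)
  have h4 : 2 / ε * ε ≤ 2 / ε * (T₀ - T) := by gcongr; linarith
  rw [div_mul_cancel₀ _ hε.ne'] at h4
  linarith

lemma frequently_quadratic_lt (H : DampedSol ε κ d g w y) (hε : 0 ≤ ε) (hκ : 0 < κ) (a b c : ℝ)
    {η : ℝ} (hη : 0 < η) : ∃ᶠ T in atBot, a * y T ^ 2 + b * (w T * y T) + c * w T ^ 2 < η := by
  have hi : IntegrableOn (fun t => (|a| + |b|) * y t ^ 2 + (|b| + |c|) * w t ^ 2) (Iic 0) :=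
    ((H.yint hε hκ).const_mul _).add (H.wint.const_mul _)
  refine (frequently_lt_of_integrableOn_Iic hi hη).mono fun T hT => lt_of_le_of_lt ?_ hT
  have h1 : a * y T ^ 2 ≤ |a| * y T ^ 2 := by gcongr; exact le_abs_self a
  have h2 : c * w T ^ 2 ≤ |c| * w T ^ 2 := by gcongr; exact le_abs_self c
  have h3 : b * (w T * y T) ≤ |b| * (y T ^ 2 + w T ^ 2) := by
    calc b * (w T * y T) ≤ |b| * |w T * y T| := by rw [← abs_mul]; exact le_abs_self _
      _ ≤ |b| * (y T ^ 2 + w T ^ 2) := by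
        gcongr
        rw [abs_mul]
        nlinarith [sq_nonneg (|w T| - |y T|), sq_abs (w T), sq_abs (y T), sq_nonneg (w T),
          sq_nonneg (y T)]
  linarith

/-- The basic energy inequality. -/
lemma energy_le (H : DampedSol ε κ d g w y) (hε : 0 ≤ ε) (hκ : 0 < κ) {β δ : ℝ}
    (hβ : β ^ 2 + δ ^ 2 ≤ 2 * β * d) {t : ℝ} (ht : t ≤ 0) :
    ε * κ * y t ^ 2 + 2 * ε * β * (w t * y t) + κ * d * w t ^ 2
      ≤ ∫ s in Iic t, (g s ^ 2 - δ ^ 2 * w s ^ 2 - (κ ^ 2 - 2 * ε * β) * y s ^ 2) := by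
  refine le_integral_of_deriv_le
    (E := fun t => ε * κ * y t ^ 2 + 2 * ε * β * (w t * y t) + κ * d * w t ^ 2)
    (E' := fun t => κ * (2 * y t * (g t - κ * y t - d * w t))
      + 2 * β * (y t * (ε * y t) + w t * (g t - κ * y t - d * w t)) + κ * d * (2 * w t * y t))
    ht (fun s hs => ?_) (fun s _ => ?_)
    ((H.gint.sub (H.wint.const_mul _)).sub ((H.yint hε hκ).const_mul _))
    (fun η hη => H.frequently_quadratic_lt hε hκ _ _ _ hη)
  · have h := (((H.hasDeriv_sq hs).const_mul κ).add ((H.hasDeriv_mul hs).const_mul (2 * β))).add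
      (((H.vel s hs).pow 2).const_mul (κ * d))
    refine (h.congr_deriv (by push_cast; ring)).congr (fun x _ => ?_) ?_
    all_goals simp only [Pi.add_apply, Pi.pow_apply]; ring
  -- The multiplier of the equation is `2(κ y + β w)`. The deficit in the inequality is exactly `(g
  -- - κ y - β w)² + (2βd - β² - δ²) w²`.
  · nlinarith [sq_nonneg (g s - (κ * y s + β * w s)),
      mul_nonneg (sub_nonneg.2 hβ) (sq_nonneg (w s))]

lemma integral_energy (H : DampedSol ε κ d g w y) (hε : 0 ≤ ε) (hκ : 0 < κ) (a b : ℝ) {t : ℝ}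
    (ht : t ≤ 0) : ∫ s in Iic t, (g s ^ 2 - a * w s ^ 2 - b * y s ^ 2)
      = (∫ s in Iic t, g s ^ 2) - a * (∫ s in Iic t, w s ^ 2) - b * ∫ s in Iic t, y s ^ 2 := by
  have hs := Iic_subset_Iic.2 ht
  rw [integral_sub, integral_sub, integral_const_mul, integral_const_mul]
  · exact H.gint.mono_set hs
  · exact (H.wint.mono_set hs).const_mul _
  · exact (H.gint.mono_set hs).sub ((H.wint.mono_set hs).const_mul _)
  · exact ((H.yint hε hκ).mono_set hs).const_mul _

lemma integral_sq_Iic_le {f : ℝ → ℝ} (hf : IntegrableOn (fun t => f t ^ 2) (Iic 0)) {t : ℝ}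
    (ht : t ≤ 0) : ∫ s in Iic t, f s ^ 2 ≤ ∫ s in Iic 0, f s ^ 2 :=
  setIntegral_mono_set hf (Eventually.of_forall fun _ => sq_nonneg _)
    (Eventually.of_forall (Iic_subset_Iic.2 ht))

/-- Estimates for the fast modes. -/
lemma fast_estimate (H : DampedSol ε κ d g w y) (hε : 0 ≤ ε) (hκ : 0 < κ) {δ : ℝ} (hδ : 0 < δ)
    (hd : δ ≤ d) (hκδ : 2 * ε * δ ≤ κ ^ 2) :
    δ ^ 2 * ∫ s in Iic 0, w s ^ 2 ≤ ∫ s in Iic 0, g s ^ 2 ∧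
    ∀ t ≤ 0, κ * (ε * y t ^ 2 + d * w t ^ 2) ≤ 4 * ∫ s in Iic 0, g s ^ 2 := by
  -- The discriminant condition is `2εδ² ≤ κ² d`, a consequence of `2εδ ≤ κ²` and `δ ≤ d`.
  have hcoer : ∀ a b : ℝ, κ * (ε * b ^ 2 + d * a ^ 2)
      ≤ 4 * (ε * κ * b ^ 2 + 2 * ε * δ * (a * b) + κ * d * a ^ 2) := by
    intro a b
    have h1 : ε * δ ^ 2 * 2 ≤ κ ^ 2 * d := by
      calc ε * δ ^ 2 * 2 = 2 * ε * δ * δ := by ring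
        _ ≤ κ ^ 2 * d := by gcongr
    have h2 : 0 ≤ κ * (3 * (ε * κ * b ^ 2) + 8 * ε * δ * (a * b) + 3 * (κ * d * a ^ 2)) := by
      have : κ * (3 * (ε * κ * b ^ 2) + 8 * ε * δ * (a * b) + 3 * (κ * d * a ^ 2))
        = ε / 3 * (3 * κ * b + 4 * δ * a) ^ 2 + (3 * (κ ^ 2 * d) - 16 / 3 * (ε * δ ^ 2)) * a ^ 2 := by
        ring
      rw [this]
      have h3 : 0 ≤ 3 * (κ ^ 2 * d) - 16 / 3 * (ε * δ ^ 2) := by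
        have : 0 ≤ ε * δ ^ 2 := by positivity
        linarith
      positivity
    have h4 := nonneg_of_mul_nonneg_right h2 hκ
    linarith
  have hQ : ∀ t ≤ 0, κ * (ε * y t ^ 2 + d * w t ^ 2) ≤ 4 * ((∫ s in Iic t, g s ^ 2)
      - δ ^ 2 * (∫ s in Iic t, w s ^ 2)) := by
    intro t ht
    have h1 := H.energy_le hε hκ (β := δ) (δ := δ) (by nlinarith) ht
    rw [H.integral_energy hε hκ _ _ ht] at h1
    have h2 := hcoer (w t) (y t)
    have h3 : 0 ≤ (κ ^ 2 - 2 * ε * δ) * ∫ s in Iic t, y s ^ 2 :=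
      mul_nonneg (by linarith) (setIntegral_nonneg measurableSet_Iic fun _ _ => sq_nonneg _)
    linarith
  have hd0 : 0 < d := hδ.trans_le hd
  constructor
  · have h1 := hQ 0 le_rfl
    have : 0 ≤ κ * (ε * y 0 ^ 2 + d * w 0 ^ 2) := by positivity
    linarith
  · intro t ht
    have h1 := hQ t ht
    have h2 := integral_sq_Iic_le H.gint ht
    have h3 : 0 ≤ δ ^ 2 * ∫ s in Iic t, w s ^ 2 :=
      mul_nonneg (sq_nonneg _) (setIntegral_nonneg measurableSet_Iic fun _ _ => sq_nonneg _)
    linarith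

/-- Estimates for the slow modes with the homogeneous final condition. -/
lemma slow_estimate (H : DampedSol ε κ d g w y) (hε : 0 ≤ ε) (hκ : 0 < κ) {δ : ℝ} (hδ : 0 < δ)
    (hd : d ≤ -δ) (h0 : 0 ≤ ε * κ * y 0 ^ 2 + 2 * ε * (-δ) * (w 0 * y 0) + κ * d * w 0 ^ 2) :
    δ ^ 2 * ∫ s in Iic 0, w s ^ 2 ≤ ∫ s in Iic 0, g s ^ 2 ∧
    κ ^ 2 * ∫ s in Iic 0, y s ^ 2 ≤ ∫ s in Iic 0, g s ^ 2 ∧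
    ∀ t ≤ 0, w t ^ 2 ≤ (∫ s in Iic 0, w s ^ 2) + (∫ s in Iic 0, y s ^ 2) ∧
      ε * y t ^ 2 ≤ (∫ s in Iic 0, g s ^ 2) + (∫ s in Iic 0, y s ^ 2)
        + |d| * ((∫ s in Iic 0, w s ^ 2) + ∫ s in Iic 0, y s ^ 2) := by
  have hyi := H.yint hε hκ
  -- For `d ≤ -δ` the multiplier takes `β = -δ`. The coefficient of `y²` improves to `κ² + 2εδ`, and
  -- the energy at `t = 0`, nonnegative by `h0`, is dropped.
  have h1 := H.energy_le hε hκ (β := -δ) (δ := δ) (by nlinarith) (le_refl 0)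
  rw [H.integral_energy hε hκ _ _ le_rfl] at h1
  have hw0 : 0 ≤ ∫ s in Iic 0, w s ^ 2 := setIntegral_nonneg measurableSet_Iic fun _ _ => sq_nonneg _
  have hy0 : 0 ≤ ∫ s in Iic 0, y s ^ 2 := setIntegral_nonneg measurableSet_Iic fun _ _ => sq_nonneg _
  have h2 : 0 ≤ δ ^ 2 * ∫ s in Iic 0, w s ^ 2 := by positivity
  have h3 : 0 ≤ κ ^ 2 * ∫ s in Iic 0, y s ^ 2 := by positivity
  have h4 : 0 ≤ ε * δ * ∫ s in Iic 0, y s ^ 2 := by positivity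
  refine ⟨by linarith, by linarith, fun t ht => ⟨?_, ?_⟩⟩
  · have h := le_integral_of_deriv_le (E := fun t => w t ^ 2) (E' := fun t => 2 * w t * y t)
      (f := fun t => w t ^ 2 + y t ^ 2) ht (fun s hs => hasDerivWithinAt_sq (H.vel s hs))
      (fun s _ => by nlinarith [sq_nonneg (w s - y s)]) (H.wint.add hyi)
      (fun η hη => frequently_lt_of_integrableOn_Iic H.wint hη)
    rw [integral_add (H.wint.mono_set (Iic_subset_Iic.2 ht)) (hyi.mono_set (Iic_subset_Iic.2 ht))] at h
    have := integral_sq_Iic_le H.wint ht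
    have := integral_sq_Iic_le hyi ht
    linarith
  · have h := le_integral_of_deriv_le (f := fun t => g t ^ 2 + y t ^ 2 + |d| * (w t ^ 2 + y t ^ 2)) ht
      (fun s hs => H.hasDeriv_sq hs) (fun s _ => ?_) ((H.gint.add hyi).add ((H.wint.add hyi).const_mul _))
      (fun η hη => frequently_lt_of_integrableOn_Iic (hyi.const_mul ε) hη)
    · have hs := Iic_subset_Iic.2 ht
      have i1 : IntegrableOn (fun t => g t ^ 2 + y t ^ 2) (Iic t) :=
        (H.gint.mono_set hs).add (hyi.mono_set hs)
      have i2 : IntegrableOn (fun t => |d| * (w t ^ 2 + y t ^ 2)) (Iic t) :=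
        ((H.wint.mono_set hs).add (hyi.mono_set hs)).const_mul _
      rw [integral_add i1 i2,
        integral_add (H.gint.mono_set hs) (hyi.mono_set hs), integral_const_mul,
        integral_add (H.wint.mono_set hs) (hyi.mono_set hs)] at h
      have e1 := integral_sq_Iic_le H.gint ht
      have e2 := integral_sq_Iic_le hyi ht
      have e3 := integral_sq_Iic_le H.wint ht
      have e4 : |d| * ((∫ s in Iic t, w s ^ 2) + ∫ s in Iic t, y s ^ 2)
        ≤ |d| * ((∫ s in Iic 0, w s ^ 2) + ∫ s in Iic 0, y s ^ 2) := by gcongr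
      linarith
    · have e1 : 2 * y s * g s ≤ g s ^ 2 + y s ^ 2 := by nlinarith [sq_nonneg (g s - y s)]
      have e2 : -(2 * d * (y s * w s)) ≤ |d| * (w s ^ 2 + y s ^ 2) := by
        calc -(2 * d * (y s * w s)) ≤ |2 * d * (y s * w s)| := neg_le_abs _
          _ = |d| * (2 * (|y s| * |w s|)) := by rw [abs_mul, abs_mul, abs_mul]; norm_num; ring
          _ ≤ _ := by
            gcongr
            nlinarith [sq_nonneg (|w s| - |y s|), sq_abs (w s), sq_abs (y s)]
      nlinarith [mul_nonneg hκ.le (sq_nonneg (y s))]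

/-- Squaring `g = y + d w` gives `g² = y² + d² w² + (d w²)'`, and the boundary term has the good
sign. The factor `d²` grows with the mode, unlike the uniform `δ²`; it yields the gain of two
spatial derivatives in the parabolic problem. -/
lemma parabolic_estimate (H : DampedSol 0 1 d g w y) (hd : 0 ≤ d) :
    d ^ 2 * ∫ s in Iic 0, w s ^ 2 ≤ ∫ s in Iic 0, g s ^ 2 := by
  have h := le_integral_of_deriv_le (E := fun t => d * w t ^ 2) (E' := fun t => d * (2 * w t * y t))
      (f := fun t => g t ^ 2 - d ^ 2 * w t ^ 2) le_rfl
      (fun s hs => (hasDerivWithinAt_sq (H.vel s hs)).const_mul d)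
      (fun s hs => by
        have := H.residual_eq_zero hs
        have h1 : g s = y s + d * w s := by linarith
        simp only [h1]
        nlinarith [sq_nonneg (y s)]) (H.gint.sub (H.wint.const_mul _))
      (fun η hη => frequently_lt_of_integrableOn_Iic (H.wint.const_mul d) hη)
  rw [integral_sub H.gint (H.wint.const_mul _), integral_const_mul] at h
  have : 0 ≤ d * w 0 ^ 2 := by positivity
  linarith

end DampedSol

end HypRelax

/-! ### Weighted spaces, the spectral gap and the equation of one mode -/

namespace HypRelax

/-- The square of the norm of the weighted space `L²_{e^{θt}}((-∞, 0])`. -/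
noncomputable def weightInt (θ : ℝ) (f : ℝ → ℝ) : ℝ :=
  ∫ t in Iic 0, Real.exp (2 * θ * t) * f t ^ 2

/-- Continuous functions on `(-∞, 0]` which belong to `L²_{e^{θt}}`. -/
structure WL2 (θ : ℝ) (f : ℝ → ℝ) : Prop where
  cont : ContinuousOn f (Iic 0)
  int : IntegrableOn (fun t => Real.exp (2 * θ * t) * f t ^ 2) (Iic 0)

lemma weightInt_nonneg (θ : ℝ) (f : ℝ → ℝ) : 0 ≤ weightInt θ f :=
  setIntegral_nonneg measurableSet_Iic fun _ _ => by positivity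

lemma weightInt_congr {θ : ℝ} {f g : ℝ → ℝ} (h : ∀ t ≤ 0, f t ^ 2 = g t ^ 2) :
    weightInt θ f = weightInt θ g :=
  setIntegral_congr_fun measurableSet_Iic fun t ht => by simp only [h t ht]

lemma weightInt_const_mul (θ c : ℝ) (f : ℝ → ℝ) :
    weightInt θ (fun t => c * f t) = c ^ 2 * weightInt θ f := by
  unfold weightInt
  rw [← integral_const_mul]
  congr 1 with t
  ring

namespace WL2

variable {θ θ' : ℝ} {f g : ℝ → ℝ}

lemma of_le (hf : ContinuousOn f (Iic 0)) {G : ℝ → ℝ}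
    (hG : IntegrableOn (fun t => Real.exp (2 * θ * t) * G t) (Iic 0))
    (h : ∀ t ≤ 0, f t ^ 2 ≤ G t) : WL2 θ f := by
  refine ⟨hf, Integrable.mono' hG ?_ ?_⟩
  · exact (ContinuousOn.mul (by fun_prop) (hf.pow 2)).aestronglyMeasurable measurableSet_Iic
  · refine (ae_restrict_iff' measurableSet_Iic).2 (Eventually.of_forall fun t ht => ?_)
    rw [Real.norm_of_nonneg (by positivity)]
    gcongr
    exact h t ht

lemma const_mul (hf : WL2 θ f) (c : ℝ) : WL2 θ (fun t => c * f t) :=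
  of_le (G := fun t => c ^ 2 * f t ^ 2) (continuousOn_const.mul hf.cont)
    ((hf.int.const_mul (c ^ 2)).congr (Eventually.of_forall fun t => by ring))
    fun t _ => by rw [mul_pow]

lemma add_le {a b η : ℝ} (hη : 0 < η) : (a + b) ^ 2 ≤ (1 + η) * a ^ 2 + (1 + 1 / η) * b ^ 2 := by
  have h : 0 ≤ (η * a - b) ^ 2 / η := by positivity
  have : (η * a - b) ^ 2 / η = (1 + η) * a ^ 2 + (1 + 1 / η) * b ^ 2 - (a + b) ^ 2 := by
    field_simp; ring
  linarith

lemma add (hf : WL2 θ f) (hg : WL2 θ g) : WL2 θ (fun t => f t + g t) :=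
  of_le (G := fun t => 2 * f t ^ 2 + 2 * g t ^ 2) (hf.cont.add hg.cont)
    (((hf.int.const_mul 2).add (hg.int.const_mul 2)).congr
      (Eventually.of_forall fun t => by simp only [Pi.add_apply]; ring))
    fun t _ => by nlinarith [sq_nonneg (f t - g t)]

lemma neg (hf : WL2 θ f) : WL2 θ (fun t => -f t) := by simpa using hf.const_mul (-1)

lemma sub (hf : WL2 θ f) (hg : WL2 θ g) : WL2 θ (fun t => f t - g t) := by
  simpa [sub_eq_add_neg] using hf.add hg.neg

/-- The parameter `η` stays free because the gap condition is sharp for the method: the factor of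
the main term has to be as close to one as desired. -/
lemma weightInt_add_le (hf : WL2 θ f) (hg : WL2 θ g) {η : ℝ} (hη : 0 < η) :
    weightInt θ (fun t => f t + g t) ≤ (1 + η) * weightInt θ f + (1 + 1 / η) * weightInt θ g := by
  unfold weightInt
  rw [← integral_const_mul, ← integral_const_mul,
    ← integral_add (hf.int.const_mul _) (hg.int.const_mul _)]
  refine setIntegral_mono_on (hf.add hg).int ((hf.int.const_mul _).add (hg.int.const_mul _))
    measurableSet_Iic fun t _ => ?_
  have := mul_le_mul_of_nonneg_left (add_le (a := f t) (b := g t) hη)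
    (Real.exp_pos (2 * θ * t)).le
  linarith

lemma weightInt_mono (hf : WL2 θ f) (hg : WL2 θ g) (h : ∀ t ≤ 0, f t ^ 2 ≤ g t ^ 2) :
    weightInt θ f ≤ weightInt θ g :=
  setIntegral_mono_on hf.int hg.int measurableSet_Iic fun t ht => by
    have := h t ht
    gcongr

/-- On `t ≤ 0` a larger exponent means a weaker norm. This carries parabolic quantities, measured
with `θ₀`, to the hyperbolic weight `θ ≥ θ₀`. -/
lemma mono_exponent (hf : WL2 θ f) (h : θ ≤ θ') :
    WL2 θ' f ∧ weightInt θ' f ≤ weightInt θ f := by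
  have hle : ∀ t ≤ 0, Real.exp (2 * θ' * t) * f t ^ 2 ≤ Real.exp (2 * θ * t) * f t ^ 2 := by
    intro t ht
    have : 2 * θ' * t ≤ 2 * θ * t := by nlinarith
    gcongr
  have h1 : WL2 θ' f := by
    refine ⟨hf.cont, Integrable.mono' hf.int ?_ ?_⟩
    · exact (ContinuousOn.mul (by fun_prop) (hf.cont.pow 2)).aestronglyMeasurable measurableSet_Iic
    · refine (ae_restrict_iff' measurableSet_Iic).2 (Eventually.of_forall fun t ht => ?_)
      rw [Real.norm_of_nonneg (by positivity)]
      exact hle t ht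
  exact ⟨h1, setIntegral_mono_on h1.int hf.int measurableSet_Iic hle⟩

lemma exp_mul {r : ℝ} (h : 0 < θ + r) (q : ℝ) :
    WL2 θ (fun t => q * Real.exp (r * t)) ∧
      weightInt θ (fun t => q * Real.exp (r * t)) = q ^ 2 / (2 * (θ + r)) := by
  have e : ∀ t, Real.exp (2 * θ * t) * (q * Real.exp (r * t)) ^ 2
      = q ^ 2 * Real.exp (2 * (θ + r) * t) := by
    intro t
    rw [mul_pow, ← Real.exp_nat_mul, mul_left_comm, ← Real.exp_add]
    push_cast
    ring_nf
  refine ⟨⟨by fun_prop, ?_⟩, ?_⟩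
  · simp only [e]
    exact (integrableOn_exp_mul_Iic (by positivity) 0).const_mul _
  · unfold weightInt
    simp only [e]
    rw [integral_const_mul, integral_exp_mul_Iic (by positivity)]
    simp [div_eq_mul_inv]

end WL2

/-- The parameters of the problem: `l < Λ` are the two eigenvalues around the gap, and `θ` is the
smallest root of `2 θ (ε θ - 1) + Λ + l = 0`. -/
structure GapData (l Λ ε θ : ℝ) : Prop where
  l_pos : 0 < l
  gap : l < Λ
  eps_nonneg : 0 ≤ ε
  eps_le : ε * (3 * Λ + l) ≤ 1
  root : ε * θ ^ 2 - θ + (l + Λ) / 2 = 0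
  damp_pos : 0 < 1 - 2 * ε * θ

namespace GapData

variable {l Λ ε θ : ℝ}

lemma damp_sq (G : GapData l Λ ε θ) : (1 - 2 * ε * θ) ^ 2 = 1 - 2 * ε * (l + Λ) := by
  linear_combination 4 * ε * G.root

/-- By `damp_sq` this is `ε (3Λ + l) ≤ 1` rewritten. It is the condition under which the velocity
term in the energy inequality of the fast modes is dissipative. -/
lemma le_damp_sq (G : GapData l Λ ε θ) : 2 * ε * ((Λ - l) / 2) ≤ (1 - 2 * ε * θ) ^ 2 := by
  rw [G.damp_sq]; linarith [G.eps_le]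

/-- The extreme case is `ε = 1/(3Λ + l)`. This keeps the damping away from zero uniformly in `ε`. -/
lemma const_le_damp_sq (G : GapData l Λ ε θ) : (Λ - l) / (3 * Λ + l) ≤ (1 - 2 * ε * θ) ^ 2 := by
  have := G.l_pos; have := G.gap
  rw [G.damp_sq, div_le_iff₀ (by linarith)]
  nlinarith [G.eps_le]

lemma half_pos (G : GapData l Λ ε θ) : 0 < 1 - ε * θ := by linarith [G.damp_pos]

lemma theta_pos (G : GapData l Λ ε θ) : 0 < θ := by
  have h : θ * (1 - ε * θ) = (l + Λ) / 2 := by linear_combination -G.root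
  have := G.l_pos; have := G.gap
  exact pos_of_mul_pos_left (h ▸ by linarith) G.half_pos.le

lemma eps_theta_nonneg (G : GapData l Λ ε θ) : 0 ≤ ε * θ := mul_nonneg G.eps_nonneg G.theta_pos.le

lemma damp_le_one (G : GapData l Λ ε θ) : 1 - 2 * ε * θ ≤ 1 := by linarith [G.eps_theta_nonneg]

lemma const_le_damp (G : GapData l Λ ε θ) : (Λ - l) / (3 * Λ + l) ≤ 1 - 2 * ε * θ := by
  nlinarith [G.const_le_damp_sq, G.damp_le_one, G.damp_pos]

lemma const_pos (G : GapData l Λ ε θ) : 0 < (Λ - l) / (3 * Λ + l) := by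
  have := G.l_pos; have := G.gap
  exact div_pos (by linarith) (by linarith)

lemma le_theta (G : GapData l Λ ε θ) : (l + Λ) / 2 ≤ θ := by
  have : 0 ≤ ε * θ ^ 2 := mul_nonneg G.eps_nonneg (sq_nonneg _)
  linarith [G.root]

lemma eps_theta_sq_le (G : GapData l Λ ε θ) : ε * θ ^ 2 ≤ (l + Λ) / 2 := by
  have h : θ * (1 - ε * θ) = (l + Λ) / 2 := by linear_combination -G.root
  rw [← h]
  nlinarith [G.damp_pos, G.theta_pos]

lemma damp_le_sqrt (G : GapData l Λ ε θ) {lam : ℝ} (h : lam ≤ l) :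
    1 - 2 * ε * θ ≤ Real.sqrt (1 - 4 * ε * lam) := by
  refine Real.le_sqrt_of_sq_le ?_
  rw [G.damp_sq]
  nlinarith [mul_le_mul_of_nonneg_left h G.eps_nonneg, mul_nonneg G.eps_nonneg (sub_pos.2 G.gap).le]

lemma sqrt_pos (G : GapData l Λ ε θ) {lam : ℝ} (h : lam ≤ l) :
    0 < Real.sqrt (1 - 4 * ε * lam) := G.damp_pos.trans_le (G.damp_le_sqrt h)

lemma sq_sqrt (G : GapData l Λ ε θ) {lam : ℝ} (h : lam ≤ l) :
    Real.sqrt (1 - 4 * ε * lam) ^ 2 = 1 - 4 * ε * lam :=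
  Real.sq_sqrt (Real.sqrt_pos.1 (G.sqrt_pos h)).le

end GapData

/-- The coordinate of `(u, v)` along the slow eigenvector of the mode with the eigenvalue `lam`. -/
noncomputable def slowCoord (ε lam v u : ℝ) : ℝ :=
  ε / Real.sqrt (1 - 4 * ε * lam) * v
    + (1 + Real.sqrt (1 - 4 * ε * lam)) / (2 * Real.sqrt (1 - 4 * ε * lam)) * u

/-- The exponent of the slow solution of the mode with the eigenvalue `lam`. -/
noncomputable def slowRate (ε lam : ℝ) : ℝ := -(2 * lam) / (1 + Real.sqrt (1 - 4 * ε * lam))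

namespace GapData

variable {l Λ ε θ : ℝ}

/-- `slowRate` is the root `(-1 + √(1 - 4ε lam))/(2ε)` in rationalised form, which at `ε = 0` makes
sense and equals `-lam`. -/
lemma slowRate_root (G : GapData l Λ ε θ) {lam : ℝ} (h : lam ≤ l) :
    ε * slowRate ε lam ^ 2 + slowRate ε lam + lam = 0 := by
  have h1 := G.sqrt_pos h
  have h2 := G.sq_sqrt h
  unfold slowRate
  set σ := Real.sqrt (1 - 4 * ε * lam)
  have : 1 + σ ≠ 0 := by positivity
  field_simp
  linear_combination lam * h2

/-- The arguments are the velocity and displacement at `0` of `q e^{rt}`, `r` the slow rate;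
subtracting this exponential therefore reduces a datum `q` to a zero datum. -/
lemma slowCoord_slow (G : GapData l Λ ε θ) {lam : ℝ} (h : lam ≤ l) (q : ℝ) :
    slowCoord ε lam (q * slowRate ε lam) q = q := by
  have h1 := G.sqrt_pos h
  have h2 := G.sq_sqrt h
  unfold slowCoord slowRate
  set σ := Real.sqrt (1 - 4 * ε * lam)
  have : 1 + σ ≠ 0 := by positivity
  field_simp
  linear_combination -q * h2

/-- With `κ = 1 - 2εθ` the root equation reads `θ = (l + Λ)/(1 + κ)`, while `√(1 - 4ε lam) ≥ κ`
bounds the slow rate below by `-2 lam/(1 + κ)`; finally `1 + κ ≤ 2`. Slow exponentials thus lie in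
the weighted space with a uniform norm. -/
lemma le_theta_add_slowRate (G : GapData l Λ ε θ) {lam : ℝ} (h : lam ≤ l) (h0 : 0 ≤ lam) :
    (Λ - l) / 2 ≤ θ + slowRate ε lam := by
  have h1 := G.sqrt_pos h
  have h3 := G.damp_le_sqrt h
  have h4 := G.damp_pos
  have h5 := G.damp_le_one
  have h6 : θ = (l + Λ) / (1 + (1 - 2 * ε * θ)) := by
    rw [eq_div_iff (by linarith)]; linear_combination -2 * G.root
  unfold slowRate
  set σ := Real.sqrt (1 - 4 * ε * lam)
  have h7 : -(2 * lam) / (1 + (1 - 2 * ε * θ)) ≤ -(2 * lam) / (1 + σ) := by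
    rw [neg_div, neg_div, neg_le_neg_iff]
    gcongr
  have h8 : (Λ - l) / 2 ≤ (l + Λ) / (1 + (1 - 2 * ε * θ)) + -(2 * lam) / (1 + (1 - 2 * ε * θ)) := by
    rw [← add_div, le_div_iff₀ (by linarith)]
    nlinarith [G.gap]
  linarith

lemma slowRate_bound (G : GapData l Λ ε θ) {lam : ℝ} (h : lam ≤ l) (h0 : 0 ≤ lam) :
    ε * slowRate ε lam ^ 2 ≤ lam := by
  have h1 := G.sqrt_pos h
  have h2 := G.slowRate_root h
  have h3 : -(2 * lam) ≤ slowRate ε lam := by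
    unfold slowRate
    rw [le_div_iff₀ (by positivity)]
    nlinarith
  linarith

/-- The boundary term in the energy inequality has the right sign if the slow coordinate
vanishes. -/
lemma boundary_nonneg (G : GapData l Λ ε θ) {lam u v : ℝ} (h : lam ≤ l)
    (hc : slowCoord ε lam v u = 0) :
    0 ≤ ε * (1 - 2 * ε * θ) * (v + θ * u) ^ 2
      + 2 * ε * (-((Λ - l) / 2)) * (u * (v + θ * u))
      + (1 - 2 * ε * θ) * (lam - (l + Λ) / 2) * u ^ 2 := by
  have h1 := G.sqrt_pos h
  have h2 := G.sq_sqrt h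
  have h4 := G.damp_pos
  have hroot := G.root
  unfold slowCoord at hc
  set σ := Real.sqrt (1 - 4 * ε * lam)
  -- A vanishing slow coordinate places `(u, v)` on the fast eigenvector when `ε > 0` and forces `u
  -- = 0` when `ε = 0`. In the first case `ε` times the energy becomes a nonnegative multiple of
  -- `u²`.
  have h5 : ε * v = -((1 + σ) / 2) * u := by
    field_simp at hc
    linarith
  rcases G.eps_nonneg.eq_or_lt with rfl | hε
  · have hσ : σ ^ 2 = 1 := by rw [h2]; ring
    have : u = 0 := by
      have h6 : (1 + σ) / 2 * u = 0 := by linarith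
      rcases mul_eq_zero.1 h6 with h7 | h7
      · linarith
      · exact h7
    simp [this]
  · set κ := 1 - 2 * ε * θ with hκ
    have h6 : ε * (v + θ * u) = -((σ + κ) / 2) * u := by rw [mul_add, h5, hκ]; ring
    have h7 : ε * (lam - (l + Λ) / 2) = -((σ + κ) * (σ - κ) / 4) := by
      have := G.damp_sq
      rw [← hκ] at this
      linear_combination (1 / 4) * h2 - (1 / 4) * this
    refine nonneg_of_mul_nonneg_right (a := ε) ?_ hε
    have h8 : ε * (ε * κ * (v + θ * u) ^ 2 + 2 * ε * (-((Λ - l) / 2)) * (u * (v + θ * u))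
      + κ * (lam - (l + Λ) / 2) * u ^ 2) = ((σ + κ) / 2) * (κ ^ 2 + ε * (Λ - l)) * u ^ 2 := by
      have : ε * (ε * κ * (v + θ * u) ^ 2 + 2 * ε * (-((Λ - l) / 2)) * (u * (v + θ * u))
        + κ * (lam - (l + Λ) / 2) * u ^ 2) = κ * (ε * (v + θ * u)) ^ 2
          - ε * (Λ - l) * u * (ε * (v + θ * u)) + κ * (ε * (lam - (l + Λ) / 2)) * u ^ 2 := by ring
      rw [this, h6, h7]; ring
    rw [h8]
    have := G.gap
    have : 0 ≤ ε * (Λ - l) := mul_nonneg hε.le (by linarith)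
    positivity

end GapData

/-- Slowly growing solutions of one mode: `ε u'' + u' + lam u = h` with `v = u'`. -/
structure ModeSol (ε θ lam : ℝ) (h u v : ℝ → ℝ) : Prop where
  force : WL2 θ h
  vel : ∀ t ≤ 0, HasDerivWithinAt u (v t) (Iic 0) t
  eqn : ∀ t ≤ 0, HasDerivWithinAt (fun s => ε * v s) (h t - lam * u t - v t) (Iic 0) t
  slow : IntegrableOn (fun t => Real.exp (2 * θ * t) * u t ^ 2) (Iic 0)

/-- The final condition for one mode. -/
def FinalDatum (l Λ ε lam q v u : ℝ) : Prop :=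
  (Λ ≤ lam ∧ q = 0) ∨ (0 < lam ∧ lam ≤ l ∧ slowCoord ε lam v u = q)

lemma exp_mul_sq (θ t a : ℝ) : (Real.exp (θ * t) * a) ^ 2 = Real.exp (2 * θ * t) * a ^ 2 := by
  rw [mul_pow, ← Real.exp_nat_mul]
  push_cast
  ring_nf

lemma hasDerivWithinAt_exp_mul {f : ℝ → ℝ} {f' θ t : ℝ} {s : Set ℝ}
    (h : HasDerivWithinAt f f' s t) :
    HasDerivWithinAt (fun x => Real.exp (θ * x) * f x)
      (Real.exp (θ * t) * (f' + θ * f t)) s t := by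
  have h1 : HasDerivAt (fun x => Real.exp (θ * x)) (Real.exp (θ * t) * (θ * 1)) t :=
    ((hasDerivAt_id t).const_mul θ).exp
  exact (h1.hasDerivWithinAt.mul h).congr_deriv (by ring)

namespace ModeSol

variable {l Λ ε θ lam : ℝ} {h u v : ℝ → ℝ}

lemma disp (M : ModeSol ε θ lam h u v) : WL2 θ u :=
  ⟨fun t ht => (M.vel t ht).continuousWithinAt, M.slow⟩

/-- Conjugation with `e^{θt}`. The equation of `θ` makes the zero order coefficient the distance,
with sign, from `lam` to the midpoint of the gap. -/
lemma damped (M : ModeSol ε θ lam h u v) (G : GapData l Λ ε θ) :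
    DampedSol ε (1 - 2 * ε * θ) (lam - (l + Λ) / 2) (fun t => Real.exp (θ * t) * h t)
      (fun t => Real.exp (θ * t) * u t) (fun t => Real.exp (θ * t) * (v t + θ * u t)) where
  gcont := ContinuousOn.mul (by fun_prop) M.force.cont
  vel t ht := hasDerivWithinAt_exp_mul (M.vel t ht)
  eqn t ht := by
    have h1 := hasDerivWithinAt_exp_mul (θ := θ) ((M.eqn t ht).add ((M.vel t ht).const_mul (ε * θ)))
    refine (h1.congr (fun x _ => ?_) ?_).congr_deriv ?_
    · simp only [Pi.add_apply]; ring
    · simp only [Pi.add_apply]; ring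
    · simp only [Pi.add_apply]
      linear_combination -(Real.exp (θ * t) * u t) * G.root
  gint := by simpa only [exp_mul_sq] using M.force.int
  wint := by simpa only [exp_mul_sq] using M.slow

/-- Slow growth is assumed for the displacement only; `DampedSol.yint` transfers it to `v + θ u`,
hence to the velocity. -/
lemma vint (M : ModeSol ε θ lam h u v) (G : GapData l Λ ε θ) : WL2 θ v := by
  have D := M.damped G
  have h1 := D.yint G.eps_nonneg G.damp_pos
  have h2 := D.ycont G.damp_pos
  have h3 : ContinuousOn (fun t => Real.exp (-θ * t) * (Real.exp (θ * t) * (v t + θ * u t)))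
    (Iic 0) := ContinuousOn.mul (by fun_prop) h2
  have h4 : ∀ t a, Real.exp (-θ * t) * (Real.exp (θ * t) * a) = a := by
    intro t a; rw [← mul_assoc, ← Real.exp_add]; simp
  simp only [h4] at h3
  have h5 : WL2 θ (fun t => v t + θ * u t) := ⟨h3, by simpa only [exp_mul_sq] using h1⟩
  simpa using h5.sub (M.disp.const_mul θ)

end ModeSol

end HypRelax

/-! ### Estimates of one mode, uniform in the eigenvalue and in `ε` -/

namespace HypRelax

/-- The constant in the pointwise estimate of one mode with zero datum. -/
noncomputable def modeConst (l Λ : ℝ) : ℝ :=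
  12 * Λ / ((Λ - l) / 2 * ((Λ - l) / (3 * Λ + l)))
    + 2 * (1 + 1 / ((Λ - l) / (3 * Λ + l))
      + Λ * (1 / ((Λ - l) / 2) ^ 2 + 1 / ((Λ - l) / (3 * Λ + l))))
    + 3 * Λ * (1 / ((Λ - l) / 2) ^ 2 + 1 / ((Λ - l) / (3 * Λ + l)))

namespace ModeSol

variable {l Λ ε θ lam : ℝ} {h u v : ℝ → ℝ}

lemma energy_eq (θ ε lam t : ℝ) (a b : ℝ) :
    Real.exp (2 * θ * t) * (ε * b ^ 2 + lam * a ^ 2)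
      = ε * (Real.exp (θ * t) * (b + θ * a) - θ * (Real.exp (θ * t) * a)) ^ 2
        + lam * (Real.exp (θ * t) * a) ^ 2 := by
  have : Real.exp (θ * t) * (b + θ * a) - θ * (Real.exp (θ * t) * a) = Real.exp (θ * t) * b := by
    ring
  rw [this, exp_mul_sq, exp_mul_sq]
  ring

/-- Coercivity of the energy serves the fast modes, its sign at `t = 0` the slow ones. The constant
`((Λ - l)/2)²` is the one compared with `L²` later; in the pointwise bound only independence of `ε`
and `lam` matters. -/
lemma zero_datum_estimate (M : ModeSol ε θ lam h u v) (G : GapData l Λ ε θ)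
    (hq : FinalDatum l Λ ε lam 0 (v 0) (u 0)) :
    ((Λ - l) / 2) ^ 2 * weightInt θ u ≤ weightInt θ h ∧
    ∀ t ≤ 0, Real.exp (2 * θ * t) * (ε * v t ^ 2 + lam * u t ^ 2)
      ≤ modeConst l Λ * weightInt θ h := by
  have hl := G.l_pos
  have hg := G.gap
  have hε := G.eps_nonneg
  have hκ := G.damp_pos
  have D := M.damped G
  set δ := (Λ - l) / 2 with hδ
  have hδ0 : 0 < δ := by rw [hδ]; linarith
  set k := (Λ - l) / (3 * Λ + l) with hk
  have hk0 : 0 < k := G.const_pos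
  have eg : ∫ s in Iic 0, (Real.exp (θ * s) * h s) ^ 2 = weightInt θ h := by
    simp only [exp_mul_sq]; rfl
  have eu : ∫ s in Iic 0, (Real.exp (θ * s) * u s) ^ 2 = weightInt θ u := by
    simp only [exp_mul_sq]; rfl
  have hG0 := weightInt_nonneg θ h
  set I := weightInt θ h with hI
  have hm : 0 < 1 / δ ^ 2 + 1 / k := by positivity
  have hΛ : 0 < Λ := hl.trans hg
  have hC1 : 0 ≤ 12 * Λ / (δ * k) := by positivity
  have hC2 : 0 ≤ 2 * (1 + 1 / k + Λ * (1 / δ ^ 2 + 1 / k)) + 3 * Λ * (1 / δ ^ 2 + 1 / k) := by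
    positivity
  have hC : modeConst l Λ = 12 * Λ / (δ * k)
    + (2 * (1 + 1 / k + Λ * (1 / δ ^ 2 + 1 / k)) + 3 * Λ * (1 / δ ^ 2 + 1 / k)) := by
    rw [modeConst, ← hδ, ← hk]; ring
  have hsq : ∀ a b : ℝ, ε * (b - θ * a) ^ 2 ≤ 2 * (ε * b ^ 2) + 2 * (ε * θ ^ 2) * a ^ 2 := by
    intro a b
    nlinarith [mul_nonneg hε (sq_nonneg (b + θ * a))]
  have hεθ := G.eps_theta_sq_le
  rcases hq with ⟨hlam, _⟩ | ⟨hlam0, hlam, hc⟩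
  · have hd : δ ≤ lam - (l + Λ) / 2 := by rw [hδ]; linarith
    obtain ⟨h1, h2⟩ := D.fast_estimate hε hκ hδ0 hd G.le_damp_sq
    rw [eg, eu] at h1
    rw [eg] at h2
    refine ⟨h1, fun t ht => ?_⟩
    rw [energy_eq]
    have h3 := h2 t ht
    set y := Real.exp (θ * t) * (v t + θ * u t)
    set w := Real.exp (θ * t) * u t
    -- The quotient `lam / (lam - (l + Λ)/2)` decreases in `lam` and equals `Λ/δ` at `lam = Λ`.
    have h4 : lam ≤ Λ / δ * (lam - (l + Λ) / 2) := by
      rw [div_mul_eq_mul_div, le_div_iff₀ hδ0, hδ]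
      nlinarith
    have h5 : 2 ≤ 3 * (Λ / δ) := by
      rw [← mul_div_assoc, le_div_iff₀ hδ0, hδ]; linarith
    have h6 : ε * y ^ 2 + (lam - (l + Λ) / 2) * w ^ 2 ≤ 4 * I / k := by
      rw [le_div_iff₀ hk0, mul_comm]
      refine le_trans ?_ h3
      have : 0 ≤ ε * y ^ 2 + (lam - (l + Λ) / 2) * w ^ 2 := by
        have : 0 ≤ lam - (l + Λ) / 2 := by linarith
        positivity
      gcongr
      exact G.const_le_damp
    calc ε * (y - θ * w) ^ 2 + lam * w ^ 2
        ≤ 2 * (ε * y ^ 2) + 2 * (ε * θ ^ 2) * w ^ 2 + lam * w ^ 2 := by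
          linarith [hsq w y]
      _ ≤ 2 * (ε * y ^ 2) + 3 * lam * w ^ 2 := by
          have : 2 * (ε * θ ^ 2) + lam ≤ 3 * lam := by linarith
          linarith [mul_le_mul_of_nonneg_right this (sq_nonneg w),
            add_mul (2 * (ε * θ ^ 2)) lam (w ^ 2)]
      _ ≤ 3 * (Λ / δ) * (ε * y ^ 2) + 3 * (Λ / δ * (lam - (l + Λ) / 2)) * w ^ 2 := by
          have : 0 ≤ ε * y ^ 2 := by positivity
          gcongr
      _ = 3 * (Λ / δ) * (ε * y ^ 2 + (lam - (l + Λ) / 2) * w ^ 2) := by ring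
      _ ≤ 3 * (Λ / δ) * (4 * I / k) := by gcongr
      _ = 12 * Λ / (δ * k) * I := by field_simp; ring
      _ ≤ modeConst l Λ * I := by rw [hC]; exact mul_le_mul_of_nonneg_right (by linarith) hG0
  · have hd : lam - (l + Λ) / 2 ≤ -δ := by rw [hδ]; linarith
    have hb := G.boundary_nonneg hlam hc
    obtain ⟨h1, h2, h3⟩ := D.slow_estimate hε hκ hδ0 hd (by simpa using hb)
    rw [eg, eu] at h1
    rw [eg] at h2 h3
    rw [eu] at h3
    refine ⟨h1, fun t ht => ?_⟩
    rw [energy_eq]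
    obtain ⟨h4, h5⟩ := h3 t ht
    set Y := ∫ s in Iic 0, (Real.exp (θ * s) * (v s + θ * u s)) ^ 2
    set y := Real.exp (θ * t) * (v t + θ * u t)
    set w := Real.exp (θ * t) * u t
    have hY0 : 0 ≤ Y := setIntegral_nonneg measurableSet_Iic fun _ _ => sq_nonneg _
    have hY : Y ≤ 1 / k * I := by
      rw [one_div, ← div_eq_inv_mul, le_div_iff₀ hk0, mul_comm]
      exact (mul_le_mul_of_nonneg_right G.const_le_damp_sq hY0).trans h2
    have hU : weightInt θ u ≤ 1 / δ ^ 2 * I := by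
      rw [one_div, ← div_eq_inv_mul, le_div_iff₀ (by positivity), mul_comm]
      exact h1
    have habs : |lam - (l + Λ) / 2| ≤ Λ := abs_le.2 ⟨by linarith, by linarith⟩
    have hw : w ^ 2 ≤ (1 / δ ^ 2 + 1 / k) * I := by linarith
    have hy : ε * y ^ 2 ≤ (1 + 1 / k + Λ * (1 / δ ^ 2 + 1 / k)) * I := by
      have : |lam - (l + Λ) / 2| * (weightInt θ u + Y) ≤ Λ * ((1 / δ ^ 2 + 1 / k) * I) := by
        have := weightInt_nonneg θ u
        gcongr
        linarith
      linarith
    calc ε * (y - θ * w) ^ 2 + lam * w ^ 2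
        ≤ 2 * (ε * y ^ 2) + 2 * (ε * θ ^ 2) * w ^ 2 + lam * w ^ 2 := by
          linarith [hsq w y]
      _ ≤ 2 * (ε * y ^ 2) + 3 * Λ * w ^ 2 := by
          have : 2 * (ε * θ ^ 2) + lam ≤ 3 * Λ := by linarith
          linarith [mul_le_mul_of_nonneg_right this (sq_nonneg w),
            add_mul (2 * (ε * θ ^ 2)) lam (w ^ 2)]
      _ ≤ 2 * ((1 + 1 / k + Λ * (1 / δ ^ 2 + 1 / k)) * I)
          + 3 * Λ * ((1 / δ ^ 2 + 1 / k) * I) := by gcongr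
      _ = (2 * (1 + 1 / k + Λ * (1 / δ ^ 2 + 1 / k)) + 3 * Λ * (1 / δ ^ 2 + 1 / k)) * I := by ring
      _ ≤ modeConst l Λ * I := by rw [hC]; exact mul_le_mul_of_nonneg_right (by linarith) hG0

/-- Subtraction of the slow solution of the homogeneous equation. -/
lemma sub_slow (M : ModeSol ε θ lam h u v) (G : GapData l Λ ε θ) (h0 : 0 ≤ lam) (hlam : lam ≤ l)
    (q : ℝ) : ModeSol ε θ lam h (fun t => u t - q * Real.exp (slowRate ε lam * t))
      (fun t => v t - q * slowRate ε lam * Real.exp (slowRate ε lam * t)) := by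
  set r := slowRate ε lam with hr
  have hroot := G.slowRate_root hlam
  rw [← hr] at hroot
  have hexp : ∀ t, HasDerivWithinAt (fun t => Real.exp (r * t)) (Real.exp (r * t) * r) (Iic 0) t :=
    fun t => by simpa using (((hasDerivAt_id t).const_mul r).exp).hasDerivWithinAt
  have hpos : 0 < θ + r := by
    have := G.le_theta_add_slowRate hlam h0
    have := G.gap
    linarith
  refine ⟨M.force, fun t ht => ?_, fun t ht => ?_, ?_⟩
  · exact ((M.vel t ht).sub ((hexp t).const_mul q)).congr_deriv (by ring)
  · refine (((M.eqn t ht).sub ((hexp t).const_mul (ε * (q * r)))).congr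
      (fun x _ => ?_) ?_).congr_deriv ?_
    · simp only [Pi.sub_apply]; ring
    · simp only [Pi.sub_apply]; ring
    · linear_combination -(q * Real.exp (r * t)) * hroot
  · exact (M.disp.sub (WL2.exp_mul hpos q).1).int

/-- Estimates of one mode, uniform in the mode and in `ε`. -/
theorem estimates (M : ModeSol ε θ lam h u v) (G : GapData l Λ ε θ) {q : ℝ}
    (hq : FinalDatum l Λ ε lam q (v 0) (u 0)) :
    (∀ η > 0, ((Λ - l) / 2) ^ 2 * weightInt θ u
      ≤ (1 + η) * weightInt θ h + (1 + 1 / η) * (Λ * q ^ 2)) ∧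
    ∀ t ≤ 0, Real.exp (2 * θ * t) * (ε * v t ^ 2 + lam * u t ^ 2)
      ≤ (2 * modeConst l Λ + 4 * Λ) * (weightInt θ h + q ^ 2) := by
  have hl := G.l_pos
  have hg := G.gap
  have hI := weightInt_nonneg θ h
  have hk := G.const_pos
  have hδ : 0 < (Λ - l) / 2 := by linarith
  have hΛ : 0 < Λ := by linarith
  have hC : 0 ≤ modeConst l Λ := by unfold modeConst; positivity
  have hq2 := sq_nonneg q
  rcases hq with ⟨hlam, rfl⟩ | ⟨hlam0, hlam, hc⟩
  · obtain ⟨h1, h2⟩ := M.zero_datum_estimate G (Or.inl ⟨hlam, rfl⟩)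
    refine ⟨fun η hη => ?_, fun t ht => (h2 t ht).trans ?_⟩
    · nlinarith
    · nlinarith [mul_nonneg hC hI, mul_nonneg hΛ.le hI]
  · set r := slowRate ε lam with hr
    have M' := M.sub_slow G hlam0.le hlam q
    rw [← hr] at M'
    have hq' : FinalDatum l Λ ε lam 0 (v 0 - q * r * Real.exp (r * 0))
        (u 0 - q * Real.exp (r * 0)) := by
      refine Or.inr ⟨hlam0, hlam, ?_⟩
      have h1 := G.slowCoord_slow hlam q
      rw [← hr] at h1
      unfold slowCoord at hc h1 ⊢
      simp only [mul_zero, Real.exp_zero, mul_one]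
      linear_combination hc - h1
    obtain ⟨h1, h2⟩ := M'.zero_datum_estimate G hq'
    have hge := G.le_theta_add_slowRate hlam hlam0.le
    rw [← hr] at hge
    have hpos : 0 < θ + r := hδ.trans_le hge
    obtain ⟨e1, e2⟩ := WL2.exp_mul hpos q
    refine ⟨fun η hη => ?_, fun t ht => ?_⟩
    · have h3 := M'.disp.weightInt_add_le e1 hη
      simp only [sub_add_cancel] at h3
      -- The slow exponential has squared norm `q²/(2(θ + r))`, and `θ + r ≥ (Λ - l)/2`.
      have h4 : ((Λ - l) / 2) ^ 2 * (q ^ 2 / (2 * (θ + r))) ≤ Λ * q ^ 2 := by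
        rw [← mul_div_assoc, div_le_iff₀ (by positivity)]
        have h5 : ((Λ - l) / 2) ^ 2 ≤ Λ * (2 * (θ + r)) := by nlinarith
        calc ((Λ - l) / 2) ^ 2 * q ^ 2 ≤ (Λ * (2 * (θ + r))) * q ^ 2 := by gcongr
          _ = _ := by ring
      calc ((Λ - l) / 2) ^ 2 * weightInt θ u
          ≤ ((Λ - l) / 2) ^ 2 * ((1 + η) * weightInt θ (fun t => u t - q * Real.exp (r * t))
            + (1 + 1 / η) * (q ^ 2 / (2 * (θ + r)))) := by rw [← e2]; gcongr
        _ = (1 + η) * (((Λ - l) / 2) ^ 2 * weightInt θ (fun t => u t - q * Real.exp (r * t)))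
            + (1 + 1 / η) * (((Λ - l) / 2) ^ 2 * (q ^ 2 / (2 * (θ + r)))) := by ring
        _ ≤ _ := by gcongr
    · have h3 := h2 t ht
      have hrb := G.slowRate_bound hlam hlam0.le
      rw [← hr] at hrb
      set E := Real.exp (2 * θ * t)
      have hE : E * Real.exp (r * t) ^ 2 ≤ 1 := by
        rw [← Real.exp_nat_mul, ← Real.exp_add, Real.exp_le_one_iff]
        push_cast
        nlinarith
      set x := Real.exp (r * t)
      have hE0 : 0 < E := Real.exp_pos _
      have hε := G.eps_nonneg
      have h4 : ε * v t ^ 2 + lam * u t ^ 2 ≤ 2 * (ε * (v t - q * r * x) ^ 2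
          + lam * (u t - q * x) ^ 2) + 2 * (ε * r ^ 2 + lam) * (q ^ 2 * x ^ 2) := by
        nlinarith [mul_nonneg hε (sq_nonneg (v t - 2 * (q * r * x))),
          mul_nonneg hlam0.le (sq_nonneg (u t - 2 * (q * x)))]
      calc E * (ε * v t ^ 2 + lam * u t ^ 2)
          ≤ E * (2 * (ε * (v t - q * r * x) ^ 2
          + lam * (u t - q * x) ^ 2) + 2 * (ε * r ^ 2 + lam) * (q ^ 2 * x ^ 2)) := by gcongr
        _ = 2 * (E * (ε * (v t - q * r * x) ^ 2 + lam * (u t - q * x) ^ 2))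
            + 2 * (ε * r ^ 2 + lam) * q ^ 2 * (E * x ^ 2) := by ring
        _ ≤ 2 * (modeConst l Λ * weightInt θ h) + 2 * (lam + lam) * q ^ 2 * 1 := by
            gcongr
        _ ≤ _ := by
            have : lam * q ^ 2 ≤ Λ * q ^ 2 := by gcongr; linarith
            nlinarith [mul_nonneg hC hq2, mul_nonneg hΛ.le hI]

/-- The additional regularity in the parabolic case `ε = 0`. -/
theorem parabolic_estimate (M : ModeSol 0 θ lam h u v) (G : GapData l Λ 0 θ) {q : ℝ}
    (hq : FinalDatum l Λ 0 lam q (v 0) (u 0)) :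
    lam ^ 2 * weightInt θ u ≤ 2 * (Λ / ((Λ - l) / 2)) ^ 2 * (weightInt θ h + Λ * q ^ 2) := by
  have hl := G.l_pos
  have hg := G.gap
  have hI := weightInt_nonneg θ h
  have hU := weightInt_nonneg θ u
  have hδ : 0 < (Λ - l) / 2 := by linarith
  have hΛ : 0 < Λ := by linarith
  have hq' := hq
  rcases hq with ⟨hlam, rfl⟩ | ⟨hlam0, hlam, hc⟩
  · have D := M.damped G
    have h1 := DampedSol.parabolic_estimate (d := lam - (l + Λ) / 2) (by simpa using D) (by linarith)
    simp only [exp_mul_sq] at h1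
    change _ * weightInt θ u ≤ weightInt θ h at h1
    -- For fast modes the distance to the midpoint of the gap is comparable with `lam` itself, so
    -- `d²` may be replaced by `lam²`.
    have h4 : lam ≤ Λ / ((Λ - l) / 2) * (lam - (l + Λ) / 2) := by
      rw [div_mul_eq_mul_div, le_div_iff₀ hδ]
      nlinarith
    calc lam ^ 2 * weightInt θ u
        ≤ (Λ / ((Λ - l) / 2) * (lam - (l + Λ) / 2)) ^ 2 * weightInt θ u := by
          have : 0 ≤ lam := by linarith
          gcongr
      _ = (Λ / ((Λ - l) / 2)) ^ 2 * ((lam - (l + Λ) / 2) ^ 2 * weightInt θ u) := by ring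
      _ ≤ (Λ / ((Λ - l) / 2)) ^ 2 * weightInt θ h := by gcongr
      _ ≤ _ := by
          have : 0 ≤ (Λ / ((Λ - l) / 2)) ^ 2 * weightInt θ h := by positivity
          nlinarith
  · have h1 := (M.estimates G hq').1 1 one_pos
    have h2 : weightInt θ u ≤ (2 * (weightInt θ h + Λ * q ^ 2)) / ((Λ - l) / 2) ^ 2 := by
      rw [le_div_iff₀ (by positivity)]
      linarith
    calc lam ^ 2 * weightInt θ u ≤ Λ ^ 2 * ((2 * (weightInt θ h + Λ * q ^ 2)) / ((Λ - l) / 2) ^ 2) := by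
          have : lam ≤ Λ := by linarith
          gcongr
      _ = _ := by field_simp

end ModeSol

end HypRelax

/-! ### Existence for one mode and for the relaxation equation -/

namespace HypRelax

variable {l Λ ε θ lam : ℝ}

/-- Converse of `ModeSol.damped`: solutions may be sought for the conjugated equation in the
unweighted `L²`. -/
lemma ModeSol.of_damped (G : GapData l Λ ε θ) {h w y : ℝ → ℝ} (hh : WL2 θ h)
    (hw : ∀ t ≤ 0, HasDerivWithinAt w (y t) (Iic 0) t)
    (hy : ∀ t ≤ 0, HasDerivWithinAt (fun s => ε * y s) (Real.exp (θ * t) * h t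
      - (1 - 2 * ε * θ) * y t - (lam - (l + Λ) / 2) * w t) (Iic 0) t)
    (hi : IntegrableOn (fun t => w t ^ 2) (Iic 0)) :
    ModeSol ε θ lam h (fun t => Real.exp (-θ * t) * w t)
      (fun t => Real.exp (-θ * t) * (y t - θ * w t)) := by
  refine ⟨hh, fun t ht => ?_, fun t ht => ?_, ?_⟩
  · exact (hasDerivWithinAt_exp_mul (hw t ht)).congr_deriv (by ring)
  · have h1 := hasDerivWithinAt_exp_mul (θ := -θ) ((hy t ht).sub ((hw t ht).const_mul (ε * θ)))
    have h2 : Real.exp (-θ * t) * Real.exp (θ * t) = 1 := by rw [← Real.exp_add]; simp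
    refine (h1.congr (fun x _ => ?_) ?_).congr_deriv ?_
    · simp only [Pi.sub_apply]; ring
    · simp only [Pi.sub_apply]; ring
    · simp only [Pi.sub_apply]
      linear_combination (h t) * h2 + (Real.exp (-θ * t) * w t) * G.root
  · refine hi.congr (Eventually.of_forall fun t => ?_)
    simp only
    rw [exp_mul_sq, ← mul_assoc, ← Real.exp_add]
    ring_nf
    simp

lemma re_neg_of_root {a b c : ℝ} (ha : 0 < a) (hb : 0 < b) (hc : 0 < c) {ρ : ℂ}
    (h : a * ρ ^ 2 + b * ρ + c = 0) : ρ.re < 0 := by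
  have h1 := congrArg Complex.re h
  have h2 := congrArg Complex.im h
  simp [pow_two] at h1 h2
  by_contra! hre
  have h3 : ρ.im * (2 * a * ρ.re + b) = 0 := by linarith
  rcases mul_eq_zero.1 h3 with h4 | h4
  · rw [h4] at h1
    nlinarith [mul_nonneg ha.le (mul_nonneg hre hre), mul_nonneg hb.le hre]
  · nlinarith [mul_nonneg ha.le hre]

lemma hasDerivWithinAt_re {z : ℝ → ℂ} {z' : ℂ} {t : ℝ} (h : HasDerivAt z z' t) (s : Set ℝ) :
    HasDerivWithinAt (fun t => (z t).re) z'.re s t :=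
  ((Complex.reCLM.hasFDerivAt.comp_hasDerivAt t h).hasDerivWithinAt)

lemma integrableOn_re_sq {z : ℝ → ℂ} (hz : Continuous z)
    (h : IntegrableOn (fun t => ‖z t‖ ^ 2) (Iic 0)) :
    IntegrableOn (fun t => (z t).re ^ 2) (Iic 0) := by
  refine Integrable.mono' h (by fun_prop) (Eventually.of_forall fun t => ?_)
  rw [Real.norm_of_nonneg (sq_nonneg _), ← sq_abs]
  gcongr
  exact Complex.abs_re_le_norm _

/-- The equation is `z' = -d z + g`. A fast mode has `d > 0` and is integrated from `-∞` with no
free datum; a slow one has `d < 0` and is integrated backwards from `z(0) = q`. -/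
lemma exists_modeSol_zero (G : GapData l Λ 0 θ) {h : ℝ → ℝ} (hh : WL2 θ h) {q : ℝ}
    (hlam : (Λ ≤ lam ∧ q = 0) ∨ (0 < lam ∧ lam ≤ l)) {g : ℝ → ℂ} (hg : Continuous g)
    (hg2 : IntegrableOn (fun t => ‖g t‖ ^ 2) (Iic 0))
    (hgh : ∀ t ≤ 0, g t = ((Real.exp (θ * t) * h t : ℝ) : ℂ)) :
    ∃ u v, ModeSol 0 θ lam h u v ∧ FinalDatum l Λ 0 lam q (v 0) (u 0) := by
  have hgap := G.gap
  set d := lam - (l + Λ) / 2 with hd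
  have main : ∀ z : ℝ → ℂ, (∀ t, HasDerivAt z (((-d : ℝ) : ℂ) * z t + g t) t) →
      IntegrableOn (fun t => ‖z t‖ ^ 2) (Iic 0) →
      ((Λ ≤ lam ∧ q = 0) ∨ ((0 < lam ∧ lam ≤ l) ∧ z 0 = (q : ℂ))) →
      ∃ u v, ModeSol 0 θ lam h u v ∧ FinalDatum l Λ 0 lam q (v 0) (u 0) := by
    intro z hz hz2 hq
    have hzc : Continuous z := continuous_iff_continuousAt.2 fun t => (hz t).continuousAt
    refine ⟨_, _, ModeSol.of_damped (w := fun t => (z t).re)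
      (y := fun t => (((-d : ℝ) : ℂ) * z t + g t).re) G hh
      (fun t _ => hasDerivWithinAt_re (hz t) _) (fun t ht => ?_) (integrableOn_re_sq hzc hz2), ?_⟩
    · have : Real.exp (θ * t) * h t - (1 - 2 * 0 * θ) * (((-d : ℝ) : ℂ) * z t + g t).re
          - (lam - (l + Λ) / 2) * (z t).re = 0 := by
        rw [hgh t ht, ← hd, Complex.add_re, Complex.re_ofReal_mul, Complex.ofReal_re]; ring
      rw [this]
      simpa using hasDerivWithinAt_const t (Iic 0) (0 : ℝ)
    · rcases hq with hq | ⟨hq, hz0⟩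
      · exact Or.inl hq
      · refine Or.inr ⟨hq.1, hq.2, ?_⟩
        simp [slowCoord, hz0]
  rcases hlam with hlam | hlam
  · obtain ⟨z, hz, hz2⟩ := exists_stable_solution (ρ := ((-d : ℝ) : ℂ))
      (by rw [Complex.ofReal_re, hd]; linarith) hg hg2
    exact main z hz hz2 (Or.inl hlam)
  · obtain ⟨z, hz, hz0, hz2⟩ := exists_unstable_solution (ρ := ((-d : ℝ) : ℂ))
      (by rw [Complex.ofReal_re, hd]; linarith) (q : ℂ) hg hg2
    exact main z hz hz2 (Or.inr ⟨hlam, hz0⟩)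

/-- The operator factors as `ε (∂_t - ρ₁)(∂_t - ρ₂)` and the two first order equations are solved in
cascade, so coinciding roots need no special care. Fast modes have two stable roots; slow modes have
one stable root and the root `θ + r > 0`, which carries the datum. -/
lemma exists_modeSol_pos (G : GapData l Λ ε θ) (hε : 0 < ε) {h : ℝ → ℝ} (hh : WL2 θ h) {q : ℝ}
    (hlam : (Λ ≤ lam ∧ q = 0) ∨ (0 < lam ∧ lam ≤ l)) {g : ℝ → ℂ} (hg : Continuous g)
    (hg2 : IntegrableOn (fun t => ‖g t‖ ^ 2) (Iic 0))
    (hgh : ∀ t ≤ 0, g t = ((Real.exp (θ * t) * h t : ℝ) : ℂ)) :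
    ∃ u v, ModeSol ε θ lam h u v ∧ FinalDatum l Λ ε lam q (v 0) (u 0) := by
  have hgap := G.gap
  have hκ := G.damp_pos
  have hεc : (ε : ℂ) ≠ 0 := by exact_mod_cast hε.ne'
  set κ := 1 - 2 * ε * θ with hκdef
  set d := lam - (l + Λ) / 2 with hd
  have main : ∀ (ρ₁ ρ₂ : ℂ) (z₁ z₂ : ℝ → ℂ), ε * (ρ₁ + ρ₂) + κ = 0 →
      ε * ρ₂ ^ 2 + κ * ρ₂ + d = 0 →
      (∀ t, HasDerivAt z₁ (ρ₁ * z₁ t + g t / ε) t) → (∀ t, HasDerivAt z₂ (ρ₂ * z₂ t + z₁ t) t) →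
      IntegrableOn (fun t => ‖z₂ t‖ ^ 2) (Iic 0) →
      ModeSol ε θ lam h (fun t => Real.exp (-θ * t) * (z₂ t).re)
        (fun t => Real.exp (-θ * t) * ((ρ₂ * z₂ t + z₁ t).re - θ * (z₂ t).re)) := by
    intro ρ₁ ρ₂ z₁ z₂ hsum hroot hz₁ hz₂ hi
    have hzc : Continuous z₂ := continuous_iff_continuousAt.2 fun t => (hz₂ t).continuousAt
    refine ModeSol.of_damped (w := fun t => (z₂ t).re)
      (y := fun t => (ρ₂ * z₂ t + z₁ t).re) G hh
      (fun t _ => hasDerivWithinAt_re (hz₂ t) _) (fun t ht => ?_) (integrableOn_re_sq hzc hi)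
    have h1 := hasDerivWithinAt_re ((((hz₂ t).const_mul ρ₂).add (hz₁ t)).const_mul (ε : ℂ)) (Iic 0)
    refine (h1.congr (fun x _ => ?_) ?_).congr_deriv ?_
    · simp only [Pi.add_apply]; rw [Complex.re_ofReal_mul]
    · simp only [Pi.add_apply]; rw [Complex.re_ofReal_mul]
    · have h2 : (ε : ℂ) * (ρ₂ * (ρ₂ * z₂ t + z₁ t) + (ρ₁ * z₁ t + g t / ε))
          = g t - κ * (ρ₂ * z₂ t + z₁ t) - d * z₂ t := by
        field_simp
        linear_combination (z₁ t) * hsum + (z₂ t) * hroot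
      rw [h2, hgh t ht, Complex.sub_re, Complex.sub_re, Complex.re_ofReal_mul,
        Complex.re_ofReal_mul, Complex.ofReal_re]
  have hgε : Continuous fun t => g t / ε := by fun_prop
  have hgε2 : IntegrableOn (fun t => ‖g t / ε‖ ^ 2) (Iic 0) := by
    simp only [norm_div, div_pow]
    exact hg2.div_const _
  rcases hlam with hlam | hlam
  -- The roots are non-real for large `lam`, so the cascade is run over `ℂ` and the real part is
  -- taken at the end.
  · obtain ⟨s, hs⟩ := IsAlgClosed.exists_pow_nat_eq ((κ : ℂ) ^ 2 - 4 * ε * d) two_pos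
    have hd0 : 0 < d := by rw [hd]; linarith
    have hr : ∀ s' : ℂ, s' ^ 2 = (κ : ℂ) ^ 2 - 4 * ε * d →
        ε * ((-κ + s') / (2 * ε)) ^ 2 + κ * ((-κ + s') / (2 * ε)) + d = 0 := by
      intro s' hs'
      field_simp
      linear_combination hs'
    have hr2 := hr (-s) (by rw [neg_sq, hs])
    obtain ⟨z₁, hz₁, hz₁2⟩ := exists_stable_solution (re_neg_of_root hε hκ hd0 (hr s hs)) hgε hgε2
    have hc : Continuous z₁ := continuous_iff_continuousAt.2 fun t => (hz₁ t).continuousAt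
    obtain ⟨z₂, hz₂, hz₂2⟩ := exists_stable_solution (re_neg_of_root hε hκ hd0 hr2) hc hz₁2
    exact ⟨_, _, main _ _ z₁ z₂ (by field_simp; ring) hr2 hz₁ hz₂ hz₂2, Or.inl hlam⟩
  · have hpos := G.le_theta_add_slowRate hlam.2 hlam.1.le
    have hrr := G.slowRate_root hlam.2
    have hrs := G.slowCoord_slow hlam.2
    have hσ := G.sqrt_pos hlam.2
    set r := slowRate ε lam
    have h1 : 0 < θ + r := by linarith
    obtain ⟨z₁, hz₁, hz₁2⟩ := exists_stable_solution (ρ := ((-(κ / ε) - (θ + r) : ℝ) : ℂ))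
      (by rw [Complex.ofReal_re]; have := div_pos hκ hε; linarith) hgε hgε2
    have hc : Continuous z₁ := continuous_iff_continuousAt.2 fun t => (hz₁ t).continuousAt
    -- At `t = 0` the displacement is `x` and the velocity `r x + Re z₁(0)`, with slow coordinate `x
    -- + ε/√(1 - 4ε lam) · Re z₁(0)`; this `x` makes it `q`.
    set x := q - ε / Real.sqrt (1 - 4 * ε * lam) * (z₁ 0).re with hx
    obtain ⟨z₂, hz₂, hz₂0, hz₂2⟩ := exists_unstable_solution (ρ := ((θ + r : ℝ) : ℂ))
      (by rwa [Complex.ofReal_re]) (x : ℂ) hc hz₁2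
    have hroot : ε * (θ + r) ^ 2 + κ * (θ + r) + d = 0 := by
      rw [hκdef, hd]; linear_combination hrr - G.root
    refine ⟨_, _, main _ _ z₁ z₂ ?_ (by exact_mod_cast hroot) hz₁ hz₂ hz₂2,
      Or.inr ⟨hlam.1, hlam.2, ?_⟩⟩
    · push_cast; field_simp; ring
    · have h2 := hrs x
      simp only [mul_zero, Real.exp_zero, one_mul, hz₂0, Complex.add_re, Complex.re_ofReal_mul,
        Complex.ofReal_re]
      unfold slowCoord at h2 ⊢
      rw [hx] at h2 ⊢
      linear_combination h2

/-- Solvability of one mode. -/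
theorem exists_modeSol (G : GapData l Λ ε θ) {h : ℝ → ℝ} (hh : WL2 θ h) {q : ℝ}
    (hlam : (Λ ≤ lam ∧ q = 0) ∨ (0 < lam ∧ lam ≤ l)) :
    ∃ u v, ModeSol ε θ lam h u v ∧ FinalDatum l Λ ε lam q (v 0) (u 0) := by
  -- The forcing is frozen at its final value for `t > 0`, so that Duhamel's formula applies on the
  -- whole line.
  set g : ℝ → ℂ := fun t => ((Real.exp (θ * min t 0) * h (min t 0) : ℝ) : ℂ) with hg
  have hgc : Continuous g := by
    have : Continuous fun t : ℝ => h (min t 0) :=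
      hh.cont.comp_continuous (by fun_prop) fun t => min_le_right t 0
    exact Complex.continuous_ofReal.comp (Continuous.mul (by fun_prop) this)
  have hgh : ∀ t ≤ 0, g t = ((Real.exp (θ * t) * h t : ℝ) : ℂ) := fun t ht => by
    simp only [hg, min_eq_left ht]
  have hg2 : IntegrableOn (fun t => ‖g t‖ ^ 2) (Iic 0) := by
    refine hh.int.congr_fun (fun t ht => ?_) measurableSet_Iic
    simp only [hgh t ht, Complex.norm_real, Real.norm_eq_abs, sq_abs]
    rw [exp_mul_sq]
  rcases G.eps_nonneg.eq_or_lt with rfl | hε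
  · exact exists_modeSol_zero G hh hlam hgc hg2 hgh
  · exact exists_modeSol_pos G hε hh hlam hgc hg2 hgh

/-- Solvability of the relaxation equation `ε c' + c = z`. -/
lemma exists_relaxation (hε : 0 < ε) (hθ : 0 < 1 - ε * θ) {z : ℝ → ℝ} (hz : WL2 θ z) :
    ∃ c : ℝ → ℝ, WL2 θ c ∧ ∀ t ≤ 0, HasDerivWithinAt c ((z t - c t) / ε) (Iic 0) t := by
  set g : ℝ → ℂ := fun t => ((Real.exp (θ * min t 0) * z (min t 0) / ε : ℝ) : ℂ) with hg
  have hgc : Continuous g := by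
    have : Continuous fun t : ℝ => z (min t 0) :=
      hz.cont.comp_continuous (by fun_prop) fun t => min_le_right t 0
    exact Complex.continuous_ofReal.comp ((Continuous.mul (by fun_prop) this).div_const ε)
  have hgh : ∀ t ≤ 0, g t = ((Real.exp (θ * t) * z t / ε : ℝ) : ℂ) := fun t ht => by
    simp only [hg, min_eq_left ht]
  have hg2 : IntegrableOn (fun t => ‖g t‖ ^ 2) (Iic 0) := by
    have h1 : IntegrableOn (fun t => Real.exp (2 * θ * t) * z t ^ 2 / ε ^ 2) (Iic 0) :=
      hz.int.div_const (ε ^ 2)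
    refine h1.congr_fun (fun t ht => ?_) measurableSet_Iic
    simp only [hgh t ht, Complex.norm_real, Real.norm_eq_abs, sq_abs]
    rw [div_pow, exp_mul_sq]
  -- For `y = e^{θt} c` the relaxation rate is `(1 - εθ)/ε`, still positive.
  obtain ⟨y, hy, hy2⟩ := exists_stable_solution (ρ := ((-((1 - ε * θ) / ε) : ℝ) : ℂ))
    (by rw [Complex.ofReal_re]; have := div_pos hθ hε; linarith) hgc hg2
  have hyc : Continuous y := continuous_iff_continuousAt.2 fun t => (hy t).continuousAt
  refine ⟨fun t => Real.exp (-θ * t) * (y t).re, ⟨?_, ?_⟩, fun t ht => ?_⟩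
  · have : Continuous fun t => (y t).re := by fun_prop
    exact (by fun_prop : Continuous fun t => Real.exp (-θ * t) * (y t).re).continuousOn
  · refine (integrableOn_re_sq hyc hy2).congr (Eventually.of_forall fun t => ?_)
    simp only
    rw [exp_mul_sq, ← mul_assoc, ← Real.exp_add]
    ring_nf
    simp
  · have h2 : Real.exp (-θ * t) * Real.exp (θ * t) = 1 := by rw [← Real.exp_add]; simp
    refine (hasDerivWithinAt_exp_mul (θ := -θ) (hasDerivWithinAt_re (hy t) (Iic 0))).congr_deriv ?_
    rw [hgh t ht, Complex.add_re, Complex.re_ofReal_mul, Complex.ofReal_re]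
    rw [neg_mul] at h2 ⊢
    field_simp
    linear_combination (z t) * h2

end HypRelax

/-! ### Functions with values in `H`, the contraction principle and Fourier coefficients -/

namespace HypRelax

variable {H : Type*} [NormedAddCommGroup H] [InnerProductSpace ℝ H] [CompleteSpace H]

/-- Continuous `H`-valued functions on `(-∞, 0]` which belong to `L²_{e^{θt}}`. -/
structure VL2 (θ : ℝ) (u : ℝ → H) : Prop where
  cont : ContinuousOn u (Iic 0)
  norm : WL2 θ (fun t => ‖u t‖)

namespace VL2

variable {θ : ℝ} {u w : ℝ → H}

lemma of_le (hu : ContinuousOn u (Iic 0)) {G : ℝ → ℝ} (hG : WL2 θ G)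
    (h : ∀ t ≤ 0, ‖u t‖ ≤ G t) : VL2 θ u :=
  ⟨hu, WL2.of_le hu.norm hG.int fun t ht => pow_le_pow_left₀ (norm_nonneg _) (h t ht) 2⟩

lemma add (hu : VL2 θ u) (hw : VL2 θ w) : VL2 θ (fun t => u t + w t) :=
  of_le (hu.cont.add hw.cont) (hu.norm.add hw.norm) fun _ _ => norm_add_le _ _

lemma sub (hu : VL2 θ u) (hw : VL2 θ w) : VL2 θ (fun t => u t - w t) :=
  of_le (hu.cont.sub hw.cont) (hu.norm.add hw.norm) fun _ _ => norm_sub_le _ _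

lemma comp_lipschitz (hu : VL2 θ u) {F : H → H} {L : ℝ}
    (hF : ∀ u₁ u₂ : H, ‖F u₁ - F u₂‖ ≤ L * ‖u₁ - u₂‖) (hF0 : F 0 = 0) :
    VL2 θ (fun t => F (u t)) := by
  have hFc : Continuous F := by
    refine (LipschitzWith.of_dist_le' (K := L) fun x y => ?_).continuous
    rw [dist_eq_norm, dist_eq_norm]
    exact hF x y
  refine of_le (hFc.comp_continuousOn hu.cont) (hu.norm.const_mul L) fun t _ => ?_
  simpa [hF0] using hF (u t) 0

lemma weightInt_add_le (hu : VL2 θ u) (hw : VL2 θ w) {η : ℝ} (hη : 0 < η) :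
    weightInt θ (fun t => ‖u t + w t‖)
      ≤ (1 + η) * weightInt θ (fun t => ‖u t‖) + (1 + 1 / η) * weightInt θ (fun t => ‖w t‖) :=
  ((hu.add hw).norm.weightInt_mono (hu.norm.add hw.norm) fun _ _ =>
    pow_le_pow_left₀ (norm_nonneg _) (norm_add_le _ _) 2).trans
      (hu.norm.weightInt_add_le hw.norm hη)

lemma weightInt_lipschitz_le (hu : VL2 θ u) (hw : VL2 θ w) {F : H → H} {L : ℝ}
    (hF : ∀ u₁ u₂ : H, ‖F u₁ - F u₂‖ ≤ L * ‖u₁ - u₂‖) (hF0 : F 0 = 0) :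
    weightInt θ (fun t => ‖F (u t) - F (w t)‖) ≤ L ^ 2 * weightInt θ (fun t => ‖u t - w t‖) := by
  rw [← weightInt_const_mul]
  exact ((hu.comp_lipschitz hF hF0).sub (hw.comp_lipschitz hF hF0)).norm.weightInt_mono
    ((hu.sub hw).norm.const_mul L) fun t _ => pow_le_pow_left₀ (norm_nonneg _) (hF _ _) 2

end VL2

/-- A version of the contraction mapping principle for continuous functions with values in `H`
belonging to a weighted `L²` space. -/
theorem exists_fixedPoint_of_contraction {θ r K : ℝ} (hθ : 0 < θ) (hr0 : 0 ≤ r) (hr1 : r < 1)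
    (hK : 0 ≤ K) (T : (ℝ → H) → ℝ → H) (hT : ∀ u, VL2 θ u → VL2 θ (T u))
    (hcontr : ∀ u w, VL2 θ u → VL2 θ w → weightInt θ (fun t => ‖T u t - T w t‖)
      ≤ r * weightInt θ (fun t => ‖u t - w t‖))
    (hsup : ∀ u w, VL2 θ u → VL2 θ w → ∀ t ≤ 0, Real.exp (2 * θ * t) * ‖T u t - T w t‖ ^ 2
      ≤ K * weightInt θ (fun t => ‖u t - w t‖)) :
    ∃ u, VL2 θ u ∧ ∀ t ≤ 0, T u t = u t := by
  set U : ℕ → ℝ → H := fun k => T^[k] (fun _ => 0) with hU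
  have hUs : ∀ k, U (k + 1) = T (U k) := fun k => Function.iterate_succ_apply' T k _
  have hU0 : VL2 θ (U 0) :=
    ⟨continuousOn_const, ⟨by simpa [hU] using continuousOn_const, by simp [hU]⟩⟩
  have hUg : ∀ k, VL2 θ (U k) := by
    intro k
    induction k with
    | zero => exact hU0
    | succ k ih => rw [hUs]; exact hT _ ih
  set D := weightInt θ (fun t => ‖U 1 t - U 0 t‖)
  have hD : 0 ≤ D := weightInt_nonneg _ _
  -- This choice gives `(1 + η) r < 1`. The number `B` below is the fixed point of `B ↦ (1 + η) r B
  -- + (1 + 1/η) D`, so by induction all iterates stay within `B` of the first one.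
  set η := (1 - r) / 2 with hη
  have hη0 : 0 < η := by rw [hη]; linarith
  have hr' : 0 < 1 - (1 + η) * r := by rw [hη]; nlinarith
  set B := (1 + 1 / η) * D / (1 - (1 + η) * r) with hB
  have hB0 : 0 ≤ B := by positivity
  have hX : ∀ m, weightInt θ (fun t => ‖U m t - U 0 t‖) ≤ B := by
    intro m
    induction m with
    | zero => simpa [weightInt] using hB0
    | succ m ih =>
      have h1 := ((hUg (m + 1)).sub (hUg 1)).weightInt_add_le ((hUg 1).sub hU0) hη0
      simp only [sub_add_sub_cancel] at h1
      have h2 := hcontr _ _ (hUg m) hU0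
      rw [← hUs m, ← hUs 0] at h2
      have h3 : (1 + η) * weightInt θ (fun t => ‖U (m + 1) t - U 1 t‖) ≤ (1 + η) * (r * B) := by
        gcongr
        exact h2.trans (by gcongr)
      have h4 : (1 + 1 / η) * D = B * (1 - (1 + η) * r) := by
        rw [hB, div_mul_cancel₀ _ hr'.ne']
      change _ ≤ _ + (1 + 1 / η) * D at h1
      rw [h4] at h1
      linarith
  have hI : ∀ k m, weightInt θ (fun t => ‖U (m + k) t - U k t‖) ≤ r ^ k * B := by
    intro k
    induction k with
    | zero => simpa using hX
    | succ k ih =>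
      intro m
      have h2 := hcontr _ _ (hUg (m + k)) (hUg k)
      rw [← hUs, ← hUs] at h2
      calc _ ≤ _ := h2
        _ ≤ r * (r ^ k * B) := by gcongr; exact ih m
        _ = _ := by ring
  -- Continuous functions are not complete in the weighted `L²` norm; `hsup` upgrades the
  -- convergence of the iterates to locally uniform convergence in time.
  have hS : ∀ k m, ∀ t ≤ 0, Real.exp (2 * θ * t) * ‖U (m + k + 1) t - U (k + 1) t‖ ^ 2
      ≤ K * (r ^ k * B) := by
    intro k m t ht
    have h2 := hsup _ _ (hUg (m + k)) (hUg k) t ht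
    rw [← hUs, ← hUs] at h2
    exact h2.trans (by gcongr; exact hI k m)
  set b : ℝ → ℕ → ℝ := fun t k => Real.sqrt (Real.exp (-(2 * θ * t)) * (K * (r ^ k * B))) with hb
  have hbt : ∀ t, Tendsto (b t) atTop (𝓝 0) := by
    intro t
    have h1 : Tendsto (fun k : ℕ => Real.exp (-(2 * θ * t)) * (K * (r ^ k * B))) atTop (𝓝 0) := by
      have h2 := ((tendsto_pow_atTop_nhds_zero_of_lt_one hr0 hr1).mul_const B).const_mul K
      simpa using h2.const_mul (Real.exp (-(2 * θ * t)))
    have h2 := (Real.continuous_sqrt.tendsto 0).comp h1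
    rw [Real.sqrt_zero] at h2
    exact h2
  have hdist : ∀ k m, ∀ t ≤ 0, ‖U (m + k + 1) t - U (k + 1) t‖ ≤ b t k := by
    intro k m t ht
    refine Real.le_sqrt_of_sq_le ?_
    have h2 : Real.exp (-(2 * θ * t)) * Real.exp (2 * θ * t) = 1 := by rw [← Real.exp_add]; simp
    calc ‖U (m + k + 1) t - U (k + 1) t‖ ^ 2
        = Real.exp (-(2 * θ * t)) * (Real.exp (2 * θ * t) * ‖U (m + k + 1) t - U (k + 1) t‖ ^ 2) := by
          rw [← mul_assoc, h2, one_mul]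
      _ ≤ _ := mul_le_mul_of_nonneg_left (hS k m t ht) (Real.exp_pos _).le
  have hlim : ∀ t, ∃ x, t ≤ 0 → Tendsto (fun k => U k t) atTop (𝓝 x) := by
    intro t
    by_cases ht : t ≤ 0
    · have hc : CauchySeq fun k => U (k + 1) t := by
        refine cauchySeq_of_le_tendsto_0' (b t) (fun n m hnm => ?_) (hbt t)
        obtain ⟨j, rfl⟩ := Nat.exists_eq_add_of_le' hnm
        rw [dist_comm, dist_eq_norm]
        exact hdist n j t ht
      obtain ⟨x, hx⟩ := cauchySeq_tendsto_of_complete hc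
      exact ⟨x, fun _ => (tendsto_add_atTop_iff_nat 1).1 hx⟩
    · exact ⟨0, fun h => absurd h ht⟩
  choose u hu using hlim
  have hdistu : ∀ k, ∀ t ≤ 0, ‖u t - U (k + 1) t‖ ≤ b t k := by
    intro k t ht
    have h1 : Tendsto (fun m => ‖U (m + (k + 1)) t - U (k + 1) t‖) atTop
        (𝓝 ‖u t - U (k + 1) t‖) :=
      (((tendsto_add_atTop_iff_nat (k + 1)).2 (hu t ht)).sub_const _).norm
    exact le_of_tendsto h1 (Eventually.of_forall fun m => hdist k m t ht)
  have huc : ContinuousOn u (Iic 0) := by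
    intro t ht
    refine continuousWithinAt_of_locally_uniform_approx_of_continuousWithinAt ht fun V hV => ?_
    obtain ⟨δ, hδ, hV⟩ := Metric.mem_uniformity_dist.1 hV
    -- As `θ > 0`, the bound `b` grows when time decreases, so its value at `t - 1` serves the whole
    -- neighbourhood `(t - 1, 0]` of `t`.
    obtain ⟨k, hk⟩ := ((hbt (t - 1)).eventually (gt_mem_nhds hδ)).exists
    refine ⟨Iic 0 ∩ Ioi (t - 1), inter_mem self_mem_nhdsWithin
      (mem_nhdsWithin_of_mem_nhds (Ioi_mem_nhds (by linarith))), U (k + 1),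
      (hUg (k + 1)).cont t ht, fun x hx => hV ?_⟩
    rw [dist_eq_norm]
    refine (hdistu k x hx.1).trans_lt (lt_of_le_of_lt ?_ hk)
    refine Real.sqrt_le_sqrt ?_
    have : -(2 * θ * x) ≤ -(2 * θ * (t - 1)) := by
      have := hx.2
      simp only [mem_Ioi] at this
      nlinarith
    gcongr
  -- Fatou's lemma as `m → ∞` transfers the Cauchy bound to the limit, with its rate.
  have hF : ∀ k, IntegrableOn (fun t => Real.exp (2 * θ * t) * ‖u t - U k t‖ ^ 2) (Iic 0) ∧
      ∫ t in Iic 0, Real.exp (2 * θ * t) * ‖u t - U k t‖ ^ 2 ≤ r ^ k * B := by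
    intro k
    refine integrableOn_and_integral_le_of_tendsto (l := atTop) measurableSet_Iic
      (f := fun m t => Real.exp (2 * θ * t) * ‖U (m + k) t - U k t‖ ^ 2) (B := fun _ => r ^ k * B)
      (fun m => ((hUg (m + k)).sub (hUg k)).norm.int) (fun m t _ => by positivity)
      (fun m => hI k m) (fun t ht => ?_) tendsto_const_nhds
    exact ((((tendsto_add_atTop_iff_nat k).2 (hu t ht)).sub_const _).norm.pow 2).const_mul _
  have hug : VL2 θ u := by
    refine ⟨huc, huc.norm, ?_⟩
    have := (hF 0).1
    simpa [hU] using this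
  refine ⟨u, hug, fun t ht => ?_⟩
  have h1 : Tendsto (fun k => T (U k) t) atTop (𝓝 (u t)) := by
    simp only [← hUs]
    exact (tendsto_add_atTop_iff_nat 1).2 (hu t ht)
  refine tendsto_nhds_unique ?_ h1
  rw [tendsto_iff_norm_sub_tendsto_zero]
  refine squeeze_zero (fun _ => norm_nonneg _) (fun k => ?_) (hbt t)
  have h2 := hsup _ _ hug (hUg k) t ht
  have h3 : Real.exp (-(2 * θ * t)) * Real.exp (2 * θ * t) = 1 := by rw [← Real.exp_add]; simp
  rw [norm_sub_rev]
  refine Real.le_sqrt_of_sq_le ?_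
  calc ‖T u t - T (U k) t‖ ^ 2
      = Real.exp (-(2 * θ * t)) * (Real.exp (2 * θ * t) * ‖T u t - T (U k) t‖ ^ 2) := by
        rw [← mul_assoc, h3, one_mul]
    _ ≤ _ := mul_le_mul_of_nonneg_left
        (h2.trans (mul_le_mul_of_nonneg_left (hF k).2 hK)) (Real.exp_pos _).le

/-! ### Fourier coefficients -/

section Coeff

variable (e : HilbertBasis ℕ+ ℝ H)

lemma coeff_add (u w : H) (n : ℕ+) : coeff e (u + w) n = coeff e u n + coeff e w n :=
  inner_add_right _ _ _

lemma coeff_sub (u w : H) (n : ℕ+) : coeff e (u - w) n = coeff e u n - coeff e w n :=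
  inner_sub_right _ _ _

lemma hasSum_coeff_sq (u : H) : HasSum (fun n => coeff e u n ^ 2) (‖u‖ ^ 2) := by
  have h := e.hasSum_inner_mul_inner u u
  rw [real_inner_self_eq_norm_sq] at h
  have h1 : (fun n => coeff e u n ^ 2) = fun n => inner ℝ u (e n) * inner ℝ (e n) u := by
    ext n
    rw [coeff, real_inner_comm, sq]
  rwa [h1]

lemma sum_coeff_sq_le (u : H) (S : Finset ℕ+) : ∑ n ∈ S, coeff e u n ^ 2 ≤ ‖u‖ ^ 2 :=
  sum_le_hasSum S (fun _ _ => sq_nonneg _) (hasSum_coeff_sq e u)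

lemma norm_sq_le_of_sum_coeff {u : H} {B : ℝ} (h : ∀ S : Finset ℕ+, ∑ n ∈ S, coeff e u n ^ 2 ≤ B) :
    ‖u‖ ^ 2 ≤ B :=
  le_of_tendsto (hasSum_coeff_sq e u) (Eventually.of_forall h)

lemma ext_coeff {u w : H} (h : ∀ n, coeff e u n = coeff e w n) : u = w := by
  have h1 := hasSum_coeff_sq e (u - w)
  simp only [coeff_sub, h, sub_self, ne_eq, OfNat.ofNat_ne_zero, not_false_eq_true, zero_pow] at h1
  have h2 := h1.unique hasSum_zero
  rw [← sub_eq_zero, ← norm_eq_zero]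
  exact pow_eq_zero_iff two_ne_zero |>.1 h2

lemma continuousOn_coeff {u : ℝ → H} {s : Set ℝ} (h : ContinuousOn u s) (n : ℕ+) :
    ContinuousOn (fun t => coeff e (u t) n) s := continuousOn_const.inner h

lemma exists_coeff_eq {a : ℕ+ → ℝ} (h : Summable fun n => a n ^ 2) :
    ∃ u : H, ∀ n, coeff e u n = a n := by
  have hm : Memℓp a 2 := by
    refine memℓp_gen ?_
    simpa using h
  refine ⟨e.repr.symm ⟨a, hm⟩, fun n => ?_⟩
  rw [coeff, ← HilbertBasis.repr_apply_apply]
  simp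

variable {θ : ℝ}

lemma VL2.coeff {u : ℝ → H} (hu : VL2 θ u) (n : ℕ+) : WL2 θ (fun t => coeff e (u t) n) :=
  WL2.of_le (continuousOn_coeff e hu.cont n) hu.norm.int fun t _ => by
    simpa using sum_coeff_sq_le e (u t) {n}

lemma sum_weightInt_le {f : ℕ+ → ℝ → ℝ} {S : Finset ℕ+} (hf : ∀ n ∈ S, WL2 θ (f n)) {g : ℝ → ℝ}
    (hg : WL2 θ g) (h : ∀ t ≤ 0, ∑ n ∈ S, f n t ^ 2 ≤ g t ^ 2) :
    ∑ n ∈ S, weightInt θ (f n) ≤ weightInt θ g := by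
  unfold weightInt
  rw [← integral_finsetSum S fun n hn => (hf n hn).int]
  refine setIntegral_mono_on (integrable_finsetSum S fun n hn => (hf n hn).int) hg.int
    measurableSet_Iic fun t ht => ?_
  rw [← Finset.mul_sum]
  gcongr
  exact h t ht

lemma VL2.sum_weightInt_coeff_le {u : ℝ → H} (hu : VL2 θ u) (S : Finset ℕ+) :
    ∑ n ∈ S, weightInt θ (fun t => HypRelax.coeff e (u t) n) ≤ weightInt θ (fun t => ‖u t‖) :=
  sum_weightInt_le (fun n _ => hu.coeff e n) hu.norm fun t _ => sum_coeff_sq_le e (u t) S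

/-- Fatou's lemma along finite sets of modes; this turns sums of one-mode estimates into estimates
in `H`. -/
lemma VL2.of_sum_weightInt_le {u : ℝ → H} (hu : ContinuousOn u (Iic 0))
    (hn : ∀ n, WL2 θ (fun t => HypRelax.coeff e (u t) n)) {B : ℝ}
    (hB : ∀ S : Finset ℕ+, ∑ n ∈ S, weightInt θ (fun t => HypRelax.coeff e (u t) n) ≤ B) :
    VL2 θ u ∧ weightInt θ (fun t => ‖u t‖) ≤ B := by
  have h := integrableOn_and_integral_le_of_tendsto (l := (atTop : Filter (Finset ℕ+)))
    (s := Iic 0) measurableSet_Iic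
    (f := fun S t => ∑ n ∈ S, Real.exp (2 * θ * t) * HypRelax.coeff e (u t) n ^ 2)
    (g := fun t => Real.exp (2 * θ * t) * ‖u t‖ ^ 2) (B := fun _ => B)
    (fun S => integrable_finsetSum S fun n _ => (hn n).int)
    (fun S t _ => Finset.sum_nonneg fun n _ => by positivity)
    (fun S => by
      rw [integral_finsetSum S fun n _ => (hn n).int]
      exact hB S)
    (fun t _ => (hasSum_coeff_sq e (u t)).mul_left _) tendsto_const_nhds
  exact ⟨⟨hu, hu.norm, h.1⟩, h.2⟩

end Coeff

end HypRelax

/-! ### The linear problem: solutions assembled mode by mode -/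

namespace HypRelax

lemma ModeSol.sub {ε θ lam : ℝ} {h₁ u₁ v₁ h₂ u₂ v₂ : ℝ → ℝ} (M₁ : ModeSol ε θ lam h₁ u₁ v₁)
    (M₂ : ModeSol ε θ lam h₂ u₂ v₂) : ModeSol ε θ lam (fun t => h₁ t - h₂ t)
      (fun t => u₁ t - u₂ t) (fun t => v₁ t - v₂ t) where
  force := M₁.force.sub M₂.force
  vel t ht := (M₁.vel t ht).sub (M₂.vel t ht)
  eqn t ht := by
    refine (((M₁.eqn t ht).sub (M₂.eqn t ht)).congr (fun x _ => ?_) ?_).congr_deriv ?_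
    · simp only [Pi.sub_apply]; ring
    · simp only [Pi.sub_apply]; ring
    · ring
  slow := (M₁.disp.sub M₂.disp).int

lemma ModeSol.velocity_eq {θ lam : ℝ} {h u v : ℝ → ℝ} (M : ModeSol 0 θ lam h u v) {t : ℝ}
    (ht : t ≤ 0) : v t = h t - lam * u t := by
  have h1 := M.eqn t ht
  simp only [zero_mul] at h1
  have := (uniqueDiffWithinAt_Iic t |>.mono (Iic_subset_Iic.2 ht)).eq_deriv _ h1
    (hasDerivWithinAt_const t (Iic 0) (0 : ℝ))
  linarith

lemma FinalDatum.sub {l Λ ε lam q₁ v₁ u₁ q₂ v₂ u₂ : ℝ} (hg : l < Λ)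
    (h₁ : FinalDatum l Λ ε lam q₁ v₁ u₁) (h₂ : FinalDatum l Λ ε lam q₂ v₂ u₂) :
    FinalDatum l Λ ε lam (q₁ - q₂) (v₁ - v₂) (u₁ - u₂) := by
  rcases h₁ with ⟨a, rfl⟩ | ⟨a, b, c⟩ <;> rcases h₂ with ⟨a', rfl⟩ | ⟨a', b', c'⟩
  · exact Or.inl ⟨a, sub_zero 0⟩
  · linarith
  · linarith
  · refine Or.inr ⟨a, b, ?_⟩
    rw [← c, ← c']
    unfold slowCoord
    ring

/-- The quadratic degenerates at `ε = 0`, hence two cases. For `ε > 0` the smaller root is the one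
for which `1 - 2εθ` is the positive square root of `1 - 2ε (λ_N + λ_{N+1})`, and `hle` makes this
radicand positive. -/
lemma gapData_theta {lam : ℕ+ → ℝ} {N : ℕ+} {ε : ℝ} (hpos : 0 < lam N) (hgap : lam N < lam (N + 1))
    (hε : 0 ≤ ε) (hle : ε * (3 * lam (N + 1) + lam N) ≤ 1) :
    GapData (lam N) (lam (N + 1)) ε (theta lam N ε) := by
  rcases hε.eq_or_lt with rfl | hε0
  · have h1 : theta lam N 0 = (lam N + lam (N + 1)) / 2 := by
      have : {θ : ℝ | 2 * θ * (0 * θ - 1) + lam (N + 1) + lam N = 0}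
          = {(lam N + lam (N + 1)) / 2} := by
        ext θ
        simp only [mem_ofPred_eq, mem_singleton_iff]
        constructor <;> intro h <;> linarith
      rw [theta, this, csInf_singleton]
    rw [h1]
    exact ⟨hpos, hgap, le_rfl, by simp, by ring, by simp⟩
  · set κ := Real.sqrt (1 - 2 * ε * (lam N + lam (N + 1))) with hκ
    have hdisc : 0 < 1 - 2 * ε * (lam N + lam (N + 1)) := by nlinarith
    have hκ0 : 0 < κ := Real.sqrt_pos.2 hdisc
    have hκ2 : κ ^ 2 = 1 - 2 * ε * (lam N + lam (N + 1)) := Real.sq_sqrt hdisc.le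
    have h1 : theta lam N ε = (1 - κ) / (2 * ε) := by
      have : {θ : ℝ | 2 * θ * (ε * θ - 1) + lam (N + 1) + lam N = 0}
          = {(1 - κ) / (2 * ε), (1 + κ) / (2 * ε)} := by
        ext θ
        simp only [mem_ofPred_eq, mem_insert_iff, mem_singleton_iff]
        rw [eq_div_iff (by positivity), eq_div_iff (by positivity)]
        have h2 : 2 * ε * (2 * θ * (ε * θ - 1) + lam (N + 1) + lam N)
          = (θ * (2 * ε) - (1 - κ)) * (θ * (2 * ε) - (1 + κ)) := by
          linear_combination hκ2
        constructor
        · intro h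
          rw [h, mul_zero] at h2
          rcases mul_eq_zero.1 h2.symm with h3 | h3
          · left; linarith
          · right; linarith
        · intro h
          have : (θ * (2 * ε) - (1 - κ)) * (θ * (2 * ε) - (1 + κ)) = 0 := by
            rcases h with h | h <;> rw [h] <;> ring
          rw [this] at h2
          exact (mul_eq_zero.1 h2).resolve_left (by positivity)
      rw [theta, this, csInf_pair, inf_eq_left]
      gcongr
      linarith
    rw [h1]
    refine ⟨hpos, hgap, hε, hle, ?_, ?_⟩
    · field_simp
      linear_combination hκ2
    · have : 2 * ε * ((1 - κ) / (2 * ε)) = 1 - κ := by field_simp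
      rw [this]; linarith

/-- Continuity of weighted sums of squares, by dominated convergence. -/
lemma tendsto_tsum_sub_sq {μ : ℕ+ → ℝ} (hμ : ∀ n, 0 ≤ μ n) {f : ℝ → ℕ+ → ℝ} {B : ℕ+ → ℝ}
    (hB : Summable B) {t : ℝ} {s : Set ℝ} (ht : t ∈ s)
    (hb : ∀ᶠ x in 𝓝[s] t, ∀ n, μ n * f x n ^ 2 ≤ B n)
    (hc : ∀ n, ContinuousWithinAt (fun x => f x n) s t) :
    Tendsto (fun x => ∑' n, μ n * (f x n - f t n) ^ 2) (𝓝[s] t) (𝓝 0) := by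
  have hbt := hb.self_of_nhdsWithin ht
  have h := tendsto_tsum_of_dominated_convergence (𝓕 := 𝓝[s] t)
    (f := fun x n => μ n * (f x n - f t n) ^ 2) (g := fun _ => (0 : ℝ)) (bound := fun n => 4 * B n)
    (hB.mul_left 4) (fun n => ?_) (hb.mono fun x hx n => ?_)
  · simpa using h
  · have h1 := (((hc n).sub (continuousWithinAt_const (b := f t n))).pow 2).const_mul (μ n)
    have h2 : Tendsto (fun x => μ n * (f x n - f t n) ^ 2) (𝓝[s] t)
        (𝓝 (μ n * (f t n - f t n) ^ 2)) := h1
    simpa using h2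
  · rw [Real.norm_of_nonneg (mul_nonneg (hμ n) (sq_nonneg _))]
    have h1 := hx n
    have h2 := hbt n
    have h3 : μ n * (f x n - f t n) ^ 2 ≤ μ n * (2 * f x n ^ 2 + 2 * f t n ^ 2) := by
      refine mul_le_mul_of_nonneg_left ?_ (hμ n)
      nlinarith [sq_nonneg (f x n + f t n)]
    nlinarith [mul_nonneg (hμ n) (sq_nonneg (f x n)), mul_nonneg (hμ n) (sq_nonneg (f t n))]

section Vector

variable {H : Type*} [NormedAddCommGroup H] [InnerProductSpace ℝ H] [CompleteSpace H]
  {e : HilbertBasis ℕ+ ℝ H} {lam : ℕ+ → ℝ} {N : ℕ+} {ε θ : ℝ}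

lemma normSqHs_nonneg (hpos : ∀ n, 0 < lam n) (s : ℝ) (a : ℕ+ → ℝ) : 0 ≤ normSqHs lam s a :=
  tsum_nonneg fun n => mul_nonneg (Real.rpow_nonneg (hpos n).le _) (sq_nonneg _)

lemma MemHs.sub (hpos : ∀ n, 0 < lam n) {s : ℝ} {a b : ℕ+ → ℝ} (ha : MemHs lam s a)
    (hb : MemHs lam s b) : MemHs lam s (a - b) := by
  refine Summable.of_nonneg_of_le (fun n => mul_nonneg (Real.rpow_nonneg (hpos n).le _)
    (sq_nonneg _)) (fun n => ?_) ((ha.mul_left 2).add (hb.mul_left 2))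
  have h1 : (a n - b n) ^ 2 ≤ 2 * a n ^ 2 + 2 * b n ^ 2 := by nlinarith [sq_nonneg (a n + b n)]
  calc lam n ^ s * (a - b) n ^ 2 ≤ lam n ^ s * (2 * a n ^ 2 + 2 * b n ^ 2) :=
        mul_le_mul_of_nonneg_left h1 (Real.rpow_nonneg (hpos n).le _)
    _ = _ := by ring

lemma coeff_sub_eq (u w : H) : coeff e (u - w) = coeff e u - coeff e w :=
  funext fun n => coeff_sub e u w n

lemma norm_sq_le_normSqHs (hmono : Monotone lam) {u : H}
    (hu : MemHs lam 1 (coeff e u)) : lam 1 * ‖u‖ ^ 2 ≤ normSqHs lam 1 (coeff e u) := by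
  rw [← (hasSum_coeff_sq e u).tsum_eq, ← tsum_mul_left]
  refine Summable.tsum_le_tsum (fun n => ?_) ((hasSum_coeff_sq e u).summable.mul_left _) hu
  rw [Real.rpow_one]
  gcongr
  exact hmono (one_le (a := n))

lemma continuousOn_of_normSqHs (hpos : ∀ n, 0 < lam n) (hmono : Monotone lam) {u : ℝ → H}
    (hu : ∀ t ≤ 0, MemHs lam 1 (coeff e (u t)))
    (h : ∀ t ≤ 0, Tendsto (fun s => normSqHs lam 1 (coeff e (u s) - coeff e (u t)))
      (𝓝[Iic 0] t) (𝓝 0)) : ContinuousOn u (Iic 0) := by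
  intro t ht
  rw [ContinuousWithinAt, tendsto_iff_norm_sub_tendsto_zero]
  have h1 : Tendsto (fun s => Real.sqrt ((lam 1)⁻¹ * normSqHs lam 1 (coeff e (u s) - coeff e (u t))))
      (𝓝[Iic 0] t) (𝓝 0) := by
    have := (Real.continuous_sqrt.tendsto 0).comp
      (by simpa using (h t ht).const_mul (lam 1)⁻¹)
    rwa [Real.sqrt_zero] at this
  refine squeeze_zero' (Eventually.of_forall fun _ => norm_nonneg _) ?_ h1
  filter_upwards [self_mem_nhdsWithin] with s hs
  refine Real.le_sqrt_of_sq_le ?_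
  rw [inv_mul_eq_div, le_div_iff₀ (hpos 1), mul_comm, ← coeff_sub_eq]
  refine norm_sq_le_normSqHs hmono ?_
  rw [coeff_sub_eq]
  exact (hu s hs).sub hpos (hu t ht)

/-- A trajectory `(u, v)` solves the linear problem with the forcing term `h` and the datum `p` mode
by mode. -/
def ModalSol (e : HilbertBasis ℕ+ ℝ H) (lam : ℕ+ → ℝ) (N : ℕ+) (ε θ : ℝ) (h : ℝ → H) (p : H)
    (u : ℝ → H) (v : ℝ → ℕ+ → ℝ) : Prop :=
  ∀ n, ModeSol ε θ (lam n) (fun t => coeff e (h t) n) (fun t => coeff e (u t) n) (fun t => v t n) ∧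
    FinalDatum (lam N) (lam (N + 1)) ε (lam n) (coeff e p n) (v 0 n) (coeff e (u 0) n)

lemma ModalSol.sub (hg : lam N < lam (N + 1)) {h₁ h₂ u₁ u₂ : ℝ → H} {p₁ p₂ : H}
    {v₁ v₂ : ℝ → ℕ+ → ℝ} (M₁ : ModalSol e lam N ε θ h₁ p₁ u₁ v₁)
    (M₂ : ModalSol e lam N ε θ h₂ p₂ u₂ v₂) :
    ModalSol e lam N ε θ (fun t => h₁ t - h₂ t) (p₁ - p₂) (fun t => u₁ t - u₂ t)
      (fun t => v₁ t - v₂ t) := by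
  intro n
  simp only [coeff_sub, Pi.sub_apply]
  exact ⟨(M₁ n).1.sub (M₂ n).1, (M₁ n).2.sub hg (M₂ n).2⟩

/-- The constant in the energy estimates. -/
noncomputable def energyConst (l Λ : ℝ) : ℝ := 2 * modeConst l Λ + 4 * Λ

lemma energyConst_pos {l Λ : ℝ} (hl : 0 < l) (hg : l < Λ) : 0 < energyConst l Λ := by
  have h1 : 0 < Λ - l := by linarith
  have h2 : 0 < Λ := by linarith
  unfold energyConst modeConst
  positivity

namespace ModalSol

variable {h u : ℝ → H} {p : H} {v : ℝ → ℕ+ → ℝ}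

lemma mode_energy_le (M : ModalSol e lam N ε θ h p u v)
    (G : GapData (lam N) (lam (N + 1)) ε θ) {t : ℝ} (ht : t ≤ 0) (n : ℕ+) :
    Real.exp (2 * θ * t) * (ε * v t n ^ 2 + lam n * coeff e (u t) n ^ 2)
      ≤ energyConst (lam N) (lam (N + 1)) *
        (weightInt θ (fun t => coeff e (h t) n) + coeff e p n ^ 2) :=
  ((M n).1.estimates G (M n).2).2 t ht

lemma summable_datum (hh : VL2 θ h) (p : H) :
    Summable fun n => weightInt θ (fun t => coeff e (h t) n) + coeff e p n ^ 2 :=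
  (summable_of_sum_le (fun _ => weightInt_nonneg θ _)
    fun S => hh.sum_weightInt_coeff_le e S).add (hasSum_coeff_sq e p).summable

lemma sum_datum_le (hh : VL2 θ h) (p : H) (S : Finset ℕ+) :
    ∑ n ∈ S, (weightInt θ (fun t => coeff e (h t) n) + coeff e p n ^ 2)
      ≤ weightInt θ (fun t => ‖h t‖) + ‖p‖ ^ 2 := by
  rw [Finset.sum_add_distrib]
  exact add_le_add (hh.sum_weightInt_coeff_le e S) (sum_coeff_sq_le e p S)

/-- The bound for the energy of a mode which is uniform on compact sets. -/
lemma mode_energy_le' (M : ModalSol e lam N ε θ h p u v)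
    (G : GapData (lam N) (lam (N + 1)) ε θ) {T t : ℝ} (hT : T ≤ t) (ht : t ≤ 0) (n : ℕ+) :
    ε * v t n ^ 2 + lam n * coeff e (u t) n ^ 2
      ≤ Real.exp (-(2 * θ * T)) * (energyConst (lam N) (lam (N + 1)) *
        (weightInt θ (fun t => coeff e (h t) n) + coeff e p n ^ 2)) := by
  have h1 := M.mode_energy_le G ht n
  have h2 : Real.exp (-(2 * θ * t)) * Real.exp (2 * θ * t) = 1 := by rw [← Real.exp_add]; simp
  have hC := energyConst_pos G.l_pos G.gap
  have hw := weightInt_nonneg θ (fun t => coeff e (h t) n)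
  have h3 : Real.exp (-(2 * θ * t)) ≤ Real.exp (-(2 * θ * T)) := by
    have := G.theta_pos
    gcongr
  calc ε * v t n ^ 2 + lam n * coeff e (u t) n ^ 2
      = Real.exp (-(2 * θ * t)) * (Real.exp (2 * θ * t) *
          (ε * v t n ^ 2 + lam n * coeff e (u t) n ^ 2)) := by rw [← mul_assoc, h2, one_mul]
    _ ≤ Real.exp (-(2 * θ * t)) * (energyConst (lam N) (lam (N + 1)) *
        (weightInt θ (fun t => coeff e (h t) n) + coeff e p n ^ 2)) := by gcongr
    _ ≤ _ := by gcongr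

lemma exists_summable_bound (M : ModalSol e lam N ε θ h p u v) (hh : VL2 θ h)
    (G : GapData (lam N) (lam (N + 1)) ε θ) (T : ℝ) :
    ∃ B : ℕ+ → ℝ, Summable B ∧ ∀ t, T ≤ t → t ≤ 0 → ∀ n,
      ε * v t n ^ 2 + lam n * coeff e (u t) n ^ 2 ≤ B n :=
  ⟨_, ((summable_datum hh p).mul_left _).mul_left _, fun _ h1 h2 n => M.mode_energy_le' G h1 h2 n⟩

lemma eventually_mem (t : ℝ) : ∀ᶠ x in 𝓝[Iic (0 : ℝ)] t, t - 1 ≤ x ∧ x ≤ 0 :=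
  inter_mem (mem_nhdsWithin_of_mem_nhds (Ici_mem_nhds (by linarith))) self_mem_nhdsWithin

lemma disp_mem (M : ModalSol e lam N ε θ h p u v) (hh : VL2 θ h) (hpos : ∀ n, 0 < lam n)
    (G : GapData (lam N) (lam (N + 1)) ε θ) {t : ℝ} (ht : t ≤ 0) : MemHs lam 1 (coeff e (u t)) := by
  obtain ⟨B, hB, hb⟩ := M.exists_summable_bound hh G t
  refine Summable.of_nonneg_of_le (fun n => ?_) (fun n => ?_) hB
  · have := hpos n; positivity
  · have h1 := hb t le_rfl ht n
    have h2 : 0 ≤ ε * v t n ^ 2 := mul_nonneg G.eps_nonneg (sq_nonneg _)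
    rw [Real.rpow_one]
    linarith

lemma disp_tendsto (M : ModalSol e lam N ε θ h p u v) (hh : VL2 θ h) (hpos : ∀ n, 0 < lam n)
    (G : GapData (lam N) (lam (N + 1)) ε θ) {t : ℝ} (ht : t ≤ 0) :
    Tendsto (fun s => normSqHs lam 1 (coeff e (u s) - coeff e (u t))) (𝓝[Iic 0] t) (𝓝 0) := by
  obtain ⟨B, hB, hb⟩ := M.exists_summable_bound hh G (t - 1)
  refine tendsto_tsum_sub_sq (fun n => Real.rpow_nonneg (hpos n).le _) hB ht ?_
    (fun n => ((M n).1.vel t ht).continuousWithinAt)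
  filter_upwards [eventually_mem t] with x hx n
  have h1 := hb x hx.1 hx.2 n
  have h2 : 0 ≤ ε * v x n ^ 2 := mul_nonneg G.eps_nonneg (sq_nonneg _)
  rw [Real.rpow_one]
  linarith

/-- For `ε > 0` the energy dominates `ε v²`, which suffices for any bounded weight `λ_n^s`; it is
used for `s = 0` and `s = -1`. -/
lemma vel_mem_of_pos (M : ModalSol e lam N ε θ h p u v) (hh : VL2 θ h) (hpos : ∀ n, 0 < lam n)
    (G : GapData (lam N) (lam (N + 1)) ε θ) (hε : 0 < ε) {s a : ℝ} (ha : ∀ n, lam n ^ s ≤ a) {t : ℝ}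
    (ht : t ≤ 0) : MemHs lam s (v t) ∧
      Tendsto (fun x => normSqHs lam s (v x - v t)) (𝓝[Iic 0] t) (𝓝 0) := by
  obtain ⟨B, hB, hb⟩ := M.exists_summable_bound hh G (t - 1)
  have hle : ∀ x, t - 1 ≤ x ∧ x ≤ 0 → ∀ n, lam n ^ s * v x n ^ 2 ≤ a * (ε⁻¹ * B n) := by
    intro x hx n
    have h1 := hb x hx.1 hx.2 n
    have h2 : 0 ≤ lam n * coeff e (u x) n ^ 2 := mul_nonneg (hpos n).le (sq_nonneg _)
    have h3 : v x n ^ 2 ≤ ε⁻¹ * B n := by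
      rw [inv_mul_eq_div, le_div_iff₀ hε]; linarith
    have h4 := Real.rpow_nonneg (hpos n).le s
    exact mul_le_mul (ha n) h3 (sq_nonneg _) (h4.trans (ha n))
  refine ⟨Summable.of_nonneg_of_le (fun n => mul_nonneg (Real.rpow_nonneg (hpos n).le _)
    (sq_nonneg _)) (hle t ⟨by linarith, ht⟩) ((hB.mul_left _).mul_left _), ?_⟩
  refine tendsto_tsum_sub_sq (fun n => Real.rpow_nonneg (hpos n).le _)
    ((hB.mul_left ε⁻¹).mul_left a) ht ((eventually_mem t).mono hle) (fun n => ?_)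
  have h1 := ((M n).1.eqn t ht).continuousWithinAt.const_mul ε⁻¹
  refine h1.congr (fun x _ => ?_) ?_ <;> field_simp

lemma rpow_neg_one_le (hpos : ∀ n, 0 < lam n) (hmono : Monotone lam) (n : ℕ+) :
    lam n ^ (-1 : ℝ) ≤ (lam 1)⁻¹ := by
  rw [Real.rpow_neg_one]
  exact inv_anti₀ (hpos 1) (hmono (one_le (a := n)))

/-- At `ε = 0` the energy does not see the velocity. It is read off the equation, `v = h - A u`, so
that `H` control of `h` and `H¹` control of `u` give `H⁻¹` control of `v`. -/
lemma vel_mem_of_zero (M : ModalSol e lam N 0 θ h p u v) (hh : VL2 θ h) (hpos : ∀ n, 0 < lam n)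
    (hmono : Monotone lam) (G : GapData (lam N) (lam (N + 1)) 0 θ) {t : ℝ} (ht : t ≤ 0) :
    MemHs lam (-1) (v t) ∧
      Tendsto (fun x => normSqHs lam (-1) (v x - v t)) (𝓝[Iic 0] t) (𝓝 0) := by
  have key : ∀ n (a b : ℝ), lam n ^ (-1 : ℝ) * (a - lam n * b) ^ 2
      ≤ 2 * (lam 1)⁻¹ * a ^ 2 + 2 * (lam n ^ (1 : ℝ) * b ^ 2) := by
    intro n a b
    have hn := hpos n
    have h1 := rpow_neg_one_le hpos hmono n
    rw [Real.rpow_neg_one] at h1 ⊢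
    rw [Real.rpow_one]
    have h2 : (a - lam n * b) ^ 2 ≤ 2 * a ^ 2 + 2 * (lam n * b) ^ 2 := by
      nlinarith [sq_nonneg (a + lam n * b)]
    calc (lam n)⁻¹ * (a - lam n * b) ^ 2 ≤ (lam n)⁻¹ * (2 * a ^ 2 + 2 * (lam n * b) ^ 2) := by gcongr
      _ = 2 * (lam n)⁻¹ * a ^ 2 + 2 * (lam n * b ^ 2) := by field_simp
      _ ≤ _ := by gcongr
  have hnn : ∀ n (a : ℝ), 0 ≤ lam n ^ (-1 : ℝ) * a ^ 2 := fun n a =>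
    mul_nonneg (Real.rpow_nonneg (hpos n).le _) (sq_nonneg _)
  have hv : ∀ x ≤ 0, ∀ n, v x n = coeff e (h x) n - lam n * coeff e (u x) n := fun x hx n =>
    (M n).1.velocity_eq hx
  constructor
  · refine Summable.of_nonneg_of_le (fun n => hnn n _) (fun n => ?_)
      (((hasSum_coeff_sq e (h t)).summable.mul_left (2 * (lam 1)⁻¹)).add
        ((M.disp_mem hh hpos G ht).mul_left 2))
    rw [hv t ht]
    exact key n _ _
  · have h1 : Tendsto (fun x => 2 * (lam 1)⁻¹ * ‖h x - h t‖ ^ 2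
        + 2 * normSqHs lam 1 (coeff e (u x) - coeff e (u t))) (𝓝[Iic 0] t) (𝓝 0) := by
      have h2 := tendsto_iff_norm_sub_tendsto_zero.1 (hh.cont t ht)
      simpa using ((h2.pow 2).const_mul (2 * (lam 1)⁻¹)).add
        ((M.disp_tendsto hh hpos G ht).const_mul 2)
    refine squeeze_zero' (Eventually.of_forall fun _ => normSqHs_nonneg hpos _ _) ?_ h1
    filter_upwards [self_mem_nhdsWithin] with x hx
    have hsum := hasSum_coeff_sq e (h x - h t)
    have hmem := (M.disp_mem hh hpos G hx).sub hpos (M.disp_mem hh hpos G ht)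
    have hsm := (hsum.summable.mul_left (2 * (lam 1)⁻¹)).add (hmem.mul_left 2)
    have hle : ∀ n, lam n ^ (-1 : ℝ) * (v x - v t) n ^ 2 ≤ 2 * (lam 1)⁻¹ * coeff e (h x - h t) n ^ 2
        + 2 * (lam n ^ (1 : ℝ) * (coeff e (u x) - coeff e (u t)) n ^ 2) := by
      intro n
      have : (v x - v t) n = coeff e (h x - h t) n
          - lam n * (coeff e (u x) - coeff e (u t)) n := by
        simp only [Pi.sub_apply, coeff_sub, hv x hx, hv t ht]; ring
      rw [this]
      exact key n _ _
    have := Summable.tsum_le_tsum hle (Summable.of_nonneg_of_le (fun n => hnn n _) hle hsm) hsm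
    rw [Summable.tsum_add (hsum.summable.mul_left (2 * (lam 1)⁻¹)) (hmem.mul_left 2),
      tsum_mul_left, tsum_mul_left, hsum.tsum_eq] at this
    exact this

lemma vl2_disp (M : ModalSol e lam N ε θ h p u v) (hh : VL2 θ h) (hpos : ∀ n, 0 < lam n)
    (hmono : Monotone lam) (G : GapData (lam N) (lam (N + 1)) ε θ) : VL2 θ u := by
  have hc := continuousOn_of_normSqHs hpos hmono (fun t ht => M.disp_mem hh hpos G ht)
    (fun t ht => M.disp_tendsto hh hpos G ht)
  have hδ : 0 < (lam (N + 1) - lam N) / 2 := by linarith [G.gap]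
  refine (VL2.of_sum_weightInt_le e hc (fun n => (M n).1.disp)
    (B := ((1 + 1) * weightInt θ (fun t => ‖h t‖) + (1 + 1 / 1) * (lam (N + 1) * ‖p‖ ^ 2))
      / ((lam (N + 1) - lam N) / 2) ^ 2) fun S => ?_).1
  rw [le_div_iff₀ (by positivity), mul_comm, Finset.mul_sum]
  refine (Finset.sum_le_sum fun n _ => ((M n).1.estimates G (M n).2).1 1 one_pos).trans ?_
  rw [Finset.sum_add_distrib, ← Finset.mul_sum, ← Finset.mul_sum, ← Finset.mul_sum]
  have := hpos (N + 1)
  gcongr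
  · exact hh.sum_weightInt_coeff_le e S
  · exact sum_coeff_sq_le e p S

/-- The weighted `L²` estimate. -/
theorem weightInt_le (M : ModalSol e lam N ε θ h p u v) (hh : VL2 θ h) (hu : VL2 θ u)
    (hpos : ∀ n, 0 < lam n) (G : GapData (lam N) (lam (N + 1)) ε θ) {η : ℝ} (hη : 0 < η) :
    ((lam (N + 1) - lam N) / 2) ^ 2 * weightInt θ (fun t => ‖u t‖)
      ≤ (1 + η) * weightInt θ (fun t => ‖h t‖) + (1 + 1 / η) * (lam (N + 1) * ‖p‖ ^ 2) := by
  have hδ : 0 < (lam (N + 1) - lam N) / 2 := by linarith [G.gap]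
  rw [mul_comm, ← le_div_iff₀ (by positivity)]
  refine (VL2.of_sum_weightInt_le e hu.cont (fun n => (M n).1.disp) fun S => ?_).2
  rw [le_div_iff₀ (by positivity), mul_comm, Finset.mul_sum]
  refine (Finset.sum_le_sum fun n _ => ((M n).1.estimates G (M n).2).1 η hη).trans ?_
  rw [Finset.sum_add_distrib, ← Finset.mul_sum, ← Finset.mul_sum, ← Finset.mul_sum]
  have := hpos (N + 1)
  gcongr
  · exact hh.sum_weightInt_coeff_le e S
  · exact sum_coeff_sq_le e p S

/-- The pointwise energy estimate. -/
theorem sum_energy_le (M : ModalSol e lam N ε θ h p u v) (hh : VL2 θ h)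
    (G : GapData (lam N) (lam (N + 1)) ε θ) {t : ℝ} (ht : t ≤ 0) (S : Finset ℕ+) :
    Real.exp (2 * θ * t) * ∑ n ∈ S, (ε * v t n ^ 2 + lam n * coeff e (u t) n ^ 2)
      ≤ energyConst (lam N) (lam (N + 1)) * (weightInt θ (fun t => ‖h t‖) + ‖p‖ ^ 2) := by
  rw [Finset.mul_sum]
  refine (Finset.sum_le_sum fun n _ => M.mode_energy_le G ht n).trans ?_
  rw [← Finset.mul_sum]
  exact mul_le_mul_of_nonneg_left (sum_datum_le hh p S) (energyConst_pos G.l_pos G.gap).le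

lemma norm_sq_le (M : ModalSol e lam N ε θ h p u v) (hh : VL2 θ h) (hpos : ∀ n, 0 < lam n)
    (hmono : Monotone lam) (G : GapData (lam N) (lam (N + 1)) ε θ) {t : ℝ} (ht : t ≤ 0) :
    Real.exp (2 * θ * t) * ‖u t‖ ^ 2
      ≤ energyConst (lam N) (lam (N + 1)) / lam 1 * (weightInt θ (fun t => ‖h t‖) + ‖p‖ ^ 2) := by
  have hE := Real.exp_pos (2 * θ * t)
  rw [div_mul_eq_mul_div, mul_comm, ← le_div_iff₀ hE]
  refine norm_sq_le_of_sum_coeff e fun S => ?_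
  rw [le_div_iff₀ hE, le_div_iff₀ (hpos 1)]
  refine le_trans ?_ (M.sum_energy_le hh G ht S)
  rw [mul_comm _ (Real.exp _), mul_assoc, Finset.sum_mul]
  gcongr with n
  have h1 := hmono (one_le (a := n))
  have h2 : 0 ≤ ε * v t n ^ 2 := mul_nonneg G.eps_nonneg (sq_nonneg _)
  nlinarith [mul_le_mul_of_nonneg_right h1 (sq_nonneg (coeff e (u t) n))]

end ModalSol

end Vector

end HypRelax

/-! ### Unique solvability of the nonlinear backward problem -/

namespace HypRelax

section Solvability

variable {H : Type*} [NormedAddCommGroup H] [InnerProductSpace ℝ H] [CompleteSpace H]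
  {e : HilbertBasis ℕ+ ℝ H} {lam : ℕ+ → ℝ} {N : ℕ+} {ε : ℝ}

lemma coeff_sum_smul (a : ℕ+ → ℝ) (n : ℕ+) :
    coeff e (∑ k ∈ Finset.Icc 1 N, a k • e k) n = if n ≤ N then a n else 0 := by
  rw [coeff, inner_sum]
  simp only [real_inner_smul_right, orthonormal_iff_ite.1 e.orthonormal, mul_ite, mul_one, mul_zero]
  rw [Finset.sum_ite_eq]
  simp

/-- The final condition decouples into modes: it fixes the slow coordinate for `n ≤ N` and leaves
the fast modes free. -/
lemma initial_iff {a b : ℕ+ → ℝ} {p : H} : projHat e lam N ε a + projCal e lam N ε b = p ↔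
    ∀ n, (if n ≤ N then slowCoord ε (lam n) (a n) (b n) else 0) = coeff e p n := by
  have h : ∀ n, coeff e (projHat e lam N ε a + projCal e lam N ε b) n
      = if n ≤ N then slowCoord ε (lam n) (a n) (b n) else 0 := by
    intro n
    rw [coeff_add, projHat, projCal, coeff_sum_smul, coeff_sum_smul]
    split_ifs
    · rfl
    · simp
  constructor
  · rintro rfl n
    exact (h n).symm
  · intro h1
    exact ext_coeff e fun n => (h n).trans (h1 n)

lemma coeff_eq_zero_of_mem_spanPN {p : H} (hp : p ∈ spanPN e N) {n : ℕ+} (hn : N < n) :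
    coeff e p n = 0 := by
  have h : spanPN e N ≤ LinearMap.ker (innerSL ℝ (e n)).toLinearMap := by
    refine Submodule.span_le.2 ?_
    rintro _ ⟨k, hk, rfl⟩
    have : n ≠ k := fun h => absurd (h ▸ hk : n ≤ N) (not_le.2 hn)
    simpa using e.orthonormal.2 this
  have h1 := h hp
  simpa [coeff] using h1

/-- A solution of the nonlinear backward problem is a modal solution with the forcing term
`F(u)`. -/
lemma IsSlowBackwardSolution.modal (hpos : ∀ n, 0 < lam n) (hmono : Monotone lam)
    (G : GapData (lam N) (lam (N + 1)) ε (theta lam N ε))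
    {F : H → H} {L : ℝ} {p : H} {ξ : ℝ → H × (ℕ+ → ℝ)}
    (hξ : IsSlowBackwardSolution e lam F N ε p ξ)
    (hF : ∀ u₁ u₂ : H, ‖F u₁ - F u₂‖ ≤ L * ‖u₁ - u₂‖) (hF0 : F 0 = 0) :
    VL2 (theta lam N ε) (fun t => (ξ t).1) ∧
      ModalSol e lam N ε (theta lam N ε) (fun t => F (ξ t).1) p (fun t => (ξ t).1)
        (fun t => (ξ t).2) := by
  have huc : ContinuousOn (fun t => (ξ t).1) (Iic 0) := by
    refine continuousOn_of_normSqHs hpos hmono (fun t ht => (hξ.mem t ht).fst_mem) fun t ht => ?_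
    have h1 := (hξ.cont t ht).pow 2
    rw [zero_pow two_ne_zero] at h1
    refine squeeze_zero (fun _ => normSqHs_nonneg hpos _ _) (fun s => ?_) h1
    have n1 := normSqHs_nonneg hpos 0 (ξ s - ξ t).2
    have n2 := normSqHs_nonneg hpos (-1) (ξ s - ξ t).2
    have n3 := normSqHs_nonneg hpos 1 (coeff e (ξ s - ξ t).1)
    have n4 := mul_nonneg G.eps_nonneg n1
    rw [energyNorm, Real.sq_sqrt (by positivity), ← coeff_sub_eq]
    rw [Prod.fst_sub] at n3 ⊢
    linarith
  have hu : VL2 (theta lam N ε) (fun t => (ξ t).1) := ⟨huc, huc.norm, hξ.slow⟩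
  have hh := hu.comp_lipschitz hF hF0
  refine ⟨hu, fun n => ⟨⟨hh.coeff e n, fun t ht => hξ.velocity t ht n,
    fun t ht => hξ.equation t ht n, (hu.coeff e n).int⟩, ?_⟩⟩
  have h1 := initial_iff.1 hξ.initial n
  split_ifs at h1 with hn
  · exact Or.inr ⟨hpos n, hmono hn, h1⟩
  · exact Or.inl ⟨hmono (Order.add_one_le_of_lt (not_le.1 hn)), h1.symm⟩

/-- A modal solution with the forcing term `F(u)` is a solution of the nonlinear backward problem. -/
lemma ModalSol.isSlowBackwardSolution (hpos : ∀ n, 0 < lam n) (hmono : Monotone lam)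
    (G : GapData (lam N) (lam (N + 1)) ε (theta lam N ε))
    {F : H → H} {h u : ℝ → H} {v : ℝ → ℕ+ → ℝ} {p : H}
    (M : ModalSol e lam N ε (theta lam N ε) h p u v) (hh : VL2 (theta lam N ε) h)
    (hu : ∀ t ≤ 0, h t = F (u t)) :
    IsSlowBackwardSolution e lam F N ε p (fun t => (u t, v t)) := by
  have hv : ∀ t ≤ 0, MemHs lam (-1) (v t) ∧
      Tendsto (fun x => normSqHs lam (-1) (v x - v t)) (𝓝[Iic 0] t) (𝓝 0) := by
    intro t ht
    rcases G.eps_nonneg.eq_or_lt with h0 | h0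
    · subst h0
      exact M.vel_mem_of_zero hh hpos hmono G ht
    · exact M.vel_mem_of_pos hh hpos G h0 (rpow_neg_one_le hpos hmono) ht
  have hv0 : 0 < ε → ∀ t ≤ 0, MemHs lam 0 (v t) ∧
      Tendsto (fun x => normSqHs lam 0 (v x - v t)) (𝓝[Iic 0] t) (𝓝 0) := fun h0 t ht =>
    M.vel_mem_of_pos hh hpos G h0 (a := 1) (fun n => by simp) ht
  refine ⟨fun t ht => ⟨M.disp_mem hh hpos G ht, (hv t ht).1, fun h0 =>
    (hv0 (G.eps_nonneg.lt_of_ne h0.symm) t ht).1⟩, fun t ht => ?_, fun t ht n => (M n).1.vel t ht,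
    fun t ht n => ?_, (M.vl2_disp hh hpos hmono G).norm.int, initial_iff.2 fun n => ?_⟩
  · have h1 : Tendsto (fun s => ε * normSqHs lam 0 (v s - v t)) (𝓝[Iic 0] t) (𝓝 0) := by
      rcases G.eps_nonneg.eq_or_lt with h0 | h0
      · simpa [← h0] using tendsto_const_nhds
      · simpa using (hv0 h0 t ht).2.const_mul ε
    have h2 := (h1.add (hv t ht).2).add (M.disp_tendsto hh hpos G ht)
    have h3 := (Real.continuous_sqrt.tendsto _).comp h2
    simp only [add_zero, Real.sqrt_zero] at h3
    refine h3.congr fun s => ?_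
    simp only [Function.comp_apply, energyNorm, Prod.fst_sub, Prod.snd_sub, coeff_sub_eq]
  · have h1 := (M n).1.eqn t ht
    simp only [hu t ht] at h1
    exact h1
  · rcases (M n).2 with ⟨h1, h2⟩ | ⟨_, h1, h2⟩
    · rw [if_neg, h2]
      intro hn
      linarith [hmono hn, G.gap]
    · rw [if_pos, h2]
      by_contra hn
      linarith [hmono (Order.add_one_le_of_lt (not_le.1 hn)), G.gap]

/-- Solvability of the linear problem. -/
lemma exists_modalSol (hpos : ∀ n, 0 < lam n) (hmono : Monotone lam)
    (G : GapData (lam N) (lam (N + 1)) ε (theta lam N ε))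
    {h : ℝ → H} (hh : VL2 (theta lam N ε) h) {p : H} (hp : p ∈ spanPN e N) :
    ∃ (u : ℝ → H) (v : ℝ → ℕ+ → ℝ), ModalSol e lam N ε (theta lam N ε) h p u v := by
  have hex : ∀ n, ∃ a b : ℝ → ℝ, ModeSol ε (theta lam N ε) (lam n) (fun t => coeff e (h t) n) a b ∧
      FinalDatum (lam N) (lam (N + 1)) ε (lam n) (coeff e p n) (b 0) (a 0) := by
    intro n
    refine exists_modeSol G (hh.coeff e n) ?_
    by_cases hn : n ≤ N
    · exact Or.inr ⟨hpos n, hmono hn⟩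
    · exact Or.inl ⟨hmono (Order.add_one_le_of_lt (not_le.1 hn)),
        coeff_eq_zero_of_mem_spanPN hp (not_le.1 hn)⟩
  choose a b hab hq using hex
  -- The pointwise mode bounds are summable and `λ_n ≥ λ_1 > 0`, so for each `t ≤ 0` the scalar
  -- solutions are the coefficients of a vector; for `t > 0` the value is arbitrary.
  have hsum : ∀ t, ∃ x : H, t ≤ 0 → ∀ n, coeff e x n = a n t := by
    intro t
    by_cases ht : t ≤ 0
    · have hs : Summable fun n => a n t ^ 2 := by
        refine Summable.of_nonneg_of_le (fun n => sq_nonneg _) (fun n => ?_)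
          ((((ModalSol.summable_datum (e := e) hh p).mul_left
            (energyConst (lam N) (lam (N + 1)))).mul_left
            (Real.exp (-(2 * theta lam N ε * t)))).mul_left (lam 1)⁻¹)
        have h1 := ((hab n).estimates G (hq n)).2 t ht
        have h2 : Real.exp (-(2 * theta lam N ε * t)) * Real.exp (2 * theta lam N ε * t) = 1 := by
          rw [← Real.exp_add]; simp
        have h3 : ε * b n t ^ 2 + lam n * a n t ^ 2 ≤ Real.exp (-(2 * theta lam N ε * t)) *
            (energyConst (lam N) (lam (N + 1)) *
              (weightInt (theta lam N ε) (fun t => coeff e (h t) n) + coeff e p n ^ 2)) := by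
          calc ε * b n t ^ 2 + lam n * a n t ^ 2 = Real.exp (-(2 * theta lam N ε * t)) *
              (Real.exp (2 * theta lam N ε * t) * (ε * b n t ^ 2 + lam n * a n t ^ 2)) := by
                rw [← mul_assoc, h2, one_mul]
            _ ≤ _ := mul_le_mul_of_nonneg_left h1 (Real.exp_pos _).le
        rw [inv_mul_eq_div, le_div_iff₀ (hpos 1)]
        have h4 : 0 ≤ ε * b n t ^ 2 := mul_nonneg G.eps_nonneg (sq_nonneg _)
        have h5 := mul_le_mul_of_nonneg_right (hmono (one_le (a := n))) (sq_nonneg (a n t))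
        linarith
      obtain ⟨x, hx⟩ := exists_coeff_eq e hs
      exact ⟨x, fun _ => hx⟩
    · exact ⟨0, fun h => absurd h ht⟩
  choose u hu using hsum
  refine ⟨u, fun t n => b n t, fun n => ⟨⟨(hab n).force, fun t ht => ?_, fun t ht => ?_, ?_⟩, ?_⟩⟩
  · exact ((hab n).vel t ht).congr (fun x hx => hu x hx n) (hu t ht n)
  · rw [hu t ht n]
    exact (hab n).eqn t ht
  · refine (hab n).slow.congr_fun (fun t ht => ?_) measurableSet_Iic
    simp only [hu t ht n]
  · rw [hu 0 le_rfl n]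
    exact hq n

/-- Unique solvability of the nonlinear backward problem. -/
theorem uniquelySolvable (hpos : ∀ n, 0 < lam n) (hmono : Monotone lam)
    (G : GapData (lam N) (lam (N + 1)) ε (theta lam N ε))
    {F : H → H} {L : ℝ}
    (hF : ∀ u₁ u₂ : H, ‖F u₁ - F u₂‖ ≤ L * ‖u₁ - u₂‖) (hF0 : F 0 = 0)
    (hL0 : 0 ≤ L) (hL : L < (lam (N + 1) - lam N) / 2) {p : H} (hp : p ∈ spanPN e N) :
    UniquelySolvable e lam F N ε p := by
  set θ := theta lam N ε
  set δ := (lam (N + 1) - lam N) / 2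
  have hδ : 0 < δ := hL0.trans_lt hL
  have hC := energyConst_pos G.l_pos G.gap
  -- The strict gap condition leaves room for Young's parameter.
  obtain ⟨η, hη, hη1⟩ : ∃ η > 0, (1 + η) * L ^ 2 < δ ^ 2 := by
    have h1 : L ^ 2 < δ ^ 2 := by gcongr
    refine ⟨(δ ^ 2 - L ^ 2) / (2 * (L ^ 2 + 1)), div_pos (by linarith) (by positivity), ?_⟩
    have h2 : (δ ^ 2 - L ^ 2) / (2 * (L ^ 2 + 1)) * L ^ 2 ≤ (δ ^ 2 - L ^ 2) / 2 := by
      rw [div_mul_eq_mul_div, div_le_div_iff₀ (by positivity) (by positivity)]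
      nlinarith
    linarith
  -- In the difference of two solutions the datum is `p - p = 0`, and only the Lipschitz bound of
  -- the forcing remains.
  have hLip : ∀ (u₁ u₂ w₁ w₂ : ℝ → H) (v₁ v₂ : ℝ → ℕ+ → ℝ), VL2 θ w₁ → VL2 θ w₂ →
      ModalSol e lam N ε θ (fun t => F (w₁ t)) p u₁ v₁ →
      ModalSol e lam N ε θ (fun t => F (w₂ t)) p u₂ v₂ →
      weightInt θ (fun t => ‖u₁ t - u₂ t‖)
        ≤ (1 + η) * L ^ 2 / δ ^ 2 * weightInt θ (fun t => ‖w₁ t - w₂ t‖) ∧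
      ∀ t ≤ 0, Real.exp (2 * θ * t) * ‖u₁ t - u₂ t‖ ^ 2
        ≤ energyConst (lam N) (lam (N + 1)) / lam 1 * L ^ 2 *
          weightInt θ (fun t => ‖w₁ t - w₂ t‖) := by
    intro u₁ u₂ w₁ w₂ v₁ v₂ hw₁ hw₂ M₁ M₂
    have M := M₁.sub G.gap M₂
    have hh := (hw₁.comp_lipschitz hF hF0).sub (hw₂.comp_lipschitz hF hF0)
    have hw := hw₁.weightInt_lipschitz_le hw₂ hF hF0
    constructor
    · have h1 := M.weightInt_le hh (M.vl2_disp hh hpos hmono G) hpos G hη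
      rw [sub_self, norm_zero] at h1
      rw [div_mul_eq_mul_div, le_div_iff₀ (by positivity), mul_comm]
      refine h1.trans ?_
      have := mul_le_mul_of_nonneg_left hw (by positivity : 0 ≤ 1 + η)
      linarith
    · intro t ht
      have h1 := M.norm_sq_le hh hpos hmono G ht
      rw [sub_self, norm_zero, zero_pow two_ne_zero, add_zero] at h1
      refine h1.trans ?_
      rw [mul_assoc]
      have := (div_pos hC (hpos 1)).le
      gcongr
  constructor
  -- The solution map must be total; outside the weighted space its value is irrelevant.
  · have hsol : ∀ w : ℝ → H, ∃ (u : ℝ → H) (v : ℝ → ℕ+ → ℝ), VL2 θ w →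
        ModalSol e lam N ε θ (fun t => F (w t)) p u v := by
      intro w
      by_cases hw : VL2 θ w
      · obtain ⟨u, v, huv⟩ := exists_modalSol hpos hmono G (hw.comp_lipschitz hF hF0) hp
        exact ⟨u, v, fun _ => huv⟩
      · exact ⟨0, 0, fun h => absurd h hw⟩
    choose T V hTV using hsol
    obtain ⟨u, hu, hfix⟩ := exists_fixedPoint_of_contraction (r := (1 + η) * L ^ 2 / δ ^ 2)
      (K := energyConst (lam N) (lam (N + 1)) / lam 1 * L ^ 2) G.theta_pos (by positivity)
      ((div_lt_one (by positivity)).2 hη1) (mul_nonneg (div_pos hC (hpos 1)).le (sq_nonneg _)) T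
      (fun w hw => (hTV w hw).vl2_disp (hw.comp_lipschitz hF hF0) hpos hmono G)
      (fun w₁ w₂ h₁ h₂ => (hLip _ _ w₁ w₂ _ _ h₁ h₂ (hTV w₁ h₁) (hTV w₂ h₂)).1)
      (fun w₁ w₂ h₁ h₂ => (hLip _ _ w₁ w₂ _ _ h₁ h₂ (hTV w₁ h₁) (hTV w₂ h₂)).2)
    exact ⟨_, (hTV u hu).isSlowBackwardSolution hpos hmono G (hu.comp_lipschitz hF hF0)
      fun t ht => by rw [hfix t ht]⟩
  · intro ξ ζ hξ hζ
    obtain ⟨hu, Mu⟩ := hξ.modal hpos hmono G hF hF0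
    obtain ⟨hw, Mw⟩ := hζ.modal hpos hmono G hF hF0
    obtain ⟨h1, h2⟩ := hLip _ _ _ _ _ _ hu hw Mu Mw
    have hI := weightInt_nonneg θ (fun t => ‖(ξ t).1 - (ζ t).1‖)
    -- Each solution generates its own forcing, so the contraction estimate bounds this quantity by
    -- itself times a factor below one.
    have hzero : weightInt θ (fun t => ‖(ξ t).1 - (ζ t).1‖) = 0 := by
      have h3 : (1 + η) * L ^ 2 / δ ^ 2 < 1 := (div_lt_one (by positivity)).2 hη1
      nlinarith
    have heq : ∀ t ≤ 0, (ξ t).1 = (ζ t).1 := by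
      intro t ht
      have h3 := h2 t ht
      rw [hzero, mul_zero] at h3
      have h4 : ‖(ξ t).1 - (ζ t).1‖ ^ 2 ≤ 0 :=
        nonpos_of_mul_nonpos_right h3 (Real.exp_pos _)
      exact sub_eq_zero.1 (norm_eq_zero.1 (pow_eq_zero_iff two_ne_zero |>.1
        (le_antisymm h4 (sq_nonneg _))))
    intro t ht
    refine Prod.ext (heq t ht) (funext fun n => ?_)
    have h3 := hξ.velocity t ht n
    have h4 := (hζ.velocity t ht n).congr (f₁ := fun s => coeff e (ξ s).1 n)
      (fun s hs => by rw [heq s hs]) (by rw [heq t ht])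
    exact (uniqueDiffWithinAt_Iic t |>.mono (Iic_subset_Iic.2 ht)).eq_deriv _ h3 h4

end Solvability

end HypRelax

namespace HypRelax

/-! ### Time increments -/

-- Shifts go to the past only, so the half-line is preserved; the weight changes by the factor
-- `e^{2θτ}`.
lemma WL2.shift {θ τ : ℝ} {f : ℝ → ℝ} (hf : WL2 θ f) (hτ : 0 ≤ τ) : WL2 θ (fun t => f (t - τ)) := by
  refine ⟨hf.cont.comp (by fun_prop) fun t ht => ?_, ?_⟩
  · simp only [mem_Iic] at ht ⊢
    linarith
  · have h1 : IntegrableOn ((fun t => Real.exp (2 * θ * τ) * (Real.exp (2 * θ * t) * f t ^ 2)) ∘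
        fun t => t - τ) ((fun t => t - τ) ⁻¹' Iic 0) :=
      ((measurePreserving_sub_right volume τ).integrableOn_comp_preimage
        (measurableEmbedding_subRight τ)).2 (hf.int.const_mul _)
    have h2 : Iic (0 : ℝ) ⊆ (fun t => t - τ) ⁻¹' Iic 0 := fun t ht => by
      simp only [mem_preimage, mem_Iic] at ht ⊢
      linarith
    refine (h1.mono_set h2).congr_fun (fun t _ => ?_) measurableSet_Iic
    simp only [Function.comp_apply]
    rw [← mul_assoc, ← Real.exp_add]
    ring_nf

lemma hasDerivWithinAt_shift {f : ℝ → ℝ} {f' τ t : ℝ} (hτ : 0 ≤ τ)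
    (h : HasDerivWithinAt f f' (Iic 0) (t - τ)) :
    HasDerivWithinAt (fun t => f (t - τ)) f' (Iic 0) t := by
  have h1 : HasDerivWithinAt (fun t : ℝ => t - τ) 1 (Iic 0) t :=
    ((hasDerivAt_id t).sub_const τ).hasDerivWithinAt
  have h2 := h.scomp (h := fun t : ℝ => t - τ) t h1 fun x hx => by
    simp only [mem_Iic] at hx ⊢
    linarith
  simpa [Function.comp_def] using h2

lemma ModeSol.shift {ε θ lam τ : ℝ} {h u v : ℝ → ℝ} (M : ModeSol ε θ lam h u v) (hτ : 0 ≤ τ) :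
    ModeSol ε θ lam (fun t => h (t - τ)) (fun t => u (t - τ)) (fun t => v (t - τ)) where
  force := M.force.shift hτ
  vel t ht := hasDerivWithinAt_shift hτ (M.vel (t - τ) (by linarith))
  eqn t ht := hasDerivWithinAt_shift (f := fun s => ε * v s) hτ (M.eqn (t - τ) (by linarith))
  slow := (M.disp.shift hτ).int

/-- Cauchy–Schwarz in time, obtained by integrating `2 m z - m² ≤ z²` with `m` the mean slope. -/
lemma sq_increment_le {u z : ℝ → ℝ} (hz : ContinuousOn z (Iic 0))
    (hd : ∀ t ≤ 0, HasDerivWithinAt u (z t) (Iic 0) t) {τ t : ℝ} (hτ : 0 < τ) (ht : t ≤ 0) :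
    (u t - u (t - τ)) ^ 2 ≤ τ * ∫ s in (t - τ)..t, z s ^ 2 := by
  set m := (u t - u (t - τ)) / τ with hm
  have h := sub_le_integral_of_deriv_le (E := fun s => 2 * m * u s - m ^ 2 * s)
    (E' := fun s => 2 * m * z s - m ^ 2 * 1) (f := fun s => z s ^ 2) (T := t - τ) (t := t)
    (by linarith) ht
    (fun s hs => ((hd s hs).const_mul (2 * m)).sub ((hasDerivWithinAt_id s _).const_mul (m ^ 2)))
    (fun s _ => by nlinarith [sq_nonneg (z s - m)])
    (((hz.pow 2).mono fun x hx => hx.2.trans ht).integrableOn_compact isCompact_Icc)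
  have h1 : m * τ = u t - u (t - τ) := by rw [hm, div_mul_cancel₀ _ hτ.ne']
  have h2 : m ^ 2 * τ ≤ ∫ s in (t - τ)..t, z s ^ 2 := by
    have h3 : 2 * m * u t - m ^ 2 * t - (2 * m * u (t - τ) - m ^ 2 * (t - τ)) = m ^ 2 * τ := by
      linear_combination (-2 * m) * h1
    exact h3 ▸ h
  calc (u t - u (t - τ)) ^ 2 = τ * (m ^ 2 * τ) := by rw [← h1]; ring
    _ ≤ _ := by gcongr

/-- The increments of a function are controlled by its derivative in the weighted `L²` space. -/
lemma weightInt_increment_le {θ : ℝ} (hθ : 0 ≤ θ) {u z : ℝ → ℝ} (hu : WL2 θ u) (hz : WL2 θ z)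
    (hd : ∀ t ≤ 0, HasDerivWithinAt u (z t) (Iic 0) t) {τ : ℝ} (hτ : 0 < τ) :
    weightInt θ (fun t => u t - u (t - τ)) ≤ τ ^ 2 * Real.exp (2 * θ * τ) * weightInt θ z := by
  set g := fun s => Real.exp (2 * θ * s) * z s ^ 2 with hg
  -- The truncation at `0` makes `Z` monotone on the whole line, hence integrable on every interval.
  set Z := fun t => ∫ s in Iic (min t 0), g s with hZ
  have hgi : ∀ t : ℝ, IntegrableOn g (Iic (min t 0)) := fun t =>
    hz.int.mono_set (Iic_subset_Iic.2 (min_le_right t 0))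
  have hg0 : ∀ s, 0 ≤ g s := fun s => by positivity
  have hZm : Monotone Z := fun a b hab =>
    setIntegral_mono_set (hgi b) (Eventually.of_forall hg0)
      (Eventually.of_forall (Iic_subset_Iic.2 (min_le_min_right 0 hab)))
  have hZ0 : ∀ t, 0 ≤ Z t := fun t => setIntegral_nonneg measurableSet_Iic fun s _ => hg0 s
  have hZle : ∀ t, Z t ≤ weightInt θ z := fun t =>
    setIntegral_mono_set hz.int (Eventually.of_forall hg0)
      (Eventually.of_forall (Iic_subset_Iic.2 (min_le_right t 0)))
  have hZs : Monotone fun t => Z (t - τ) := fun a b hab => hZm (by linarith)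
  have hpt : ∀ t ≤ 0, Real.exp (2 * θ * t) * (u t - u (t - τ)) ^ 2
      ≤ τ * Real.exp (2 * θ * τ) * (Z t - Z (t - τ)) := by
    intro t ht
    have h1 : Z t - Z (t - τ) = ∫ s in (t - τ)..t, g s := by
      have e1 : min t 0 = t := min_eq_left ht
      have e2 : min (t - τ) 0 = t - τ := min_eq_left (by linarith)
      have i1 := hgi t
      have i2 := hgi (t - τ)
      rw [e1] at i1
      rw [e2] at i2
      simp only [hZ, e1, e2]
      exact intervalIntegral.integral_Iic_sub_Iic i2 i1
    have hzc : ContinuousOn z (uIcc (t - τ) t) := hz.cont.mono fun x hx => by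
      rw [uIcc_of_le (by linarith)] at hx
      exact hx.2.trans ht
    have h2 : Real.exp (2 * θ * (t - τ)) * ∫ s in (t - τ)..t, z s ^ 2 ≤ ∫ s in (t - τ)..t, g s := by
      rw [← intervalIntegral.integral_const_mul]
      refine intervalIntegral.integral_mono_on (by linarith)
        ((hzc.pow 2).intervalIntegrable.const_mul _)
        (ContinuousOn.mul (by fun_prop) (hzc.pow 2)).intervalIntegrable fun s hs => ?_
      have : 2 * θ * (t - τ) ≤ 2 * θ * s := by
        have := hs.1
        gcongr
      simp only [hg]
      gcongr
    have h3 := sq_increment_le hz.cont hd hτ ht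
    have h4 : Real.exp (2 * θ * t) = Real.exp (2 * θ * τ) * Real.exp (2 * θ * (t - τ)) := by
      rw [← Real.exp_add]; ring_nf
    calc Real.exp (2 * θ * t) * (u t - u (t - τ)) ^ 2
        ≤ Real.exp (2 * θ * t) * (τ * ∫ s in (t - τ)..t, z s ^ 2) := by gcongr
      _ = τ * Real.exp (2 * θ * τ) *
          (Real.exp (2 * θ * (t - τ)) * ∫ s in (t - τ)..t, z s ^ 2) := by rw [h4]; ring
      _ ≤ _ := by rw [h1]; gcongr
  have hD := hu.sub (hu.shift hτ.le)
  refine le_of_tendsto (intervalIntegral_tendsto_integral_Iic 0 hD.int tendsto_id) ?_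
  filter_upwards [eventually_le_atBot 0] with T hT
  have h1 : ∫ t in T..0, Real.exp (2 * θ * t) * (u t - u (t - τ)) ^ 2
      ≤ ∫ t in T..0, τ * Real.exp (2 * θ * τ) * (Z t - Z (t - τ)) := by
    refine intervalIntegral.integral_mono_on hT ?_
      ((hZm.intervalIntegrable.sub hZs.intervalIntegrable).const_mul _) fun t ht => hpt t ht.2
    refine (hD.int.mono_set ?_).intervalIntegrable
    rw [uIcc_of_le hT]
    exact fun x hx => hx.2
  refine h1.trans ?_
  have hi : ∀ a b, IntervalIntegrable Z volume a b := fun a b => hZm.intervalIntegrable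
  have hj : IntervalIntegrable (fun t => Z (t - τ)) volume T 0 := hZs.intervalIntegrable
  rw [intervalIntegral.integral_const_mul, intervalIntegral.integral_sub (hi _ _) hj,
    intervalIntegral.integral_comp_sub_right (fun t => Z t), zero_sub]
  -- Telescoping leaves two windows of length `τ`; the one at the left end has a favourable sign.
  have h2 : (∫ t in T..0, Z t) - ∫ t in (T - τ)..(-τ), Z t
      = (∫ t in (-τ)..0, Z t) - ∫ t in (T - τ)..T, Z t := by
    rw [intervalIntegral.integral_interval_sub_interval_comm (hi T 0) (hi (T - τ) (-τ))
      (hi T (T - τ)), intervalIntegral.integral_symm 0 (-τ),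
      intervalIntegral.integral_symm T (T - τ)]
    ring
  have h3 : ∫ t in (-τ)..0, Z t ≤ τ * weightInt θ z := by
    have := intervalIntegral.integral_mono_on (f := Z) (g := fun _ => weightInt θ z)
      (by linarith : -τ ≤ 0) (hi _ _) intervalIntegrable_const (fun t _ => hZle t)
    simpa using this
  have h4 : 0 ≤ ∫ t in (T - τ)..T, Z t :=
    intervalIntegral.integral_nonneg (by linarith) fun t _ => hZ0 t
  rw [h2]
  calc τ * Real.exp (2 * θ * τ) * ((∫ t in (-τ)..0, Z t) - ∫ t in (T - τ)..T, Z t)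
      ≤ τ * Real.exp (2 * θ * τ) * (τ * weightInt θ z) := by gcongr; linarith
    _ = _ := by ring

lemma tendsto_increment {u : ℝ → ℝ} {z t : ℝ} (h : HasDerivWithinAt u z (Iic 0) t) (ht : t ≤ 0) :
    Tendsto (fun k : ℕ => (u t - u (t - 1 / (k + 1))) / (1 / (k + 1))) atTop (𝓝 z) := by
  rw [hasDerivWithinAt_iff_tendsto_slope] at h
  have h1 : Tendsto (fun k : ℕ => t - 1 / ((k : ℝ) + 1)) atTop (𝓝[Iic 0 \ {t}] t) := by
    refine tendsto_nhdsWithin_iff.2 ⟨?_, Eventually.of_forall fun k => ?_⟩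
    · simpa using (tendsto_one_div_add_atTop_nhds_zero_nat (𝕜 := ℝ)).const_sub t
    · have : (0 : ℝ) < 1 / ((k : ℝ) + 1) := by positivity
      refine ⟨?_, ?_⟩
      · simp only [mem_Iic]; linarith
      · simp only [mem_singleton_iff]; linarith
  refine (h.comp h1).congr fun k => ?_
  have : (0 : ℝ) < 1 / ((k : ℝ) + 1) := by positivity
  simp only [Function.comp_apply, slope_def_field]
  rw [← neg_sub (u t), ← neg_sub t, neg_div_neg_eq]
  ring_nf

end HypRelax

namespace HypRelax

/-! ### Regularity of solutions of the parabolic problem -/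

/-- The cube pays for the three successive uses of Young's inequality in
`ComparisonData.exists_disp_weightInt_le`. -/
lemma exists_contraction_margin {L δ : ℝ} (hL0 : 0 ≤ L) (hL : L < δ) :
    ∃ η > 0, (1 + η) ^ 3 * L ^ 2 < δ ^ 2 := by
  have h1 : Tendsto (fun η : ℝ => (1 + η) ^ 3 * L ^ 2) (𝓝[>] 0) (𝓝 ((1 + 0) ^ 3 * L ^ 2)) :=
    ((by fun_prop : Continuous fun η : ℝ => (1 + η) ^ 3 * L ^ 2).tendsto 0).mono_left
      nhdsWithin_le_nhds
  have h2 : (1 + 0 : ℝ) ^ 3 * L ^ 2 < δ ^ 2 := by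
    rw [add_zero, one_pow, one_mul]
    gcongr
  obtain ⟨η, h3, h4⟩ := ((h1.eventually (gt_mem_nhds h2)).and self_mem_nhdsWithin).exists
  exact ⟨η, h4, h3⟩

section Regularity

variable {H : Type*} [NormedAddCommGroup H] [InnerProductSpace ℝ H] [CompleteSpace H]
  {e : HilbertBasis ℕ+ ℝ H} {lam : ℕ+ → ℝ} {N : ℕ+} {ε θ : ℝ}

lemma VL2.shift {u : ℝ → H} (hu : VL2 θ u) {τ : ℝ} (hτ : 0 ≤ τ) : VL2 θ (fun t => u (t - τ)) :=
  ⟨hu.cont.comp (by fun_prop) fun t ht => by simp only [mem_Iic] at ht ⊢; linarith,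
    hu.norm.shift hτ⟩

lemma norm_sq_sum_smul (a : ℕ+ → ℝ) :
    ‖∑ n ∈ Finset.Icc 1 N, a n • e n‖ ^ 2 = ∑ n ∈ Finset.Icc 1 N, a n ^ 2 := by
  refine (hasSum_coeff_sq e _).unique ?_
  have h : ∀ n, coeff e (∑ k ∈ Finset.Icc 1 N, a k • e k) n ^ 2 = if n ≤ N then a n ^ 2 else 0 := by
    intro n
    rw [coeff_sum_smul]
    split_ifs <;> simp
  simp only [h]
  convert hasSum_sum_of_ne_finset_zero (s := Finset.Icc 1 N) (L := .unconditional ℕ+)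
    (f := fun n => if n ≤ N then a n ^ 2 else 0) (fun n hn => ?_) using 1
  · exact Finset.sum_congr rfl fun n hn => by rw [if_pos (Finset.mem_Icc.1 hn).2]
  · rw [if_neg]
    simpa using hn

lemma slowCoord_zero (lam v u : ℝ) : slowCoord 0 lam v u = u := by simp [slowCoord]

/-- The equation is autonomous, so time increments solve the linear problem again. At `ε = 0` the
slow coordinate is the displacement alone, which makes the datum of the increment explicit. -/
lemma ModalSol.increment (hpos : ∀ n, 0 < lam n) (hmono : Monotone lam) {h u : ℝ → H} {p : H}
    {z : ℝ → ℕ+ → ℝ} (M : ModalSol e lam N 0 θ h p u z) {τ : ℝ} (hτ : 0 ≤ τ) :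
    ModalSol e lam N 0 θ (fun t => h t - h (t - τ))
      (∑ n ∈ Finset.Icc 1 N, (coeff e (u 0) n - coeff e (u (0 - τ)) n) • e n)
      (fun t => u t - u (t - τ)) (fun t n => z t n - z (t - τ) n) := by
  intro n
  simp only [coeff_sub]
  refine ⟨(M n).1.sub ((M n).1.shift hτ), ?_⟩
  rw [coeff_sum_smul]
  split_ifs with hn
  · exact Or.inr ⟨hpos n, hmono hn, slowCoord_zero _ _ _⟩
  · exact Or.inl ⟨hmono (Order.add_one_le_of_lt (not_le.1 hn)), rfl⟩

lemma VL2.weightInt_lipschitz_zero_le {u : ℝ → H} (hu : VL2 θ u) {F : H → H} {L : ℝ}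
    (hF : ∀ u₁ u₂ : H, ‖F u₁ - F u₂‖ ≤ L * ‖u₁ - u₂‖) (hF0 : F 0 = 0) :
    weightInt θ (fun t => ‖F (u t)‖) ≤ L ^ 2 * weightInt θ (fun t => ‖u t‖) := by
  rw [← weightInt_const_mul]
  refine (hu.comp_lipschitz hF hF0).norm.weightInt_mono (hu.norm.const_mul L) fun t _ =>
    pow_le_pow_left₀ (norm_nonneg _) ?_ 2
  simpa [hF0] using hF (u t) 0

variable {F : H → H} {L : ℝ}

/-- The bounds for the velocity of a solution of the parabolic problem which do not require
differentiation in time. -/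
lemma exists_velocity_bound (hpos : ∀ n, 0 < lam n) (hmono : Monotone lam)
    (G : GapData (lam N) (lam (N + 1)) 0 θ)
    (hF : ∀ u₁ u₂ : H, ‖F u₁ - F u₂‖ ≤ L * ‖u₁ - u₂‖) (hF0 : F 0 = 0)
    (hL0 : 0 ≤ L) (hL : L < (lam (N + 1) - lam N) / 2) :
    ∃ C, 0 ≤ C ∧ ∀ (p : H) (u : ℝ → H) (z : ℝ → ℕ+ → ℝ), VL2 θ u →
      ModalSol e lam N 0 θ (fun t => F (u t)) p u z →
      (∀ S : Finset ℕ+, ∑ n ∈ S, weightInt θ (fun t => z t n) ≤ C * ‖p‖ ^ 2) ∧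
      ∑ n ∈ Finset.Icc 1 N, z 0 n ^ 2 ≤ C * ‖p‖ ^ 2 := by
  set δ := (lam (N + 1) - lam N) / 2 with hδ
  set Λ := lam (N + 1)
  have hδ0 : 0 < δ := hL0.trans_lt hL
  have hΛ : 0 < Λ := hpos _
  have hl1 := hpos 1
  obtain ⟨η, hη, hη1⟩ := exists_contraction_margin hL0 hL
  have hη2 : 0 < δ ^ 2 - (1 + η) * L ^ 2 := by
    have : (1 + η) ^ 1 ≤ (1 + η) ^ 3 := pow_le_pow_right₀ (by linarith) (by norm_num)
    nlinarith [mul_le_mul_of_nonneg_right this (sq_nonneg L)]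
  have hC := energyConst_pos G.l_pos G.gap
  set Ce := energyConst (lam N) Λ
  -- The constant left after the nonlinear term has been absorbed in the weighted `L²` estimate of
  -- `u`.
  set K := (1 + 1 / η) * Λ / (δ ^ 2 - (1 + η) * L ^ 2) with hK
  have hK0 : 0 ≤ K := by positivity
  set c := 2 * (Λ / δ) ^ 2
  refine ⟨2 * (L ^ 2 * K) + 2 * (c * (L ^ 2 * K + Λ)) +
    (2 * L ^ 2 * (Ce / lam 1 * (L ^ 2 * K + 1)) + 2 * Λ * (Ce * (L ^ 2 * K + 1))), by positivity, ?_⟩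
  intro p u z hu M
  have hh := hu.comp_lipschitz hF hF0
  have hhI := hu.weightInt_lipschitz_zero_le hF hF0
  have hI : weightInt θ (fun t => ‖u t‖) ≤ K * ‖p‖ ^ 2 := by
    have h1 : δ ^ 2 * weightInt θ (fun t => ‖u t‖)
        ≤ (1 + η) * weightInt θ (fun t => ‖F (u t)‖) + (1 + 1 / η) * (Λ * ‖p‖ ^ 2) :=
      M.weightInt_le hh hu hpos G hη
    rw [hK, div_mul_eq_mul_div, le_div_iff₀ hη2]
    have := mul_le_mul_of_nonneg_left hhI (by linarith : 0 ≤ 1 + η)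
    linarith
  have hW : weightInt θ (fun t => ‖F (u t)‖) ≤ L ^ 2 * K * ‖p‖ ^ 2 := by
    refine hhI.trans ?_
    rw [mul_assoc]
    gcongr
  have hX : 0 ≤ 2 * (L ^ 2 * K) + 2 * (c * (L ^ 2 * K + Λ)) := by positivity
  have hY : 0 ≤ 2 * L ^ 2 * (Ce / lam 1 * (L ^ 2 * K + 1)) + 2 * Λ * (Ce * (L ^ 2 * K + 1)) := by
    positivity
  have hP := sq_nonneg ‖p‖
  constructor
  · intro S
    have h1 : ∀ n, weightInt θ (fun t => z t n) ≤ 2 * weightInt θ (fun t => coeff e (F (u t)) n)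
        + 2 * (c * (weightInt θ (fun t => coeff e (F (u t)) n) + Λ * coeff e p n ^ 2)) := by
      intro n
      have h2 : lam n ^ 2 * weightInt θ (fun t => coeff e (u t) n)
          ≤ c * (weightInt θ (fun t => coeff e (F (u t)) n) + Λ * coeff e p n ^ 2) :=
        (M n).1.parabolic_estimate G (M n).2
      have h3 := (hh.coeff e n).weightInt_add_le ((M n).1.disp.const_mul (-lam n)) one_pos
      rw [weightInt_const_mul] at h3
      have h4 : weightInt θ (fun t => z t n)
          = weightInt θ (fun t => coeff e (F (u t)) n + -lam n * coeff e (u t) n) :=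
        weightInt_congr fun t ht => by rw [(M n).1.velocity_eq ht]; ring
      rw [h4]
      linarith
    refine (Finset.sum_le_sum fun n _ => h1 n).trans ?_
    rw [Finset.sum_add_distrib, ← Finset.mul_sum, ← Finset.mul_sum, ← Finset.mul_sum,
      Finset.sum_add_distrib, ← Finset.mul_sum]
    have h5 := (hh.sum_weightInt_coeff_le e S).trans hW
    have h6 := sum_coeff_sq_le e p S
    calc _ ≤ 2 * (L ^ 2 * K * ‖p‖ ^ 2) + 2 * (c * (L ^ 2 * K * ‖p‖ ^ 2 + Λ * ‖p‖ ^ 2)) := by gcongr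
      _ = (2 * (L ^ 2 * K) + 2 * (c * (L ^ 2 * K + Λ))) * ‖p‖ ^ 2 := by ring
      _ ≤ _ := mul_le_mul_of_nonneg_right (by linarith) hP
  -- Only modes `n ≤ N` occur, so `λ_n² ≤ Λ λ_n` and the `H¹` energy suffices.
  · have h1 : ∀ n ∈ Finset.Icc 1 N, z 0 n ^ 2
        ≤ 2 * coeff e (F (u 0)) n ^ 2 + 2 * Λ * (lam n * coeff e (u 0) n ^ 2) := by
      intro n hn
      have h2 : lam n ≤ Λ := (hmono (Finset.mem_Icc.1 hn).2).trans G.gap.le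
      have h3 := hpos n
      rw [(M n).1.velocity_eq le_rfl]
      have h4 : (coeff e (F (u 0)) n - lam n * coeff e (u 0) n) ^ 2
          ≤ 2 * coeff e (F (u 0)) n ^ 2 + 2 * (lam n * (lam n * coeff e (u 0) n ^ 2)) := by
        nlinarith [sq_nonneg (coeff e (F (u 0)) n + lam n * coeff e (u 0) n)]
      refine h4.trans ?_
      rw [mul_assoc 2 Λ]
      gcongr
    refine (Finset.sum_le_sum h1).trans ?_
    rw [Finset.sum_add_distrib, ← Finset.mul_sum, ← Finset.mul_sum]
    have h2 : ∑ n ∈ Finset.Icc 1 N, coeff e (F (u 0)) n ^ 2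
        ≤ L ^ 2 * (Ce / lam 1 * (L ^ 2 * K * ‖p‖ ^ 2 + ‖p‖ ^ 2)) := by
      refine (sum_coeff_sq_le e _ _).trans ?_
      have h3 : ‖F (u 0)‖ ^ 2 ≤ L ^ 2 * ‖u 0‖ ^ 2 := by
        rw [← mul_pow]
        refine pow_le_pow_left₀ (norm_nonneg _) ?_ 2
        simpa [hF0] using hF (u 0) 0
      have h4 := M.norm_sq_le hh hpos hmono G le_rfl
      rw [mul_zero, Real.exp_zero, one_mul] at h4
      refine h3.trans (mul_le_mul_of_nonneg_left (h4.trans ?_) (sq_nonneg L))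
      gcongr
    have h3 : ∑ n ∈ Finset.Icc 1 N, lam n * coeff e (u 0) n ^ 2
        ≤ Ce * (L ^ 2 * K * ‖p‖ ^ 2 + ‖p‖ ^ 2) := by
      have h4 := M.sum_energy_le hh G le_rfl (Finset.Icc 1 N)
      simp only [mul_zero, Real.exp_zero, one_mul, zero_mul, zero_add] at h4
      exact h4.trans (by gcongr)
    calc _ ≤ 2 * (L ^ 2 * (Ce / lam 1 * (L ^ 2 * K * ‖p‖ ^ 2 + ‖p‖ ^ 2)))
          + 2 * Λ * (Ce * (L ^ 2 * K * ‖p‖ ^ 2 + ‖p‖ ^ 2)) := by gcongr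
      _ = (2 * L ^ 2 * (Ce / lam 1 * (L ^ 2 * K + 1)) + 2 * Λ * (Ce * (L ^ 2 * K + 1))) * ‖p‖ ^ 2 := by
          ring
      _ ≤ _ := mul_le_mul_of_nonneg_right (by linarith) hP

/-- The velocity of a solution of the parabolic problem is bounded in `H¹` with the weight
`e^{θt}`, and it belongs to the weighted `L²` space with values in `H²`. -/
theorem exists_regularity (hpos : ∀ n, 0 < lam n) (hmono : Monotone lam)
    (G : GapData (lam N) (lam (N + 1)) 0 θ)
    (hF : ∀ u₁ u₂ : H, ‖F u₁ - F u₂‖ ≤ L * ‖u₁ - u₂‖) (hF0 : F 0 = 0)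
    (hL0 : 0 ≤ L) (hL : L < (lam (N + 1) - lam N) / 2) :
    ∃ C, 0 ≤ C ∧ ∀ (p : H) (u : ℝ → H) (z : ℝ → ℕ+ → ℝ), VL2 θ u →
      ModalSol e lam N 0 θ (fun t => F (u t)) p u z →
      (∀ t ≤ 0, ∀ S : Finset ℕ+,
        Real.exp (2 * θ * t) * ∑ n ∈ S, lam n * z t n ^ 2 ≤ C * ‖p‖ ^ 2) ∧
      ∀ S : Finset ℕ+, ∑ n ∈ S, lam n ^ 2 * weightInt θ (fun t => z t n) ≤ C * ‖p‖ ^ 2 := by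
  obtain ⟨C, hC0, hCb⟩ := exists_velocity_bound (e := e) hpos hmono G hF hF0 hL0 hL
  have hC := energyConst_pos G.l_pos G.gap
  set Λ := lam (N + 1)
  set Ce := energyConst (lam N) Λ
  set c := 2 * (Λ / ((Λ - lam N) / 2)) ^ 2 with hc
  have hΛ : 0 < Λ := hpos _
  have hc0 : 0 ≤ c := by positivity
  refine ⟨(Ce + c * (1 + Λ)) * ((L ^ 2 + 1) * C), by positivity, ?_⟩
  intro p u z hu M
  obtain ⟨hz1, hz2⟩ := hCb p u z hu M
  set P := ‖p‖ ^ 2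
  have hP : 0 ≤ P := sq_nonneg _
  have hh := hu.comp_lipschitz hF hF0
  -- The Lipschitz map `F` cannot be differentiated, but an increment of `F(u)` is bounded by `L`
  -- times that of `u`. The linear estimates for difference quotients are therefore uniform in the
  -- step, which then tends to zero.
  set τ : ℕ → ℝ := fun k => 1 / ((k : ℝ) + 1)
  have hτ : ∀ k, 0 < τ k := fun k => by positivity
  have hτ0 : Tendsto τ atTop (𝓝 0) := tendsto_one_div_add_atTop_nhds_zero_nat
  set D : ℕ → ℝ → ℕ+ → ℝ := fun k t n => (coeff e (u t) n - coeff e (u (t - τ k)) n) / τ k with hD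
  have hDz : ∀ t ≤ 0, ∀ n, Tendsto (fun k => D k t n) atTop (𝓝 (z t n)) := fun t ht n =>
    tendsto_increment ((M n).1.vel t ht) ht
  -- `τ_k² b_k` bounds forcing and datum of the increment. The velocity bounds of
  -- `exists_velocity_bound` control both parts of `lim b_k`.
  set b : ℕ → ℝ := fun k => L ^ 2 * (Real.exp (2 * θ * τ k) * (C * P))
    + ∑ n ∈ Finset.Icc 1 N, D k 0 n ^ 2 with hb
  have hblim : Tendsto b atTop (𝓝 (L ^ 2 * (Real.exp (2 * θ * 0) * (C * P))
      + ∑ n ∈ Finset.Icc 1 N, z 0 n ^ 2)) := by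
    refine Tendsto.add ?_ (tendsto_finsetSum _ fun n _ => (hDz 0 le_rfl n).pow 2)
    exact (((by fun_prop : Continuous fun x => Real.exp (2 * θ * x)).tendsto 0).comp
      hτ0).mul_const _ |>.const_mul _
  have hble : L ^ 2 * (Real.exp (2 * θ * 0) * (C * P)) + ∑ n ∈ Finset.Icc 1 N, z 0 n ^ 2
      ≤ (L ^ 2 + 1) * C * P := by
    rw [mul_zero, Real.exp_zero, one_mul]
    linarith
  have hdat : ∀ k, VL2 θ (fun t => F (u t) - F (u (t - τ k))) ∧
      weightInt θ (fun t => ‖F (u t) - F (u (t - τ k))‖)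
      + ‖∑ n ∈ Finset.Icc 1 N, (coeff e (u 0) n - coeff e (u (0 - τ k)) n) • e n‖ ^ 2
        ≤ τ k ^ 2 * b k := by
    intro k
    have hs := hu.shift (hτ k).le
    refine ⟨hh.sub (hh.shift (hτ k).le), ?_⟩
    have h1 : weightInt θ (fun t => ‖u t - u (t - τ k)‖)
        ≤ τ k ^ 2 * Real.exp (2 * θ * τ k) * (C * P) := by
      refine (VL2.of_sum_weightInt_le e (hu.sub hs).cont (fun n => (hu.sub hs).coeff e n)
        fun S => ?_).2
      have h2 : ∀ n, weightInt θ (fun t => coeff e (u t - u (t - τ k)) n)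
          ≤ τ k ^ 2 * Real.exp (2 * θ * τ k) * weightInt θ (fun t => z t n) := by
        intro n
        simp only [coeff_sub]
        exact weightInt_increment_le G.theta_pos.le (hu.coeff e n) ((M n).1.vint G) (M n).1.vel
          (hτ k)
      refine (Finset.sum_le_sum fun n _ => h2 n).trans ?_
      rw [← Finset.mul_sum]
      gcongr
      exact hz1 S
    have h3 := (hu.weightInt_lipschitz_le hs hF hF0).trans
      (mul_le_mul_of_nonneg_left h1 (sq_nonneg L))
    have h4 : ∑ n ∈ Finset.Icc 1 N, (coeff e (u 0) n - coeff e (u (0 - τ k)) n) ^ 2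
        = τ k ^ 2 * ∑ n ∈ Finset.Icc 1 N, D k 0 n ^ 2 := by
      rw [Finset.mul_sum]
      refine Finset.sum_congr rfl fun n _ => ?_
      rw [← mul_pow, hD]
      simp only
      rw [mul_div_cancel₀ _ (hτ k).ne']
    rw [norm_sq_sum_smul, h4, hb]
    simp only
    linarith
  have hDsq : ∀ k t n, (coeff e (u t - u (t - τ k)) n) ^ 2 = τ k ^ 2 * D k t n ^ 2 := by
    intro k t n
    rw [← mul_pow, hD, coeff_sub]
    simp only
    rw [mul_div_cancel₀ _ (hτ k).ne']
  constructor
  · intro t ht S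
    have h1 : ∀ k, Real.exp (2 * θ * t) * ∑ n ∈ S, lam n * D k t n ^ 2 ≤ Ce * b k := by
      intro k
      have h2 := ((M.increment hpos hmono (hτ k).le).sum_energy_le (hdat k).1 G ht S).trans
        (mul_le_mul_of_nonneg_left (hdat k).2 hC.le)
      simp only [zero_mul, zero_add, hDsq] at h2
      refine le_of_mul_le_mul_left ?_ (pow_pos (hτ k) 2)
      calc τ k ^ 2 * (Real.exp (2 * θ * t) * ∑ n ∈ S, lam n * D k t n ^ 2)
          = Real.exp (2 * θ * t) * ∑ n ∈ S, lam n * (τ k ^ 2 * D k t n ^ 2) := by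
            rw [mul_left_comm, Finset.mul_sum]
            congr 1
            exact Finset.sum_congr rfl fun n _ => by ring
        _ ≤ _ := h2
        _ = _ := by ring
    have h2 := le_of_tendsto_of_tendsto' ((tendsto_finsetSum S fun n _ =>
      ((hDz t ht n).pow 2).const_mul (lam n)).const_mul (Real.exp (2 * θ * t)))
      (hblim.const_mul Ce) h1
    refine h2.trans ?_
    calc _ ≤ Ce * ((L ^ 2 + 1) * C * P) := by gcongr
      _ ≤ (Ce + c * (1 + Λ)) * ((L ^ 2 + 1) * C * P) := by
          gcongr
          nlinarith
      _ = _ := by ring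
  · intro S
    have hDW : ∀ k n, WL2 θ (fun t => D k t n) := by
      intro k n
      simpa only [hD, div_eq_inv_mul] using
        ((M n).1.disp.sub ((M n).1.disp.shift (hτ k).le)).const_mul (τ k)⁻¹
    have hint : ∀ k, ∑ n ∈ S, lam n ^ 2 * weightInt θ (fun t => D k t n) ≤ c * (1 + Λ) * b k := by
      intro k
      have M' := M.increment hpos hmono (hτ k).le
      set q := ∑ n ∈ Finset.Icc 1 N, (coeff e (u 0) n - coeff e (u (0 - τ k)) n) • e n
      have h1 : ∀ n, τ k ^ 2 * (lam n ^ 2 * weightInt θ (fun t => D k t n))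
          ≤ c * (weightInt θ (fun t => coeff e (F (u t) - F (u (t - τ k))) n)
            + Λ * coeff e q n ^ 2) := by
        intro n
        refine le_trans (le_of_eq ?_) ((M' n).1.parabolic_estimate G (M' n).2)
        rw [mul_left_comm, ← weightInt_const_mul]
        congr 1
        refine weightInt_congr fun t _ => ?_
        rw [mul_pow, hDsq]
      have h2 := (hdat k).1.sum_weightInt_coeff_le e S
      have h3 := sum_coeff_sq_le e q S
      have h4 := (hdat k).2
      have h5 := weightInt_nonneg θ (fun t => ‖F (u t) - F (u (t - τ k))‖)
      refine le_of_mul_le_mul_left ?_ (pow_pos (hτ k) 2)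
      rw [Finset.mul_sum]
      refine (Finset.sum_le_sum fun n _ => h1 n).trans ?_
      rw [← Finset.mul_sum, Finset.sum_add_distrib, ← Finset.mul_sum]
      calc _ ≤ c * (weightInt θ (fun t => ‖F (u t) - F (u (t - τ k))‖) + Λ * ‖q‖ ^ 2) := by gcongr
        _ ≤ c * ((1 + Λ) * (weightInt θ (fun t => ‖F (u t) - F (u (t - τ k))‖) + ‖q‖ ^ 2)) := by
            gcongr
            nlinarith [sq_nonneg ‖q‖]
        _ ≤ c * ((1 + Λ) * (τ k ^ 2 * b k)) := by gcongr
        _ = _ := by ring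
    have hz : ∀ n, WL2 θ (fun t => z t n) := fun n => (M n).1.vint G
    -- The quotients converge pointwise to the velocity; Fatou's lemma passes to the limit in the
    -- integrated `H²` bound.
    have h1 := (integrableOn_and_integral_le_of_tendsto (l := atTop) (s := Iic 0) measurableSet_Iic
      (f := fun k t => ∑ n ∈ S, lam n ^ 2 * (Real.exp (2 * θ * t) * D k t n ^ 2))
      (g := fun t => ∑ n ∈ S, lam n ^ 2 * (Real.exp (2 * θ * t) * z t n ^ 2))
      (B := fun k => c * (1 + Λ) * b k)
      (fun k => integrable_finsetSum S fun n _ => (hDW k n).int.const_mul _)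
      (fun k t _ => Finset.sum_nonneg fun n _ => by positivity)
      (fun k => by
        rw [integral_finsetSum S fun n _ => (hDW k n).int.const_mul _]
        simp only [integral_const_mul]
        exact hint k)
      (fun t ht => tendsto_finsetSum S fun n _ => (((hDz t ht n).pow 2).const_mul _).const_mul _)
      (hblim.const_mul _)).2
    rw [integral_finsetSum S fun n _ => (hz n).int.const_mul _] at h1
    simp only [integral_const_mul] at h1
    refine h1.trans ?_
    calc _ ≤ c * (1 + Λ) * ((L ^ 2 + 1) * C * P) := by gcongr
      _ ≤ (Ce + c * (1 + Λ)) * ((L ^ 2 + 1) * C * P) := by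
          gcongr
          linarith
      _ = _ := by ring

end Regularity

end HypRelax

namespace HypRelax

/-! ### Relaxation equations -/

/-- Apply `2 c z ≤ c² + z²` in the derivative of `e^{2θt} c²`. The integral bound keeps its strength
as `ε → 0`, provided `1 - 2εθ` stays away from zero, while the value at `0` is controlled only with
the factor `ε`. -/
lemma relaxation_energy_le {ε θ : ℝ} (hε : 0 < ε) {c z : ℝ → ℝ} (hc : WL2 θ c) (hz : WL2 θ z)
    (hd : ∀ t ≤ 0, HasDerivWithinAt c ((z t - c t) / ε) (Iic 0) t) :
    ε * c 0 ^ 2 + (1 - 2 * ε * θ) * weightInt θ c ≤ weightInt θ z := by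
  have hi : IntegrableOn (fun t => ε⁻¹ * (Real.exp (2 * θ * t) * z t ^ 2
      - (1 - 2 * ε * θ) * (Real.exp (2 * θ * t) * c t ^ 2))) (Iic 0) :=
    Integrable.const_mul (Integrable.sub hz.int (hc.int.const_mul _)) _
  have h := le_integral_of_deriv_le (t := 0) le_rfl
    (E := fun t => Real.exp (2 * θ * t) * c t ^ 2)
    (E' := fun t => Real.exp (2 * θ * t) *
      (2 * c t ^ 1 * ((z t - c t) / ε) + 2 * θ * c t ^ 2))
    (f := fun t => ε⁻¹ * (Real.exp (2 * θ * t) * z t ^ 2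
      - (1 - 2 * ε * θ) * (Real.exp (2 * θ * t) * c t ^ 2)))
    (fun t ht => hasDerivWithinAt_exp_mul (((hd t ht).pow 2).congr_deriv (by simp)))
    (fun t _ => ?_) hi
    (fun η hη => frequently_lt_of_integrableOn_Iic hc.int hη)
  · rw [integral_const_mul, integral_sub hz.int (hc.int.const_mul _), integral_const_mul, mul_zero,
      Real.exp_zero, one_mul, inv_mul_eq_div, le_div_iff₀ hε] at h
    unfold weightInt
    linarith
  · have h1 : ε⁻¹ * (Real.exp (2 * θ * t) * z t ^ 2
        - (1 - 2 * ε * θ) * (Real.exp (2 * θ * t) * c t ^ 2))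
        - Real.exp (2 * θ * t) * (2 * c t ^ 1 * ((z t - c t) / ε) + 2 * θ * c t ^ 2)
        = Real.exp (2 * θ * t) * ε⁻¹ * (z t - c t) ^ 2 := by
      field_simp
      ring
    have h2 : 0 ≤ Real.exp (2 * θ * t) * ε⁻¹ * (z t - c t) ^ 2 := by positivity
    linarith

/-- The weighted sum satisfies `ε f' ≤ B - k f`, so `e^{kt/ε} (f - B/k)` is nonincreasing;
integrability of `f` makes it start from at most zero at `-∞`. A pointwise bound on the source thus
passes to the solution with no power of `ε` lost. -/
lemma relaxation_sup_le {ε θ k B : ℝ} (hε : 0 < ε) (hk : 0 < k) (hkθ : k ≤ 1 - 2 * ε * θ)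
    {S : Finset ℕ+} {μ : ℕ+ → ℝ} (hμ : ∀ n, 0 ≤ μ n) {y s : ℕ+ → ℝ → ℝ} (hy : ∀ n, WL2 θ (y n))
    (hd : ∀ n, ∀ t ≤ 0, HasDerivWithinAt (y n) ((s n t - y n t) / ε) (Iic 0) t)
    (hB : ∀ t ≤ 0, Real.exp (2 * θ * t) * ∑ n ∈ S, μ n * s n t ^ 2 ≤ B) {t : ℝ} (ht : t ≤ 0) :
    Real.exp (2 * θ * t) * ∑ n ∈ S, μ n * y n t ^ 2 ≤ B / k := by
  have hB0 : 0 ≤ B := le_trans (mul_nonneg (Real.exp_pos _).le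
    (Finset.sum_nonneg fun n _ => mul_nonneg (hμ n) (sq_nonneg _))) (hB 0 le_rfl)
  set f : ℝ → ℝ := fun t => Real.exp (2 * θ * t) * ∑ n ∈ S, μ n * y n t ^ 2 with hf
  have hf0 : ∀ t, 0 ≤ f t := fun t => mul_nonneg (Real.exp_pos _).le
    (Finset.sum_nonneg fun n _ => mul_nonneg (hμ n) (sq_nonneg _))
  have hfi : IntegrableOn f (Iic 0) := by
    have : IntegrableOn (fun t => ∑ n ∈ S, μ n * (Real.exp (2 * θ * t) * y n t ^ 2)) (Iic 0) :=
      integrable_finsetSum S fun n _ => (hy n).int.const_mul _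
    refine this.congr_fun (fun t _ => ?_) measurableSet_Iic
    simp only [hf, Finset.mul_sum]
    exact Finset.sum_congr rfl fun n _ => by ring
  set f' : ℝ → ℝ := fun t => Real.exp (2 * θ * t) *
    (∑ n ∈ S, μ n * (2 * y n t * ((s n t - y n t) / ε)) + 2 * θ * ∑ n ∈ S, μ n * y n t ^ 2) with hf'
  have hfd : ∀ t ≤ 0, HasDerivWithinAt f (f' t) (Iic 0) t := fun t ht =>
    hasDerivWithinAt_exp_mul (HasDerivWithinAt.fun_sum fun n _ =>
      (((hd n t ht).pow 2).const_mul (μ n)).congr_deriv (by simp))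
  have hfle : ∀ t ≤ 0, f' t ≤ ε⁻¹ * (B - k * f t) := by
    intro t ht
    have h1 : ∑ n ∈ S, μ n * (2 * y n t * ((s n t - y n t) / ε)) + 2 * θ * ∑ n ∈ S, μ n * y n t ^ 2
        ≤ ε⁻¹ * (∑ n ∈ S, μ n * s n t ^ 2 - (1 - 2 * ε * θ) * ∑ n ∈ S, μ n * y n t ^ 2) := by
      rw [Finset.mul_sum, Finset.mul_sum, ← Finset.sum_sub_distrib, ← Finset.sum_add_distrib,
        Finset.mul_sum]
      refine Finset.sum_le_sum fun n _ => ?_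
      have h2 : ε⁻¹ * (μ n * s n t ^ 2 - (1 - 2 * ε * θ) * (μ n * y n t ^ 2))
          - (μ n * (2 * y n t * ((s n t - y n t) / ε)) + 2 * θ * (μ n * y n t ^ 2))
          = μ n * ε⁻¹ * (s n t - y n t) ^ 2 := by
        field_simp
        ring
      have h3 : 0 ≤ μ n * ε⁻¹ * (s n t - y n t) ^ 2 :=
        mul_nonneg (mul_nonneg (hμ n) (by positivity)) (sq_nonneg _)
      linarith
    calc f' t ≤ Real.exp (2 * θ * t) * (ε⁻¹ * (∑ n ∈ S, μ n * s n t ^ 2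
          - (1 - 2 * ε * θ) * ∑ n ∈ S, μ n * y n t ^ 2)) := by
            simp only [hf']
            gcongr
      _ = ε⁻¹ * (Real.exp (2 * θ * t) * ∑ n ∈ S, μ n * s n t ^ 2 - (1 - 2 * ε * θ) * f t) := by
            simp only [hf]; ring
      _ ≤ ε⁻¹ * (B - k * f t) := by
            have := hB t ht
            have := mul_le_mul_of_nonneg_right hkθ (hf0 t)
            gcongr
  have h := nonpos_of_deriv_nonpos ht (E := fun t => Real.exp (k / ε * t) * (f t - B / k))
    (E' := fun t => Real.exp (k / ε * t) * (f' t + k / ε * (f t - B / k)))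
    (fun t ht => hasDerivWithinAt_exp_mul ((hfd t ht).sub_const _)) (fun t ht => ?_)
    (fun η hη => ?_)
  · have := nonpos_of_mul_nonpos_right h (Real.exp_pos _)
    linarith
  · refine mul_nonpos_of_nonneg_of_nonpos (Real.exp_pos _).le ?_
    have h1 := hfle t ht
    have h2 : k / ε * (f t - B / k) = -(ε⁻¹ * (B - k * f t)) := by
      field_simp
      ring
    linarith
  · refine ((frequently_lt_of_integrableOn_Iic hfi hη).and_eventually
      (eventually_le_atBot (0 : ℝ))).mono fun T hT => ?_
    have h1 : Real.exp (k / ε * T) ≤ 1 := Real.exp_le_one_iff.2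
      (mul_nonpos_of_nonneg_of_nonpos (by positivity) hT.2)
    have h2 : 0 ≤ B / k := by positivity
    calc Real.exp (k / ε * T) * (f T - B / k) ≤ Real.exp (k / ε * T) * f T := by
          gcongr; linarith
      _ ≤ 1 * f T := mul_le_mul_of_nonneg_right h1 (hf0 T)
      _ < η := by rw [one_mul]; exact hT.1

/-! ### Comparison of the hyperbolic and the parabolic problem -/

section Comparison

variable {H : Type*} [NormedAddCommGroup H] [InnerProductSpace ℝ H] [CompleteSpace H]

/-- A solution `(u, v)` of the hyperbolic problem and a solution `(u₀, z)` of the parabolic problem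
with the same datum, together with the corrector `c`, which solves `ε c' + c = z`. -/
structure ComparisonData (e : HilbertBasis ℕ+ ℝ H) (lam : ℕ+ → ℝ) (N : ℕ+) (F : H → H)
    (ε θ θ₀ B : ℝ) (p : H) (u u₀ : ℝ → H) (v z : ℝ → ℕ+ → ℝ) (c : ℕ+ → ℝ → ℝ) : Prop where
  eps_pos : 0 < ε
  gap : GapData (lam N) (lam (N + 1)) ε θ
  gap₀ : GapData (lam N) (lam (N + 1)) 0 θ₀
  vl2 : VL2 θ u
  vl2₀ : VL2 θ₀ u₀
  sol : ModalSol e lam N ε θ (fun t => F (u t)) p u v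
  sol₀ : ModalSol e lam N 0 θ₀ (fun t => F (u₀ t)) p u₀ z
  corr : ∀ n, WL2 θ₀ (c n)
  corr_deriv : ∀ n, ∀ t ≤ 0, HasDerivWithinAt (c n) ((z t n - c n t) / ε) (Iic 0) t
  sup_le : ∀ t ≤ 0, ∀ S : Finset ℕ+, Real.exp (2 * θ₀ * t) * ∑ n ∈ S, lam n * z t n ^ 2 ≤ B
  int_le : ∀ S : Finset ℕ+, ∑ n ∈ S, lam n ^ 2 * weightInt θ₀ (fun t => z t n) ≤ B
  datum_le : ‖p‖ ^ 2 ≤ B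

namespace ComparisonData

variable {e : HilbertBasis ℕ+ ℝ H} {lam : ℕ+ → ℝ} {N : ℕ+} {F : H → H} {L ε θ θ₀ B : ℝ} {p : H}
  {u u₀ : ℝ → H} {v z : ℝ → ℕ+ → ℝ} {c : ℕ+ → ℝ → ℝ}

lemma bound_nonneg (D : ComparisonData e lam N F ε θ θ₀ B p u u₀ v z c) : 0 ≤ B :=
  (sq_nonneg _).trans D.datum_le

lemma theta₀_eq (D : ComparisonData e lam N F ε θ θ₀ B p u u₀ v z c) :
    θ₀ = (lam N + lam (N + 1)) / 2 := by linarith [D.gap₀.root]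

lemma theta₀_le (D : ComparisonData e lam N F ε θ θ₀ B p u u₀ v z c) : θ₀ ≤ θ :=
  D.theta₀_eq ▸ D.gap.le_theta

/-- Here `2εθ₀ = ε (λ_N + λ_{N+1}) ≤ ε (3 λ_{N+1} + λ_N)/2`. -/
lemma half_le (D : ComparisonData e lam N F ε θ θ₀ B p u u₀ v z c) :
    1 / 2 ≤ 1 - 2 * ε * θ₀ := by
  rw [D.theta₀_eq]
  nlinarith [D.gap.eps_le, D.gap.gap, D.eps_pos]

lemma vel_wl2 (D : ComparisonData e lam N F ε θ θ₀ B p u u₀ v z c) (n : ℕ+) :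
    WL2 θ₀ (fun t => z t n) := (D.sol₀ n).1.vint D.gap₀

/-- The remainder in the equation for the corrected difference. -/
lemma modeSol (D : ComparisonData e lam N F ε θ θ₀ B p u u₀ v z c)
    (hF : ∀ u₁ u₂ : H, ‖F u₁ - F u₂‖ ≤ L * ‖u₁ - u₂‖) (hF0 : F 0 = 0) (n : ℕ+) :
    ModeSol ε θ (lam n) (fun t => coeff e (F (u t) - F (u₀ t)) n + ε * lam n * c n t)
      (fun t => coeff e (u t) n - coeff e (u₀ t) n + ε * c n t) (fun t => v t n - c n t) where
  force := by
    have h0 : VL2 θ u₀ := ⟨D.vl2₀.cont, (D.vl2₀.norm.mono_exponent D.theta₀_le).1⟩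
    exact (((D.vl2.comp_lipschitz hF hF0).sub (h0.comp_lipschitz hF hF0)).coeff e n).add
      (((D.corr n).mono_exponent D.theta₀_le).1.const_mul _)
  vel t ht := by
    have hε := D.eps_pos.ne'
    refine (((((D.sol n).1.vel t ht).sub ((D.sol₀ n).1.vel t ht)).add
      ((D.corr_deriv n t ht).const_mul ε))).congr_deriv ?_
    field_simp
    ring
  eqn t ht := by
    have hε := D.eps_pos.ne'
    -- The parabolic equation eliminates `z` in favour of `F(u₀) - A u₀`; only `c'` occurs, never a
    -- derivative of `z`.
    have h1 := (D.sol₀ n).1.velocity_eq ht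
    refine (((D.sol n).1.eqn t ht).sub ((D.corr_deriv n t ht).const_mul ε)).congr_deriv ?_
      |>.congr (fun x _ => ?_) ?_
    · rw [mul_div_cancel₀ _ hε, coeff_sub]
      simp only at h1 ⊢
      linear_combination -h1
    · simp only [Pi.sub_apply]; ring
    · simp only [Pi.sub_apply]; ring
  slow := (((D.sol n).1.disp.sub ((D.sol₀ n).1.disp.mono_exponent D.theta₀_le).1).add
    (((D.corr n).mono_exponent D.theta₀_le).1.const_mul ε)).int

lemma corr_sup_le (D : ComparisonData e lam N F ε θ θ₀ B p u u₀ v z c) (hpos : ∀ n, 0 < lam n)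
    {t : ℝ} (ht : t ≤ 0) (S : Finset ℕ+) :
    Real.exp (2 * θ₀ * t) * ∑ n ∈ S, lam n * c n t ^ 2 ≤ 2 * B := by
  have h := relaxation_sup_le D.eps_pos one_half_pos D.half_le (fun n => (hpos n).le) D.corr
    D.corr_deriv (fun t ht => D.sup_le t ht S) ht
  linarith

lemma corr_sup_le' (D : ComparisonData e lam N F ε θ θ₀ B p u u₀ v z c) (hpos : ∀ n, 0 < lam n)
    {t : ℝ} (ht : t ≤ 0) (S : Finset ℕ+) :
    Real.exp (2 * θ * t) * ∑ n ∈ S, lam n * c n t ^ 2 ≤ 2 * B := by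
  refine le_trans ?_ (D.corr_sup_le hpos ht S)
  have h1 : 2 * θ * t ≤ 2 * θ₀ * t := by nlinarith [D.theta₀_le]
  have h2 : 0 ≤ ∑ n ∈ S, lam n * c n t ^ 2 :=
    Finset.sum_nonneg fun n _ => mul_nonneg (hpos n).le (sq_nonneg _)
  gcongr

lemma corr_energy_le (D : ComparisonData e lam N F ε θ θ₀ B p u u₀ v z c) (n : ℕ+) :
    ε * c n 0 ^ 2 ≤ weightInt θ₀ (fun t => z t n) ∧
      weightInt θ (c n) ≤ 2 * weightInt θ₀ (fun t => z t n) := by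
  have h1 := relaxation_energy_le D.eps_pos (D.corr n) (D.vel_wl2 n) (D.corr_deriv n)
  have h2 := weightInt_nonneg θ₀ (c n)
  have h3 := ((D.corr n).mono_exponent D.theta₀_le).2
  have h4 := mul_le_mul_of_nonneg_right D.half_le h2
  have h5 : 0 ≤ ε * c n 0 ^ 2 := mul_nonneg D.eps_pos.le (sq_nonneg _)
  constructor <;> linarith

/-- At `t = 0` the corrector is bounded in `H²` only by a multiple of `ε^{-1/2}`. This is enough,
since it enters the final estimate through `ε ‖ε A c(0)‖²`. -/
lemma sum_corr_zero_le (D : ComparisonData e lam N F ε θ θ₀ B p u u₀ v z c) (S : Finset ℕ+) :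
    ε * ∑ n ∈ S, lam n ^ 2 * c n 0 ^ 2 ≤ B := by
  refine le_trans ?_ (D.int_le S)
  rw [Finset.mul_sum]
  refine Finset.sum_le_sum fun n _ => ?_
  rw [mul_left_comm]
  exact mul_le_mul_of_nonneg_left (D.corr_energy_le n).1 (sq_nonneg _)

lemma sum_corr_weightInt_le (D : ComparisonData e lam N F ε θ θ₀ B p u u₀ v z c)
    (S : Finset ℕ+) : ∑ n ∈ S, lam n ^ 2 * weightInt θ (c n) ≤ 2 * B := by
  refine le_trans ?_ (mul_le_mul_of_nonneg_left (D.int_le S) zero_le_two)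
  rw [Finset.mul_sum]
  refine Finset.sum_le_sum fun n _ => ?_
  rw [mul_left_comm]
  exact mul_le_mul_of_nonneg_left (D.corr_energy_le n).2 (sq_nonneg _)

end ComparisonData

/-- The discrepancy of the data of the two problems in one mode. -/
lemma slowCoord_corrector_sq_le {l Λ ε θ : ℝ} (G : GapData l Λ ε θ) {lam v u p c : ℝ} (h0 : 0 < lam)
    (h : lam ≤ l) (hp : slowCoord ε lam v u = p) :
    slowCoord ε lam (v - c) (u - p + ε * c) ^ 2
      ≤ ε ^ 2 * (((Λ - l) / (3 * Λ + l)) ^ 2)⁻¹ * (8 * Λ ^ 2 * p ^ 2 + c ^ 2) := by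
  have h1 := G.sqrt_pos h
  have h2 := G.sq_sqrt h
  have hκ := G.const_pos
  have h3 := G.const_le_damp.trans (G.damp_le_sqrt h)
  have hε := G.eps_nonneg
  unfold slowCoord at hp ⊢
  set σ := Real.sqrt (1 - 4 * ε * lam)
  set κ := (Λ - l) / (3 * Λ + l)
  -- The identity `σ² = 1 - 4ε lam` extracts a factor `ε/σ` from the mismatch of the two final
  -- conditions.
  have h4 : ε / σ * (v - c) + (1 + σ) / (2 * σ) * (u - p + ε * c)
      = ε / σ * ((1 - σ) / 2 * (-c) + 2 * lam / (1 + σ) * -p) := by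
    have h5 : 1 + σ ≠ 0 := by positivity
    have h6 : ε / σ * (v - c) + (1 + σ) / (2 * σ) * (u - p + ε * c)
        = p - (1 + σ) / (2 * σ) * p + ε / σ * ((1 + σ) / 2 - 1) * c := by
      rw [← hp]; field_simp; ring
    rw [h6]
    field_simp
    linear_combination p * h2
  have h5 : σ ≤ 1 := by nlinarith [mul_nonneg hε h0.le]
  have ha : ((1 - σ) / 2) ^ 2 ≤ 1 / 4 := by nlinarith
  have hb : (2 * lam / (1 + σ)) ^ 2 ≤ (2 * Λ) ^ 2 := by
    have : 2 * lam / (1 + σ) ≤ 2 * Λ := by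
      rw [div_le_iff₀ (by positivity)]
      nlinarith [G.gap]
    gcongr
  have h6 : ((1 - σ) / 2 * (-c) + 2 * lam / (1 + σ) * -p) ^ 2 ≤ 8 * Λ ^ 2 * p ^ 2 + c ^ 2 := by
    have h7 : ((1 - σ) / 2 * (-c) + 2 * lam / (1 + σ) * -p) ^ 2
        ≤ 2 * (((1 - σ) / 2) ^ 2 * c ^ 2) + 2 * ((2 * lam / (1 + σ)) ^ 2 * p ^ 2) := by
      nlinarith [sq_nonneg ((1 - σ) / 2 * (-c) - 2 * lam / (1 + σ) * -p)]
    have h8 := mul_le_mul_of_nonneg_right ha (sq_nonneg c)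
    have h9 := mul_le_mul_of_nonneg_right hb (sq_nonneg p)
    nlinarith [sq_nonneg c]
  rw [h4, mul_pow, div_pow, div_eq_mul_inv]
  gcongr

end Comparison

end HypRelax

/-! ### Estimates of the corrected difference -/

namespace HypRelax

namespace ComparisonData

variable {H : Type*} [NormedAddCommGroup H] [InnerProductSpace ℝ H] [CompleteSpace H]
  {e : HilbertBasis ℕ+ ℝ H} {lam : ℕ+ → ℝ} {N : ℕ+} {F : H → H} {L ε θ θ₀ B : ℝ} {p : H}
  {u u₀ : ℝ → H} {v z : ℝ → ℕ+ → ℝ} {c : ℕ+ → ℝ → ℝ}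

/-- Both solutions have the datum `p`, but for different functionals, and the corrector shifts the
final values as well. In the finitely many slow modes the total discrepancy is `O(ε)`, because
`c(0)` is bounded through its `H¹` estimate. -/
lemma exists_datum (hpos : ∀ n, 0 < lam n) (hmono : Monotone lam) :
    ∃ K, 0 ≤ K ∧ ∀ {ε θ θ₀ B : ℝ} {p : H} {u u₀ : ℝ → H} {v z : ℝ → ℕ+ → ℝ} {c : ℕ+ → ℝ → ℝ},
      ComparisonData e lam N F ε θ θ₀ B p u u₀ v z c → ∃ q : ℕ+ → ℝ,
        (∀ n, FinalDatum (lam N) (lam (N + 1)) ε (lam n) (q n) (v 0 n - c n 0)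
          (coeff e (u 0) n - coeff e (u₀ 0) n + ε * c n 0)) ∧
        ∀ S : Finset ℕ+, ∑ n ∈ S, q n ^ 2 ≤ K * (ε ^ 2 * B) := by
  set Λ := lam (N + 1)
  set κ := (Λ - lam N) / (3 * Λ + lam N)
  have hl1 := hpos 1
  refine ⟨(κ ^ 2)⁻¹ * (8 * Λ ^ 2 + (lam 1)⁻¹ * 2), by positivity, fun {ε θ θ₀ B p u u₀ v z c} D => ?_⟩
  refine ⟨fun n => if n ≤ N then slowCoord ε (lam n) (v 0 n - c n 0)
    (coeff e (u 0) n - coeff e (u₀ 0) n + ε * c n 0) else 0, fun n => ?_, fun S => ?_⟩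
  · simp only
    split_ifs with hn
    · exact Or.inr ⟨hpos n, hmono hn, rfl⟩
    · exact Or.inl ⟨hmono (Order.add_one_le_of_lt (not_le.1 hn)), rfl⟩
  · have h1 : ∀ n, (if n ≤ N then slowCoord ε (lam n) (v 0 n - c n 0)
        (coeff e (u 0) n - coeff e (u₀ 0) n + ε * c n 0) else 0) ^ 2
        ≤ ε ^ 2 * (κ ^ 2)⁻¹ * (8 * Λ ^ 2 * coeff e p n ^ 2 + c n 0 ^ 2) := by
      intro n
      split_ifs with hn
      · have hlt : lam n < Λ := (hmono hn).trans_lt D.gap.gap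
        have h2 : coeff e (u₀ 0) n = coeff e p n := by
          rcases (D.sol₀ n).2 with h | h
          · exact absurd h.1 (not_le.2 hlt)
          · rw [← h.2.2, slowCoord_zero]
        have h3 : slowCoord ε (lam n) (v 0 n) (coeff e (u 0) n) = coeff e p n := by
          rcases (D.sol n).2 with h | h
          · exact absurd h.1 (not_le.2 hlt)
          · exact h.2.2
        rw [h2]
        exact slowCoord_corrector_sq_le D.gap (hpos n) (hmono hn) h3
      · rw [zero_pow two_ne_zero]
        positivity
    refine (Finset.sum_le_sum fun n _ => h1 n).trans ?_
    rw [← Finset.mul_sum, Finset.sum_add_distrib, ← Finset.mul_sum]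
    have h2 := (sum_coeff_sq_le e p S).trans D.datum_le
    have h3 : ∑ n ∈ S, c n 0 ^ 2 ≤ (lam 1)⁻¹ * (2 * B) := by
      have h4 := D.corr_sup_le hpos le_rfl S
      rw [mul_zero, Real.exp_zero, one_mul] at h4
      refine le_trans ?_ (mul_le_mul_of_nonneg_left h4 (inv_pos.2 hl1).le)
      rw [Finset.mul_sum]
      refine Finset.sum_le_sum fun n _ => ?_
      rw [inv_mul_eq_div, le_div_iff₀ hl1, mul_comm]
      exact mul_le_mul_of_nonneg_right (hmono (one_le (a := n))) (sq_nonneg _)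
    calc _ ≤ ε ^ 2 * (κ ^ 2)⁻¹ * (8 * Λ ^ 2 * B + (lam 1)⁻¹ * (2 * B)) := by gcongr
      _ = _ := by ring

lemma vl2₀' (D : ComparisonData e lam N F ε θ θ₀ B p u u₀ v z c) : VL2 θ u₀ :=
  ⟨D.vl2₀.cont, (D.vl2₀.norm.mono_exponent D.theta₀_le).1⟩

lemma force_vl2 (D : ComparisonData e lam N F ε θ θ₀ B p u u₀ v z c)
    (hF : ∀ u₁ u₂ : H, ‖F u₁ - F u₂‖ ≤ L * ‖u₁ - u₂‖) (hF0 : F 0 = 0) :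
    VL2 θ (fun t => F (u t) - F (u₀ t)) :=
  (D.vl2.comp_lipschitz hF hF0).sub (D.vl2₀'.comp_lipschitz hF hF0)

/-- The remainder `ε A c` is `O(ε)` thanks to the weighted `L²(H²)` bound of the corrector; the
nonlinear part keeps a factor close to one for later absorption. -/
lemma sum_remainder_le (D : ComparisonData e lam N F ε θ θ₀ B p u u₀ v z c)
    (hF : ∀ u₁ u₂ : H, ‖F u₁ - F u₂‖ ≤ L * ‖u₁ - u₂‖) (hF0 : F 0 = 0) {η : ℝ} (hη : 0 < η)
    (S : Finset ℕ+) :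
    ∑ n ∈ S, weightInt θ (fun t => coeff e (F (u t) - F (u₀ t)) n + ε * lam n * c n t)
      ≤ (1 + η) * (L ^ 2 * weightInt θ (fun t => ‖u t - u₀ t‖))
        + (1 + 1 / η) * 2 * (ε ^ 2 * B) := by
  have hf := D.force_vl2 hF hF0
  have h1 : ∀ n, weightInt θ (fun t => coeff e (F (u t) - F (u₀ t)) n + ε * lam n * c n t)
      ≤ (1 + η) * weightInt θ (fun t => coeff e (F (u t) - F (u₀ t)) n)
        + (1 + 1 / η) * ε ^ 2 * (lam n ^ 2 * weightInt θ (c n)) := by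
    intro n
    have h2 := (hf.coeff e n).weightInt_add_le
      (((D.corr n).mono_exponent D.theta₀_le).1.const_mul (ε * lam n)) hη
    rw [weightInt_const_mul] at h2
    refine h2.trans (le_of_eq ?_)
    ring
  refine (Finset.sum_le_sum fun n _ => h1 n).trans ?_
  rw [Finset.sum_add_distrib, ← Finset.mul_sum, ← Finset.mul_sum]
  have h2 := (hf.sum_weightInt_coeff_le e S).trans (D.vl2.weightInt_lipschitz_le D.vl2₀' hF hF0)
  calc _ ≤ (1 + η) * (L ^ 2 * weightInt θ (fun t => ‖u t - u₀ t‖))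
        + (1 + 1 / η) * ε ^ 2 * (2 * B) := by
          gcongr
          exact D.sum_corr_weightInt_le S
    _ = _ := by ring

/-- Estimating the forcing, applying the mode estimate and removing `ε c` each cost a factor `1 +
η`. Since `(1 + η)³ L² < δ²`, the term with `u - u₀` on the right is absorbed. -/
lemma exists_disp_weightInt_le (hpos : ∀ n, 0 < lam n) (hmono : Monotone lam)
    (hF : ∀ u₁ u₂ : H, ‖F u₁ - F u₂‖ ≤ L * ‖u₁ - u₂‖) (hF0 : F 0 = 0)
    (hL0 : 0 ≤ L) (hL : L < (lam (N + 1) - lam N) / 2) :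
    ∃ K, 0 ≤ K ∧ ∀ {ε θ θ₀ B : ℝ} {p : H} {u u₀ : ℝ → H} {v z : ℝ → ℕ+ → ℝ} {c : ℕ+ → ℝ → ℝ},
      ComparisonData e lam N F ε θ θ₀ B p u u₀ v z c →
        weightInt θ (fun t => ‖u t - u₀ t‖) ≤ K * (ε ^ 2 * B) := by
  obtain ⟨Kq, hKq, hq⟩ := exists_datum (e := e) (N := N) (F := F) hpos hmono
  obtain ⟨η, hη, hη1⟩ := exists_contraction_margin hL0 hL
  set Λ := lam (N + 1)
  set δ := (Λ - lam N) / 2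
  have hΛ : 0 < Λ := hpos _
  have hl1 := hpos 1
  have hδ0 : 0 < δ := hL0.trans_lt hL
  have hγ : 0 < δ ^ 2 - (1 + η) ^ 3 * L ^ 2 := by linarith
  set K₁ := (1 + η) * ((1 + η) * ((1 + 1 / η) * 2) + (1 + 1 / η) * (Λ * Kq))
    + δ ^ 2 * ((1 + 1 / η) * ((lam 1 ^ 2)⁻¹ * 2)) with hK₁
  refine ⟨K₁ / (δ ^ 2 - (1 + η) ^ 3 * L ^ 2), by positivity, fun {ε θ θ₀ B p u u₀ v z c} D => ?_⟩
  obtain ⟨q, hq1, hq2⟩ := hq D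
  set J := weightInt θ (fun t => ‖u t - u₀ t‖)
  have hd := D.vl2.sub D.vl2₀'
  have h1 : ∀ n, δ ^ 2 * weightInt θ (fun t => coeff e (u t - u₀ t) n)
      ≤ (1 + η) * ((1 + η) * weightInt θ (fun t => coeff e (F (u t) - F (u₀ t)) n
          + ε * lam n * c n t) + (1 + 1 / η) * Λ * q n ^ 2)
        + δ ^ 2 * ((1 + 1 / η) * ε ^ 2 * weightInt θ (c n)) := by
    intro n
    have M := D.modeSol hF hF0 n
    have h2 := (M.estimates D.gap (hq1 n)).1 η hη
    have h3 := M.disp.weightInt_add_le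
      (((D.corr n).mono_exponent D.theta₀_le).1.const_mul (-ε)) hη
    rw [weightInt_const_mul] at h3
    have h4 : weightInt θ (fun t => coeff e (u t - u₀ t) n)
        = weightInt θ (fun t => coeff e (u t) n - coeff e (u₀ t) n + ε * c n t + -ε * c n t) :=
      weightInt_congr fun t _ => by rw [coeff_sub]; ring
    rw [h4]
    calc _ ≤ δ ^ 2 * ((1 + η) * weightInt θ (fun t => coeff e (u t) n - coeff e (u₀ t) n
            + ε * c n t) + (1 + 1 / η) * ((-ε) ^ 2 * weightInt θ (c n))) := by gcongr
      _ = (1 + η) * (δ ^ 2 * weightInt θ (fun t => coeff e (u t) n - coeff e (u₀ t) n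
            + ε * c n t)) + δ ^ 2 * ((1 + 1 / η) * ε ^ 2 * weightInt θ (c n)) := by ring
      _ ≤ (1 + η) * ((1 + η) * weightInt θ (fun t => coeff e (F (u t) - F (u₀ t)) n
          + ε * lam n * c n t) + (1 + 1 / η) * (Λ * q n ^ 2))
            + δ ^ 2 * ((1 + 1 / η) * ε ^ 2 * weightInt θ (c n)) := by gcongr
      _ = _ := by ring
  have hc : ∀ S : Finset ℕ+, ∑ n ∈ S, weightInt θ (c n) ≤ (lam 1 ^ 2)⁻¹ * (2 * B) := by
    intro S
    refine le_trans ?_ (mul_le_mul_of_nonneg_left (D.sum_corr_weightInt_le S) (by positivity))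
    rw [Finset.mul_sum]
    refine Finset.sum_le_sum fun n _ => ?_
    rw [inv_mul_eq_div, le_div_iff₀ (by positivity), mul_comm]
    exact mul_le_mul_of_nonneg_right (pow_le_pow_left₀ hl1.le (hmono (one_le (a := n))) 2)
      (weightInt_nonneg _ _)
  have h2 : ∀ S : Finset ℕ+, ∑ n ∈ S, weightInt θ (fun t => coeff e (u t - u₀ t) n)
      ≤ ((1 + η) ^ 3 * L ^ 2 * J + K₁ * (ε ^ 2 * B)) / δ ^ 2 := by
    intro S
    rw [le_div_iff₀ (by positivity), mul_comm, Finset.mul_sum]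
    refine (Finset.sum_le_sum fun n _ => h1 n).trans ?_
    rw [Finset.sum_add_distrib, ← Finset.mul_sum, Finset.sum_add_distrib, ← Finset.mul_sum,
      ← Finset.mul_sum, ← Finset.mul_sum, ← Finset.mul_sum]
    calc _ ≤ (1 + η) * ((1 + η) * ((1 + η) * (L ^ 2 * J) + (1 + 1 / η) * 2 * (ε ^ 2 * B))
          + (1 + 1 / η) * Λ * (Kq * (ε ^ 2 * B)))
          + δ ^ 2 * ((1 + 1 / η) * ε ^ 2 * ((lam 1 ^ 2)⁻¹ * (2 * B))) := by
            gcongr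
            · exact D.sum_remainder_le hF hF0 hη S
            · exact hq2 S
            · exact hc S
      _ = _ := by rw [hK₁]; ring
  have h3 := (VL2.of_sum_weightInt_le e hd.cont (fun n => hd.coeff e n) h2).2
  rw [le_div_iff₀ (by positivity)] at h3
  rw [div_mul_eq_mul_div, le_div_iff₀ hγ]
  linarith

/-- With `u - u₀` already `O(ε)` in weighted `L²`, nothing remains to be absorbed, so the pointwise
mode estimate applies and Young's parameter can be one. -/
lemma exists_energy_le (hpos : ∀ n, 0 < lam n) (hmono : Monotone lam)
    (hF : ∀ u₁ u₂ : H, ‖F u₁ - F u₂‖ ≤ L * ‖u₁ - u₂‖) (hF0 : F 0 = 0)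
    (hL0 : 0 ≤ L) (hL : L < (lam (N + 1) - lam N) / 2) :
    ∃ K, 0 ≤ K ∧ ∀ {ε θ θ₀ B : ℝ} {p : H} {u u₀ : ℝ → H} {v z : ℝ → ℕ+ → ℝ} {c : ℕ+ → ℝ → ℝ},
      ComparisonData e lam N F ε θ θ₀ B p u u₀ v z c → ∀ t ≤ 0, ∀ S : Finset ℕ+,
        Real.exp (2 * θ * t) * ∑ n ∈ S, (ε * (v t n - c n t) ^ 2
          + lam n * (coeff e (u t) n - coeff e (u₀ t) n + ε * c n t) ^ 2) ≤ K * (ε ^ 2 * B) := by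
  obtain ⟨Kq, hKq, hq⟩ := exists_datum (e := e) (N := N) (F := F) hpos hmono
  obtain ⟨KJ, hKJ, hJ⟩ := exists_disp_weightInt_le (e := e) hpos hmono hF hF0 hL0 hL
  have hC := energyConst_pos (hpos N) (by linarith : lam N < lam (N + 1))
  set Ce := energyConst (lam N) (lam (N + 1))
  refine ⟨Ce * (2 * (L ^ 2 * KJ) + 4 + Kq), by positivity,
    fun {ε θ θ₀ B p u u₀ v z c} D t ht S => ?_⟩
  obtain ⟨q, hq1, hq2⟩ := hq D
  rw [Finset.mul_sum]
  have h1 : ∀ n, Real.exp (2 * θ * t) * (ε * (v t n - c n t) ^ 2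
      + lam n * (coeff e (u t) n - coeff e (u₀ t) n + ε * c n t) ^ 2)
      ≤ Ce * (weightInt θ (fun t => coeff e (F (u t) - F (u₀ t)) n + ε * lam n * c n t)
        + q n ^ 2) := fun n => ((D.modeSol hF hF0 n).estimates D.gap (hq1 n)).2 t ht
  refine (Finset.sum_le_sum fun n _ => h1 n).trans ?_
  rw [← Finset.mul_sum, Finset.sum_add_distrib]
  have h2 := D.sum_remainder_le hF hF0 one_pos S
  have h3 := mul_le_mul_of_nonneg_left (hJ D) (sq_nonneg L)
  calc _ ≤ Ce * ((1 + 1) * (L ^ 2 * (KJ * (ε ^ 2 * B))) + (1 + 1 / 1) * 2 * (ε ^ 2 * B)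
        + Kq * (ε ^ 2 * B)) := by
          gcongr
          · exact h2.trans (by gcongr)
          · exact hq2 S
    _ = _ := by ring

/-- The energy controls only `ε ‖v - c‖²`. For a bound free of `ε` the second order equation is read
as the relaxation `ε y' + y = s` with `y = v - c`. Its source contains `A (u - u₀ + ε c)`, whose
`H⁻¹` norm is the `H¹` norm of the corrected difference. -/
lemma exists_vel_le (hpos : ∀ n, 0 < lam n) (hmono : Monotone lam)
    (hF : ∀ u₁ u₂ : H, ‖F u₁ - F u₂‖ ≤ L * ‖u₁ - u₂‖) (hF0 : F 0 = 0)
    (hL0 : 0 ≤ L) (hL : L < (lam (N + 1) - lam N) / 2) :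
    ∃ K, 0 ≤ K ∧ ∀ {ε θ θ₀ B : ℝ} {p : H} {u u₀ : ℝ → H} {v z : ℝ → ℕ+ → ℝ} {c : ℕ+ → ℝ → ℝ},
      ComparisonData e lam N F ε θ θ₀ B p u u₀ v z c → ∀ S : Finset ℕ+,
        ∑ n ∈ S, (lam n)⁻¹ * (v 0 n - c n 0) ^ 2 ≤ K * (ε ^ 2 * B) := by
  obtain ⟨K, hK, hE⟩ := exists_energy_le (e := e) hpos hmono hF hF0 hL0 hL
  set Λ := lam (N + 1)
  set κ := (Λ - lam N) / (3 * Λ + lam N)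
  have hl1 := hpos 1
  have hΛ : 0 < Λ := hpos _
  have hlN := hpos N
  have hκ : 0 < κ := div_pos (by linarith) (by linarith)
  set K' := 4 * ((lam 1)⁻¹ * (L ^ 2 * ((lam 1)⁻¹ * (2 * K + 4)))) + 8 + 2 * K
  refine ⟨K' / κ, by positivity, fun {ε θ θ₀ B p u u₀ v z c} D S => ?_⟩
  have hW : ∀ t ≤ 0, ∀ S : Finset ℕ+, Real.exp (2 * θ * t) * ∑ n ∈ S,
      lam n * (coeff e (u t) n - coeff e (u₀ t) n + ε * c n t) ^ 2 ≤ K * (ε ^ 2 * B) := by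
    intro t ht S
    refine le_trans ?_ (hE D t ht S)
    gcongr with n
    have := mul_nonneg D.eps_pos.le (sq_nonneg (v t n - c n t))
    linarith
  have hd : ∀ t ≤ 0, Real.exp (2 * θ * t) * ‖u t - u₀ t‖ ^ 2
      ≤ (lam 1)⁻¹ * ((2 * K + 4) * (ε ^ 2 * B)) := by
    intro t ht
    have hexp := Real.exp_pos (2 * θ * t)
    rw [mul_comm, ← le_div_iff₀ hexp]
    refine norm_sq_le_of_sum_coeff e fun S => ?_
    rw [le_div_iff₀ hexp, inv_mul_eq_div, le_div_iff₀ hl1]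
    have h1 := hW t ht S
    have h2 := D.corr_sup_le' hpos ht S
    have h3 : lam 1 * ∑ n ∈ S, coeff e (u t - u₀ t) n ^ 2
        ≤ 2 * ∑ n ∈ S, lam n * (coeff e (u t) n - coeff e (u₀ t) n + ε * c n t) ^ 2
          + 2 * ε ^ 2 * ∑ n ∈ S, lam n * c n t ^ 2 := by
      rw [Finset.mul_sum, Finset.mul_sum, Finset.mul_sum, ← Finset.sum_add_distrib]
      refine Finset.sum_le_sum fun n _ => ?_
      have h4 := mul_le_mul_of_nonneg_right (hmono (one_le (a := n)))
        (sq_nonneg (coeff e (u t - u₀ t) n))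
      refine h4.trans ?_
      rw [coeff_sub]
      have h5 : (coeff e (u t) n - coeff e (u₀ t) n) ^ 2
          ≤ 2 * (coeff e (u t) n - coeff e (u₀ t) n + ε * c n t) ^ 2 + 2 * (ε ^ 2 * c n t ^ 2) := by
        nlinarith [sq_nonneg (coeff e (u t) n - coeff e (u₀ t) n + 2 * (ε * c n t))]
      have := mul_le_mul_of_nonneg_left h5 (hpos n).le
      linarith
    have h6 := mul_le_mul_of_nonneg_left h3 hexp.le
    have h7 := mul_le_mul_of_nonneg_left h2 (by positivity : 0 ≤ 2 * ε ^ 2)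
    linarith
  have hsrc : ∀ t ≤ 0, Real.exp (2 * θ * t) * ∑ n ∈ S, (lam n)⁻¹ *
      (coeff e (F (u t) - F (u₀ t)) n + ε * lam n * c n t
        - lam n * (coeff e (u t) n - coeff e (u₀ t) n + ε * c n t)) ^ 2 ≤ K' * (ε ^ 2 * B) := by
    intro t ht
    have hexp := Real.exp_pos (2 * θ * t)
    have h1 : ∑ n ∈ S, (lam n)⁻¹ * (coeff e (F (u t) - F (u₀ t)) n + ε * lam n * c n t
        - lam n * (coeff e (u t) n - coeff e (u₀ t) n + ε * c n t)) ^ 2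
        ≤ 4 * ((lam 1)⁻¹ * (L ^ 2 * ‖u t - u₀ t‖ ^ 2)) + 4 * ε ^ 2 * ∑ n ∈ S, lam n * c n t ^ 2
          + 2 * ∑ n ∈ S, lam n * (coeff e (u t) n - coeff e (u₀ t) n + ε * c n t) ^ 2 := by
      have h2 : ∑ n ∈ S, coeff e (F (u t) - F (u₀ t)) n ^ 2 ≤ L ^ 2 * ‖u t - u₀ t‖ ^ 2 := by
        refine (sum_coeff_sq_le e _ S).trans ?_
        rw [← mul_pow]
        exact pow_le_pow_left₀ (norm_nonneg _) (hF _ _) 2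
      have h3 := mul_le_mul_of_nonneg_left h2 (inv_pos.2 hl1).le
      refine le_trans ?_ (add_le_add (add_le_add (mul_le_mul_of_nonneg_left h3
        (by norm_num : (0 : ℝ) ≤ 4)) le_rfl) le_rfl)
      rw [Finset.mul_sum, Finset.mul_sum, Finset.mul_sum, Finset.mul_sum,
        ← Finset.sum_add_distrib, ← Finset.sum_add_distrib]
      refine Finset.sum_le_sum fun n _ => ?_
      have hn := hpos n
      have h4 := inv_anti₀ hl1 (hmono (one_le (a := n)))
      set a := coeff e (F (u t) - F (u₀ t)) n
      set w := coeff e (u t) n - coeff e (u₀ t) n + ε * c n t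
      have h5 : (a + ε * lam n * c n t - lam n * w) ^ 2
          ≤ 4 * a ^ 2 + 4 * (ε * lam n * c n t) ^ 2 + 2 * (lam n * w) ^ 2 := by
        nlinarith [sq_nonneg (a + ε * lam n * c n t + lam n * w), sq_nonneg (a - ε * lam n * c n t)]
      calc _ ≤ (lam n)⁻¹ * (4 * a ^ 2 + 4 * (ε * lam n * c n t) ^ 2 + 2 * (lam n * w) ^ 2) := by
            gcongr
        _ = 4 * ((lam n)⁻¹ * a ^ 2) + 4 * ε ^ 2 * (lam n * c n t ^ 2) + 2 * (lam n * w ^ 2) := by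
            field_simp
        _ ≤ _ := by gcongr
    have h2 := mul_le_mul_of_nonneg_left h1 hexp.le
    have h3 := mul_le_mul_of_nonneg_left (hd t ht)
      (by positivity : 0 ≤ 4 * ((lam 1)⁻¹ * L ^ 2))
    have h4 := mul_le_mul_of_nonneg_left (D.corr_sup_le' hpos ht S)
      (by positivity : 0 ≤ 4 * ε ^ 2)
    have h5 := hW t ht S
    calc _ ≤ _ := h2
      _ = 4 * ((lam 1)⁻¹ * L ^ 2) * (Real.exp (2 * θ * t) * ‖u t - u₀ t‖ ^ 2)
          + 4 * ε ^ 2 * (Real.exp (2 * θ * t) * ∑ n ∈ S, lam n * c n t ^ 2)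
          + 2 * (Real.exp (2 * θ * t) * ∑ n ∈ S,
            lam n * (coeff e (u t) n - coeff e (u₀ t) n + ε * c n t) ^ 2) := by ring
      _ ≤ 4 * ((lam 1)⁻¹ * L ^ 2) * ((lam 1)⁻¹ * ((2 * K + 4) * (ε ^ 2 * B)))
          + 4 * ε ^ 2 * (2 * B) + 2 * (K * (ε ^ 2 * B)) := by linarith
      _ = K' * (ε ^ 2 * B) := by ring
  have h := relaxation_sup_le D.eps_pos hκ D.gap.const_le_damp (S := S)
    (fun n => (inv_pos.2 (hpos n)).le) (y := fun n t => v t n - c n t)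
    (s := fun n t => coeff e (F (u t) - F (u₀ t)) n + ε * lam n * c n t
        - lam n * (coeff e (u t) n - coeff e (u₀ t) n + ε * c n t))
    (fun n => (D.modeSol hF hF0 n).vint D.gap) (fun n t ht => ?_) hsrc le_rfl
  · rw [mul_zero, Real.exp_zero, one_mul] at h
    rw [div_mul_eq_mul_div]
    exact h
  · have hε := D.eps_pos.ne'
    refine (((D.modeSol hF hF0 n).eqn t ht).const_mul ε⁻¹).congr (fun x _ => ?_) ?_ |>.congr_deriv ?_
    · field_simp
    · field_simp
    · field_simp

end ComparisonData

end HypRelax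

/-! ### The velocity defect at `t = 0` and the final estimate -/

namespace HypRelax

namespace ComparisonData

variable {H : Type*} [NormedAddCommGroup H] [InnerProductSpace ℝ H] [CompleteSpace H]
  {e : HilbertBasis ℕ+ ℝ H} {lam : ℕ+ → ℝ} {N : ℕ+} {F : H → H} {L ε θ θ₀ B : ℝ} {p : H}
  {u u₀ : ℝ → H} {v z : ℝ → ℕ+ → ℝ} {c : ℕ+ → ℝ → ℝ}

/-- The solution of the parabolic problem is Lipschitz continuous near `0`. -/
lemma norm_sub_zero_sq_le (D : ComparisonData e lam N F ε θ θ₀ B p u u₀ v z c)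
    (hpos : ∀ n, 0 < lam n) (hmono : Monotone lam) {t : ℝ} (ht : t ≤ 0) :
    ‖u₀ t - u₀ 0‖ ^ 2 ≤ t ^ 2 * (Real.exp (-(2 * θ₀ * t)) * ((lam 1)⁻¹ * B)) := by
  rcases ht.eq_or_lt with rfl | ht0
  · simp
  have hl1 := hpos 1
  refine norm_sq_le_of_sum_coeff e fun S => ?_
  have hz : ∀ n, IntervalIntegrable (fun s => z s n ^ 2) volume t 0 := fun n =>
    (((D.vel_wl2 n).cont.pow 2).mono fun x hx => by
      rw [uIcc_of_le ht] at hx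
      exact hx.2).intervalIntegrable
  have h1 : ∀ n, coeff e (u₀ t - u₀ 0) n ^ 2 ≤ -t * ∫ s in t..0, z s n ^ 2 := by
    intro n
    have h2 := sq_increment_le (D.vel_wl2 n).cont (D.sol₀ n).1.vel (neg_pos.2 ht0) le_rfl
    simp only [sub_neg_eq_add, zero_add] at h2
    rw [coeff_sub, ← neg_sq, neg_sub]
    exact h2
  refine (Finset.sum_le_sum fun n _ => h1 n).trans ?_
  rw [← Finset.mul_sum, ← intervalIntegral.integral_finsetSum fun n _ => hz n]
  have h3 : ∫ s in t..0, ∑ n ∈ S, z s n ^ 2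
      ≤ ∫ _ in t..0, Real.exp (-(2 * θ₀ * t)) * ((lam 1)⁻¹ * B) := by
    have hi : IntervalIntegrable (fun s => ∑ n ∈ S, z s n ^ 2) volume t 0 := by
      have h := IntervalIntegrable.sum S fun n _ => hz n
      rwa [Finset.sum_fn] at h
    refine intervalIntegral.integral_mono_on ht hi
      intervalIntegrable_const fun s hs => ?_
    have h4 := D.sup_le s hs.2 S
    have h5 : lam 1 * ∑ n ∈ S, z s n ^ 2 ≤ ∑ n ∈ S, lam n * z s n ^ 2 := by
      rw [Finset.mul_sum]
      exact Finset.sum_le_sum fun n _ =>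
        mul_le_mul_of_nonneg_right (hmono (one_le (a := n))) (sq_nonneg _)
    have h6 : Real.exp (-(2 * θ₀ * s)) ≤ Real.exp (-(2 * θ₀ * t)) := by
      have := D.gap₀.theta_pos
      have := hs.1
      gcongr
    have h7 : Real.exp (-(2 * θ₀ * s)) * Real.exp (2 * θ₀ * s) = 1 := by
      rw [← Real.exp_add]; simp
    have hB := D.bound_nonneg
    calc ∑ n ∈ S, z s n ^ 2 ≤ (lam 1)⁻¹ * ∑ n ∈ S, lam n * z s n ^ 2 := by
          rw [inv_mul_eq_div, le_div_iff₀ hl1, mul_comm]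
          exact h5
      _ = Real.exp (-(2 * θ₀ * s)) * ((lam 1)⁻¹ *
          (Real.exp (2 * θ₀ * s) * ∑ n ∈ S, lam n * z s n ^ 2)) := by
          linear_combination (-(lam 1)⁻¹ * ∑ n ∈ S, lam n * z s n ^ 2) * h7
      _ ≤ Real.exp (-(2 * θ₀ * s)) * ((lam 1)⁻¹ * B) := by gcongr
      _ ≤ _ := by gcongr
  rw [intervalIntegral.integral_const, smul_eq_mul] at h3
  refine (mul_le_mul_of_nonneg_left h3 (neg_pos.2 ht0).le).trans (le_of_eq ?_)
  ring

/-- The function `Y = c + A (u₀ - ε c) - F(u₀(0))` satisfies `ε Y' + Y = F(u₀(t)) - F(u₀(0))`, and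
`Y(0)` is the defect in question. The source vanishes at `t = 0` and is Lipschitz there, while
relaxation remembers only times of order `ε`; hence `Y(0) = O(ε)` in `H`. -/
lemma exists_defect_le (hpos : ∀ n, 0 < lam n) (hmono : Monotone lam)
    (hF : ∀ u₁ u₂ : H, ‖F u₁ - F u₂‖ ≤ L * ‖u₁ - u₂‖) :
    ∃ K, 0 ≤ K ∧ ∀ {ε θ θ₀ B : ℝ} {p : H} {u u₀ : ℝ → H} {v z : ℝ → ℕ+ → ℝ} {c : ℕ+ → ℝ → ℝ},
      ComparisonData e lam N F ε θ θ₀ B p u u₀ v z c → ∀ S : Finset ℕ+,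
        ∑ n ∈ S, (c n 0 - z 0 n - ε * lam n * c n 0) ^ 2 ≤ K * (ε ^ 2 * B) := by
  have hl1 := hpos 1
  refine ⟨128 * (L ^ 2 * (lam 1)⁻¹), by positivity, fun {ε θ θ₀ B p u u₀ v z c} D S => ?_⟩
  have hε := D.eps_pos
  have hB := D.bound_nonneg
  -- The additional weight `e^{t/(4ε)}` on squares turns `t²` into `O(ε²)`, and `1 - 2εθ'` still
  -- exceeds `1/4`.
  set θ' := θ₀ + 1 / (8 * ε) with hθ'
  have hle : θ₀ ≤ θ' := by
    have : 0 < 1 / (8 * ε) := by positivity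
    linarith
  have hk : 1 / 4 ≤ 1 - 2 * ε * θ' := by
    have h1 : 2 * ε * θ' = 2 * ε * θ₀ + 1 / 4 := by rw [hθ']; field_simp; ring
    linarith [D.half_le]
  have hθ0 : 0 < θ' + 0 := by linarith [D.gap₀.theta_pos]
  have hsrc : ∀ t ≤ 0, Real.exp (2 * θ' * t) * ∑ n ∈ S, 1 *
      (coeff e (F (u₀ t)) n - coeff e (F (u₀ 0)) n) ^ 2
        ≤ 32 * (L ^ 2 * (lam 1)⁻¹) * (ε ^ 2 * B) := by
    intro t ht
    have h1 : ∑ n ∈ S, 1 * (coeff e (F (u₀ t)) n - coeff e (F (u₀ 0)) n) ^ 2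
        ≤ L ^ 2 * ‖u₀ t - u₀ 0‖ ^ 2 := by
      simp only [one_mul, ← coeff_sub]
      refine (sum_coeff_sq_le e _ S).trans ?_
      rw [← mul_pow]
      exact pow_le_pow_left₀ (norm_nonneg _) (hF _ _) 2
    have h2 := D.norm_sub_zero_sq_le hpos hmono ht
    set x := -t / (4 * ε) with hx
    have hx0 : 0 ≤ x := div_nonneg (by linarith) (by positivity)
    have h3 : Real.exp (2 * θ' * t) * Real.exp (-(2 * θ₀ * t)) = Real.exp (-x) := by
      rw [← Real.exp_add]
      congr 1
      rw [hθ', hx]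
      field_simp
      ring
    have h4 : Real.exp (-x) * x ^ 2 ≤ 2 := by
      rw [Real.exp_neg, inv_mul_le_iff₀ (Real.exp_pos x)]
      linarith [Real.quadratic_le_exp_of_nonneg hx0]
    have h5 : t ^ 2 = 16 * ε ^ 2 * x ^ 2 := by rw [hx]; field_simp; norm_num
    calc _ ≤ Real.exp (2 * θ' * t) * (L ^ 2 *
          (t ^ 2 * (Real.exp (-(2 * θ₀ * t)) * ((lam 1)⁻¹ * B)))) := by
            gcongr
            exact h1.trans (by gcongr)
      _ = (Real.exp (2 * θ' * t) * Real.exp (-(2 * θ₀ * t))) * t ^ 2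
          * (L ^ 2 * (lam 1)⁻¹ * B) := by ring
      _ = (Real.exp (-x) * x ^ 2) * (16 * ε ^ 2 * (L ^ 2 * (lam 1)⁻¹ * B)) := by rw [h3, h5]; ring
      _ ≤ 2 * (16 * ε ^ 2 * (L ^ 2 * (lam 1)⁻¹ * B)) := by gcongr
      _ = _ := by ring
  have h := relaxation_sup_le (k := 1 / 4) hε (by norm_num) hk (S := S) (μ := fun _ => 1)
    (fun _ => zero_le_one)
    (y := fun n t => c n t + lam n * (coeff e (u₀ t) n - ε * c n t) - coeff e (F (u₀ 0)) n)
    (s := fun n t => coeff e (F (u₀ t)) n - coeff e (F (u₀ 0)) n)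
    (fun n => ?_) (fun n t ht => ?_) hsrc le_rfl
  · simp only [mul_zero, Real.exp_zero, one_mul] at h
    have h1 : ∀ n, c n 0 - z 0 n - ε * lam n * c n 0
        = c n 0 + lam n * (coeff e (u₀ 0) n - ε * c n 0) - coeff e (F (u₀ 0)) n := by
      intro n
      have := (D.sol₀ n).1.velocity_eq le_rfl
      simp only at this
      rw [this]
      ring
    simp only [h1]
    linarith
  · have h1 : WL2 θ' fun _ => coeff e (F (u₀ 0)) n := by
      simpa using (WL2.exp_mul hθ0 (coeff e (F (u₀ 0)) n)).1
    exact ((((D.corr n).add (((D.sol₀ n).1.disp.sub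
      ((D.corr n).const_mul ε)).const_mul (lam n))).mono_exponent hle).1).sub h1
  · have h1 := (D.sol₀ n).1.velocity_eq ht
    simp only at h1
    refine (((D.corr_deriv n t ht).add ((((D.sol₀ n).1.vel t ht).sub
      ((D.corr_deriv n t ht).const_mul ε)).const_mul (lam n))).sub_const _).congr_deriv ?_
    rw [h1]
    field_simp
    ring

/-- The distance between the two trajectories at `t = 0`. -/
theorem exists_difference_le (hpos : ∀ n, 0 < lam n) (hmono : Monotone lam)
    (hF : ∀ u₁ u₂ : H, ‖F u₁ - F u₂‖ ≤ L * ‖u₁ - u₂‖) (hF0 : F 0 = 0)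
    (hL0 : 0 ≤ L) (hL : L < (lam (N + 1) - lam N) / 2) :
    ∃ K, 0 ≤ K ∧ ∀ {ε θ θ₀ B : ℝ} {p : H} {u u₀ : ℝ → H} {v z : ℝ → ℕ+ → ℝ} {c : ℕ+ → ℝ → ℝ},
      ComparisonData e lam N F ε θ θ₀ B p u u₀ v z c → ∀ S : Finset ℕ+,
        ε * ∑ n ∈ S, (v 0 n - z 0 n) ^ 2 ≤ K * (ε ^ 2 * B) ∧
        ∑ n ∈ S, (lam n)⁻¹ * (v 0 n - z 0 n) ^ 2 ≤ K * (ε ^ 2 * B) ∧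
        ∑ n ∈ S, lam n * (coeff e (u 0) n - coeff e (u₀ 0) n) ^ 2 ≤ K * (ε ^ 2 * B) := by
  obtain ⟨K₁, hK₁, h₁⟩ := exists_energy_le (e := e) hpos hmono hF hF0 hL0 hL
  obtain ⟨K₂, hK₂, h₂⟩ := exists_vel_le (e := e) hpos hmono hF hF0 hL0 hL
  obtain ⟨K₃, hK₃, h₃⟩ := exists_defect_le (e := e) (N := N) hpos hmono hF
  have hl1 := hpos 1
  have hΛ := hpos (N + 1)
  have hlN := hpos N
  set r := (3 * lam (N + 1) + lam N)⁻¹ with hr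
  refine ⟨3 * (K₁ + r * K₃ + 1) + 3 * (K₂ + (lam 1)⁻¹ * K₃ + 2) + 2 * (K₁ + 2), by positivity,
    fun {ε θ θ₀ B p u u₀ v z c} D S => ?_⟩
  have hε := D.eps_pos
  have hB := D.bound_nonneg
  set T := ε ^ 2 * B with hT
  have hT0 : 0 ≤ T := by positivity
  -- The upper bound on `ε` absorbs the surplus factor in the `H` part of the norm.
  have hεr : ε ≤ r := by
    rw [hr, ← one_div, le_div_iff₀ (by positivity)]
    exact D.gap.eps_le
  have hen := h₁ D 0 le_rfl S
  rw [mul_zero, Real.exp_zero, one_mul, Finset.sum_add_distrib] at hen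
  have hV := h₂ D S
  have hk := h₃ D S
  have hc := D.corr_sup_le hpos le_rfl S
  rw [mul_zero, Real.exp_zero, one_mul] at hc
  have hc2 := D.sum_corr_zero_le S
  have hA : 0 ≤ ∑ n ∈ S, ε * (v 0 n - c n 0) ^ 2 :=
    Finset.sum_nonneg fun n _ => by positivity
  have hW : 0 ≤ ∑ n ∈ S, lam n * (coeff e (u 0) n - coeff e (u₀ 0) n + ε * c n 0) ^ 2 :=
    Finset.sum_nonneg fun n _ => mul_nonneg (hpos n).le (sq_nonneg _)
  -- The velocity difference splits into `v - c`, the defect `c - z - ε A c`, and `ε A c`.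
  have hsq : ∀ n, (v 0 n - z 0 n) ^ 2 ≤ 3 * (v 0 n - c n 0) ^ 2
      + 3 * (c n 0 - z 0 n - ε * lam n * c n 0) ^ 2 + 3 * (ε * lam n * c n 0) ^ 2 := by
    intro n
    set a := v 0 n - c n 0 with ha
    set b := c n 0 - z 0 n - ε * lam n * c n 0 with hb
    set d := ε * lam n * c n 0
    have : v 0 n - z 0 n = a + b + d := by rw [ha, hb]; ring
    rw [this]
    nlinarith [sq_nonneg (a - b), sq_nonneg (b - d), sq_nonneg (a - d)]
  have hX : 0 ≤ 3 * (K₁ + r * K₃ + 1) := by positivity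
  have hY : 0 ≤ 3 * (K₂ + (lam 1)⁻¹ * K₃ + 2) := by positivity
  have hZ : 0 ≤ 2 * (K₁ + 2) := by positivity
  have hcT := mul_le_mul_of_nonneg_left hc (sq_nonneg ε)
  have hcT2 := mul_le_mul_of_nonneg_left hc2 (sq_nonneg ε)
  refine ⟨?_, ?_, ?_⟩
  · have h4 : ε * ∑ n ∈ S, (v 0 n - z 0 n) ^ 2 ≤ 3 * ∑ n ∈ S, ε * (v 0 n - c n 0) ^ 2
        + 3 * (ε * ∑ n ∈ S, (c n 0 - z 0 n - ε * lam n * c n 0) ^ 2)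
        + 3 * (ε ^ 2 * (ε * ∑ n ∈ S, lam n ^ 2 * c n 0 ^ 2)) := by
      simp only [Finset.mul_sum]
      rw [← Finset.sum_add_distrib, ← Finset.sum_add_distrib]
      refine Finset.sum_le_sum fun n _ => ?_
      have := mul_le_mul_of_nonneg_left (hsq n) hε.le
      refine this.trans (le_of_eq ?_)
      ring
    have h5 : ε * ∑ n ∈ S, (c n 0 - z 0 n - ε * lam n * c n 0) ^ 2 ≤ r * (K₃ * T) := by gcongr
    calc _ ≤ 3 * (K₁ + r * K₃ + 1) * T := by linarith
      _ ≤ _ := mul_le_mul_of_nonneg_right (by linarith) hT0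
  · have h4 : ∑ n ∈ S, (lam n)⁻¹ * (v 0 n - z 0 n) ^ 2
        ≤ 3 * ∑ n ∈ S, (lam n)⁻¹ * (v 0 n - c n 0) ^ 2
        + 3 * ((lam 1)⁻¹ * ∑ n ∈ S, (c n 0 - z 0 n - ε * lam n * c n 0) ^ 2)
        + 3 * (ε ^ 2 * ∑ n ∈ S, lam n * c n 0 ^ 2) := by
      simp only [Finset.mul_sum]
      rw [← Finset.sum_add_distrib, ← Finset.sum_add_distrib]
      refine Finset.sum_le_sum fun n _ => ?_
      have hn := hpos n
      have h5 := inv_anti₀ hl1 (hmono (one_le (a := n)))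
      calc _ ≤ (lam n)⁻¹ * (3 * (v 0 n - c n 0) ^ 2
          + 3 * (c n 0 - z 0 n - ε * lam n * c n 0) ^ 2 + 3 * (ε * lam n * c n 0) ^ 2) := by
            gcongr
            exact hsq n
        _ = 3 * ((lam n)⁻¹ * (v 0 n - c n 0) ^ 2)
          + 3 * ((lam n)⁻¹ * (c n 0 - z 0 n - ε * lam n * c n 0) ^ 2)
          + 3 * (ε ^ 2 * (lam n * c n 0 ^ 2)) := by field_simp
        _ ≤ _ := by gcongr
    have h5 := mul_le_mul_of_nonneg_left hk (inv_pos.2 hl1).le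
    calc _ ≤ 3 * (K₂ + (lam 1)⁻¹ * K₃ + 2) * T := by linarith
      _ ≤ _ := mul_le_mul_of_nonneg_right (by linarith) hT0
  · have h4 : ∑ n ∈ S, lam n * (coeff e (u 0) n - coeff e (u₀ 0) n) ^ 2
        ≤ 2 * ∑ n ∈ S, lam n * (coeff e (u 0) n - coeff e (u₀ 0) n + ε * c n 0) ^ 2
        + 2 * (ε ^ 2 * ∑ n ∈ S, lam n * c n 0 ^ 2) := by
      simp only [Finset.mul_sum]
      rw [← Finset.sum_add_distrib]
      refine Finset.sum_le_sum fun n _ => ?_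
      have h5 : (coeff e (u 0) n - coeff e (u₀ 0) n) ^ 2
          ≤ 2 * (coeff e (u 0) n - coeff e (u₀ 0) n + ε * c n 0) ^ 2 + 2 * (ε ^ 2 * c n 0 ^ 2) := by
        nlinarith [sq_nonneg (coeff e (u 0) n - coeff e (u₀ 0) n + 2 * (ε * c n 0))]
      have := mul_le_mul_of_nonneg_left h5 (hpos n).le
      linarith
    calc _ ≤ 2 * (K₁ + 2) * T := by linarith
      _ ≤ _ := mul_le_mul_of_nonneg_right (by linarith) hT0

end ComparisonData

section Main

variable {H : Type*} [NormedAddCommGroup H] [InnerProductSpace ℝ H] [CompleteSpace H]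
  {e : HilbertBasis ℕ+ ℝ H} {lam : ℕ+ → ℝ} {N : ℕ+} {F : H → H} {L : ℝ}

theorem exists_energyNorm_sub_le (hpos : ∀ n, 0 < lam n) (hmono : Monotone lam)
    (hF : ∀ u₁ u₂ : H, ‖F u₁ - F u₂‖ ≤ L * ‖u₁ - u₂‖) (hF0 : F 0 = 0)
    (hL0 : 0 ≤ L) (hL : L < (lam (N + 1) - lam N) / 2) :
    ∃ C : ℝ, ∀ ε, 0 < ε → ε * (3 * lam (N + 1) + lam N) ≤ 1 → ∀ p ξ ξ₀,
      IsSlowBackwardSolution e lam F N ε p ξ → IsSlowBackwardSolution e lam F N 0 p ξ₀ →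
      MemEnergy e lam ε (ξ 0 - ξ₀ 0) ∧ energyNorm e lam ε (ξ 0 - ξ₀ 0) ≤ C * ε * ‖p‖ := by
  have hgap : lam N < lam (N + 1) := by linarith
  have G₀ := gapData_theta (hpos N) hgap le_rfl (by simp)
  obtain ⟨R, hR, hreg⟩ := exists_regularity (e := e) hpos hmono G₀ hF hF0 hL0 hL
  obtain ⟨K, hK, hdiff⟩ :=
    ComparisonData.exists_difference_le (e := e) hpos hmono hF hF0 hL0 hL
  refine ⟨Real.sqrt (3 * (K * (R + 1))), fun ε hε hle p ξ ξ₀ hξ hξ₀ => ?_⟩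
  have G := gapData_theta (hpos N) hgap hε.le hle
  obtain ⟨hu, M⟩ := hξ.modal hpos hmono G hF hF0
  obtain ⟨hu₀, M₀⟩ := hξ₀.modal hpos hmono G₀ hF hF0
  obtain ⟨hsup, hint⟩ := hreg p _ _ hu₀ M₀
  have hhalf : 0 < 1 - ε * theta lam N 0 := by
    have h1 : theta lam N 0 ≤ theta lam N ε := by
      have h2 := G.le_theta
      have h3 := G₀.root
      linarith
    have h4 := mul_le_mul_of_nonneg_left h1 hε.le
    linarith [G.half_pos]
  choose c hc hcd using fun n => exists_relaxation hε hhalf ((M₀ n).1.vint G₀)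
  -- The bound `(R + 1) ‖p‖²` dominates both the regularity constants and the datum itself.
  have hP := sq_nonneg ‖p‖
  have D : ComparisonData e lam N F ε (theta lam N ε) (theta lam N 0) ((R + 1) * ‖p‖ ^ 2) p
      (fun t => (ξ t).1) (fun t => (ξ₀ t).1) (fun t => (ξ t).2) (fun t => (ξ₀ t).2) c :=
    ⟨hε, G, G₀, hu, hu₀, M, M₀, hc, hcd, fun t ht S => (hsup t ht S).trans (by nlinarith),
      fun S => (hint S).trans (by nlinarith), by nlinarith⟩
  set T := K * (ε ^ 2 * ((R + 1) * ‖p‖ ^ 2)) with hT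
  set a := ξ 0 - ξ₀ 0 with ha
  -- The division by `ε` is harmless: the `H` part of the energy norm carries the factor `ε`.
  have h0 : ∀ S : Finset ℕ+, ∑ n ∈ S, lam n ^ (0 : ℝ) * a.2 n ^ 2 ≤ T / ε := by
    intro S
    simp only [Real.rpow_zero, one_mul]
    rw [le_div_iff₀ hε, mul_comm]
    exact (hdiff D S).1
  have h1 : ∀ S : Finset ℕ+, ∑ n ∈ S, lam n ^ (-1 : ℝ) * a.2 n ^ 2 ≤ T := by
    intro S
    simp only [Real.rpow_neg_one]
    exact (hdiff D S).2.1
  have h2 : ∀ S : Finset ℕ+, ∑ n ∈ S, lam n ^ (1 : ℝ) * coeff e a.1 n ^ 2 ≤ T := by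
    intro S
    simp only [Real.rpow_one, ha, Prod.fst_sub, coeff_sub]
    exact (hdiff D S).2.2
  have hnn : ∀ (s : ℝ) (b : ℕ+ → ℝ) n, 0 ≤ lam n ^ s * b n ^ 2 := fun s b n =>
    mul_nonneg (Real.rpow_nonneg (hpos n).le _) (sq_nonneg _)
  refine ⟨⟨summable_of_sum_le (hnn _ _) h2, summable_of_sum_le (hnn _ _) h1,
    fun _ => summable_of_sum_le (hnn _ _) h0⟩, ?_⟩
  have n0 : ε * normSqHs lam 0 a.2 ≤ T := by
    have := Real.tsum_le_of_sum_le (hnn _ _) h0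
    rw [le_div_iff₀ hε, mul_comm] at this
    exact this
  have n1 : normSqHs lam (-1) a.2 ≤ T := Real.tsum_le_of_sum_le (hnn _ _) h1
  have n2 : normSqHs lam 1 (coeff e a.1) ≤ T := Real.tsum_le_of_sum_le (hnn _ _) h2
  have h3 : Real.sqrt (3 * (K * (R + 1))) * ε * ‖p‖ = Real.sqrt (3 * T) := by
    have : 3 * T = 3 * (K * (R + 1)) * (ε * ‖p‖) ^ 2 := by rw [hT]; ring
    rw [this, Real.sqrt_mul (x := 3 * (K * (R + 1))) (by positivity), Real.sqrt_sq (by positivity)]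
    ring
  rw [h3]
  exact Real.sqrt_le_sqrt (by linarith)

lemma manifoldMap_eq {ε : ℝ} {p : H} (h : UniquelySolvable e lam F N ε p) :
    ∃ ξ, IsSlowBackwardSolution e lam F N ε p ξ ∧ manifoldMap e lam F N ε p = ξ 0 := by
  refine ⟨h.1.choose, h.1.choose_spec, ?_⟩
  rw [manifoldMap, dif_pos h.1]

lemma IsEigenSystem.pos {A : H →ₗ.[ℝ] H} (hA : IsPositiveSelfAdjointCompactInv A)
    (he : IsEigenSystem A e lam) (n : ℕ+) : 0 < lam n := by
  obtain ⟨h, h1⟩ := he.eigen n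
  have hne : e n ≠ 0 := e.orthonormal.ne_zero n
  have h2 := hA.pos ⟨e n, h⟩ fun h0 => hne (congrArg Subtype.val h0)
  rw [h1, real_inner_smul_left, real_inner_self_eq_norm_sq, e.orthonormal.1 n] at h2
  simpa using h2

end Main

end HypRelax

theorem theorem2p2 {H : Type*} [NormedAddCommGroup H] [InnerProductSpace ℝ H] [CompleteSpace H]
    (A : H →ₗ.[ℝ] H) (hA : HypRelax.IsPositiveSelfAdjointCompactInv A)
    (e : HilbertBasis ℕ+ ℝ H) (lam : ℕ+ → ℝ) (he : HypRelax.IsEigenSystem A e lam)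
    (F : H → H) (L : ℝ) (hF : ∀ u₁ u₂ : H, ‖F u₁ - F u₂‖ ≤ L * ‖u₁ - u₂‖) (hF0 : F 0 = 0)
    (N : ℕ+) (hgap : lam (N + 1) - lam N > 2 * L) :
    ∃ C : ℝ, ∀ ε : ℝ, 0 < ε → 3 * lam (N + 1) + lam N ≤ 1 / ε →
      ∀ p ∈ HypRelax.spanPN e N,
        HypRelax.UniquelySolvable e lam F N ε p ∧
        HypRelax.UniquelySolvable e lam F N 0 p ∧
        HypRelax.MemEnergy e lam ε
          (HypRelax.manifoldMap e lam F N ε p - HypRelax.manifoldMap e lam F N 0 p) ∧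
        HypRelax.energyNorm e lam ε
          (HypRelax.manifoldMap e lam F N ε p - HypRelax.manifoldMap e lam F N 0 p)
            ≤ C * ε * ‖p‖ := by
  have hpos := fun n => he.pos hA n
  -- Testing the Lipschitz bound on the unit vector `e 1` and `0` gives `L ≥ 0`.
  have hL0 : 0 ≤ L := by
    have h := (norm_nonneg _).trans (hF (e 1) 0)
    rwa [sub_zero, e.orthonormal.1 1, mul_one] at h
  have hL : L < (lam (N + 1) - lam N) / 2 := by linarith
  have hlt : lam N < lam (N + 1) := by linarith
  obtain ⟨C, hC⟩ := HypRelax.exists_energyNorm_sub_le (e := e) hpos he.mono hF hF0 hL0 hL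
  refine ⟨C, fun ε hε hle p hp => ?_⟩
  have hle' : ε * (3 * lam (N + 1) + lam N) ≤ 1 := by
    rwa [le_div_iff₀ hε, mul_comm] at hle
  have U := HypRelax.uniquelySolvable hpos he.mono
    (HypRelax.gapData_theta (hpos N) hlt hε.le hle') hF hF0 hL0 hL hp
  have U₀ := HypRelax.uniquelySolvable hpos he.mono
    (HypRelax.gapData_theta (hpos N) hlt le_rfl (by simp)) hF hF0 hL0 hL hp
  obtain ⟨ξ, hξ, h1⟩ := HypRelax.manifoldMap_eq U
  obtain ⟨ξ₀, hξ₀, h2⟩ := HypRelax.manifoldMap_eq U₀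
  rw [h1, h2]
  exact ⟨U, U₀, hC ε hε hle' p ξ ξ₀ hξ hξ₀⟩
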